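/- **Setting.** Let $p\neq 0$ and $q$ be integers, $Z=\begin{pmatrix}1&q\\0&p\end{pmatrix}$. The symmetric space $G_{2(2)}/SO(4)\cong\mathbb R^8$, with coordinates $(u,v,w,\zeta^1,\zeta^2,\chi,\psi^1,\psi^2)$, carries the Riemannian metric $$G=12du^2+\cosh^2\! w\,dv^2+dw^2+p^2\tfrac{e^{-6u-v}}{\cosh w}(\bar\Theta^1)^2+p^2e^{-6u+v}\cosh w\,(e^{-v}\tanh w\,\bar\Theta^1-\bar\Theta^2)^2+\tfrac{e^{-2u-v}}{\cosh w}(d\bar\psi^1)^2+e^{-2u+v}\cosh w\,(e^{-v}\tanh w\,d\bar\psi^1-d\bar\psi^2)^2+p^2e^{-4u}\Upsilon^2,$$ where $\Upsilon=d\chi+\frac1{\sqrt3}(\psi^1d\psi^2-\psi^2d\psi^1)$, $\Theta^i=d\zeta^i+\psi^i\big(d\chi+\frac1{3\sqrt3}(\psi^1d\psi^2-\psi^2d\psi^1)\big)$, $\bar\Theta=Z^T\Theta$, $\bar\psi=Z^T\psi$. Let $\mathrm{dist}$ be its Riemannian distance. On $S^3$ use Hopf coordinates $(\theta,\phi^1,\phi^2)$,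 $\theta\in[0,\pi]$, in which the round metric is $\frac{d\theta^2}{4}+\sin^2\frac\theta2(d\phi^1)^2+\cos^2\frac\theta2(d\phi^2)^2$ and $d\mathcal V=\frac{\sin\theta}{4}d\theta\,d\phi^1d\phi^2$. Let $\Gamma$ be the union of the two circles $\theta=0$ and $\theta=\pi$ (the poles). Let $\Lambda\ge0$ and $A$ be real constants and let $\xi=\xi(\cos\theta)\ge1$, where $\xi$ is a smooth function on $[-1,1]$. For an open set $\Omega\subset S^3$ with $\Omega\cap\Gamma=\emptyset$ and a map $\tilde\Psi=(u,\dots,\psi^2):\Omega\to G_{2(2)}/SO(4)$ that is bi-axisymmetric (a function of $\theta$ only) let $$E_\Omega(\tilde\Psi)=\frac1{\pi^2}\int_\Omega\xi\Big\{G(\partial_\theta\tilde\Psi,\partial_\theta\tilde\Psi)+3p^2\Lambda\Big(\frac{A}{2\sqrt2\,\pi^2}\Big)^2e^{-4u}\sin^2\theta\Big\}\,d\mathcal V$$ be its quasi-harmonic energy. **Proposition.** Let $\tilde\Psi^t:\Omega\to G_{2(2)}/SO(4)$, $t\in[0,1]$, be a smooth family (smooth on $[0,1]\times\Omega$) of bi-axisymmetric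 maps such that $t\mapsto\tilde\Psi^t(x)$ is a geodesic of $G$ on $[0,1]$ for every $x\in\Omega$. Consider the inequality $$\frac{d^2}{dt^2}E_\Omega(\tilde\Psi^t)\ \ge\ \frac1{2\pi^2}\int_\Omega\big|\nabla\,\mathrm{dist}(\tilde\Psi^1,\tilde\Psi^0)\big|^2\,d\mathcal V.\qquad(*)$$ 1. If $\overline\Omega\cap\Gamma=\emptyset$ and the family extends smoothly to a neighbourhood of $\overline\Omega$, then the energies are finite, $t\mapsto E_\Omega(\tilde\Psi^t)$ is $C^2$ on $[0,1]$, the integral on the right of $(*)$ is finite, and $(*)$ holds for all $t\in[0,1]$. 2. For general $\Omega$ with $\Omega\cap\Gamma=\emptyset$: if $E_\Omega(\tilde\Psi^t)<\infty$ for all $t\in[0,1]$, then the integral on the right of $(*)$ is finite, and $(*)$ holds at every $t\in[0,1]$ at which $t\mapsto E_\Omega(\tilde\Psi^t)$ is twice differentiable (one-sidedly at $t=0,1$). 3. Along every geodesic $\gamma:[0,1]\to G_{2(2)}/SO(4)$ the function $t\mapsto e^{-4u(\gamma(t))}$ is convex. -/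

import Mathlib

open Set MeasureTheory Filter Topology
open scoped ContDiff

noncomputable section

namespace QuasiHarmonic

/-! ### The target space `G_{2(2)}/SO(4) ≅ ℝ⁸` -/

/-- Global coordinates `(u, v, w, ζ¹, ζ², χ, ψ¹, ψ²)` on the target `G_{2(2)}/SO(4) ≅ ℝ⁸`.
Tangent vectors at any point are written in the same coordinates. -/
abbrev Target : Type := Fin 8 → ℝ

/-- The 1-form `ψ¹ dψ² - ψ² dψ¹` at `x`, applied to the tangent vector `a`. -/
def psiWedge (x a : Target) : ℝ := x 6 * a 7 - x 7 * a 6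

/-- The 1-form `Υ = dχ + (1/√3) (ψ¹ dψ² - ψ² dψ¹)`. -/
def Upsilon (x a : Target) : ℝ := a 5 + 1 / √3 * psiWedge x a

/-- The 1-form `Θ¹ = dζ¹ + ψ¹ (dχ + (1/(3√3)) (ψ¹ dψ² - ψ² dψ¹))`. -/
def Theta1 (x a : Target) : ℝ := a 3 + x 6 * (a 5 + 1 / (3 * √3) * psiWedge x a)

/-- The 1-form `Θ² = dζ² + ψ² (dχ + (1/(3√3)) (ψ¹ dψ² - ψ² dψ¹))`. -/
def Theta2 (x a : Target) : ℝ := a 4 + x 7 * (a 5 + 1 / (3 * √3) * psiWedge x a)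

/-- First component of `Zᵀ (α¹, α²)`, where `Z = !![1, q; 0, p]`. -/
def bar1 (α₁ _α₂ : ℝ) : ℝ := α₁

/-- Second component of `Zᵀ (α¹, α²)`, where `Z = !![1, q; 0, p]`. -/
def bar2 (p q : ℤ) (α₁ α₂ : ℝ) : ℝ := q * α₁ + p * α₂

/-- The 1-form `Θ̄¹`, where `Θ̄ = Zᵀ Θ`. -/
def ThetaBar1 (x a : Target) : ℝ := bar1 (Theta1 x a) (Theta2 x a)

/-- The 1-form `Θ̄²`, where `Θ̄ = Zᵀ Θ`. -/
def ThetaBar2 (p q : ℤ) (x a : Target) : ℝ := bar2 p q (Theta1 x a) (Theta2 x a)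

/-- The 1-form `dψ̄¹`, where `ψ̄ = Zᵀ ψ`. -/
def dPsiBar1 (a : Target) : ℝ := bar1 (a 6) (a 7)

/-- The 1-form `dψ̄²`, where `ψ̄ = Zᵀ ψ`. -/
def dPsiBar2 (p q : ℤ) (a : Target) : ℝ := bar2 p q (a 6) (a 7)

/-- The symmetric-space Riemannian metric of `G_{2(2)}/SO(4)` at the point `x`, as a bilinear form:
`12 du² + cosh² w dv² + dw² + p² e^{-6u-v}/cosh w (Θ̄¹)²
  + p² e^{-6u+v} cosh w (e^{-v} tanh w Θ̄¹ - Θ̄²)² + e^{-2u-v}/cosh w (dψ̄¹)²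
  + e^{-2u+v} cosh w (e^{-v} tanh w dψ̄¹ - dψ̄²)² + p² e^{-4u} Υ²`.
With `λ = Z⁻ᵀ λ̄ Z⁻¹` and `λ̄ = e^{2u} !![e^v cosh w, sinh w; sinh w, e^{-v} cosh w]` it is
`(d det λ)² / (2 (det λ)²) + Tr((λ⁻¹dλ)²) / 2 + Θᵀλ⁻¹Θ / det λ + Υ² / det λ + dψᵀλ⁻¹dψ`. -/
def metric (p q : ℤ) (x a b : Target) : ℝ :=
  12 * (a 0 * b 0) + Real.cosh (x 2) ^ 2 * (a 1 * b 1) + a 2 * b 2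
  + (p : ℝ) ^ 2 * (Real.exp (-6 * x 0 - x 1) / Real.cosh (x 2)) * (ThetaBar1 x a * ThetaBar1 x b)
  + (p : ℝ) ^ 2 * Real.exp (-6 * x 0 + x 1) * Real.cosh (x 2)
    * ((Real.exp (-x 1) * Real.tanh (x 2) * ThetaBar1 x a - ThetaBar2 p q x a)
      * (Real.exp (-x 1) * Real.tanh (x 2) * ThetaBar1 x b - ThetaBar2 p q x b))
  + Real.exp (-2 * x 0 - x 1) / Real.cosh (x 2) * (dPsiBar1 a * dPsiBar1 b)
  + Real.exp (-2 * x 0 + x 1) * Real.cosh (x 2)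
    * ((Real.exp (-x 1) * Real.tanh (x 2) * dPsiBar1 a - dPsiBar2 p q a)
      * (Real.exp (-x 1) * Real.tanh (x 2) * dPsiBar1 b - dPsiBar2 p q b))
  + (p : ℝ) ^ 2 * Real.exp (-4 * x 0) * (Upsilon x a * Upsilon x b)

/-- The coordinate vector field `∂_B`. -/
def coordVec (B : Fin 8) : Target := Pi.single B 1

/-- The matrix `(G_{BC})` of the metric in the global coordinates. -/
def gram (p q : ℤ) (x : Target) : Matrix (Fin 8) (Fin 8) ℝ :=
  Matrix.of fun B C => metric p q x (coordVec B) (coordVec C)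

/-- The partial derivative `∂_D G_{BC}` at `x`. -/
def dGram (p q : ℤ) (x : Target) (D B C : Fin 8) : ℝ :=
  fderiv ℝ (fun y : Target => gram p q y B C) x (coordVec D)

/-- The Christoffel symbols
`Γ^M_{BC} = (1/2) ∑_D G^{MD} (∂_B G_{DC} + ∂_C G_{DB} - ∂_D G_{BC})` of the Levi-Civita connection. -/
def christoffel (p q : ℤ) (x : Target) (M B C : Fin 8) : ℝ :=
  1 / 2 * ∑ D, (gram p q x)⁻¹ M D * (dGram p q x B D C + dGram p q x C D B - dGram p q x D B C)

/-- `γ : [0,1] → G_{2(2)}/SO(4)` is an (affinely parametrized) geodesic: it is `C²` on `[0,1]` and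
`γ̈^M + Γ^M_{BC} γ̇^B γ̇^C = 0` there. -/
def IsGeodesic (p q : ℤ) (γ : ℝ → Target) : Prop :=
  ContDiffOn ℝ 2 γ (Icc 0 1) ∧
  ∀ t ∈ Icc (0 : ℝ) 1, ∀ M : Fin 8,
    derivWithin (derivWithin γ (Icc 0 1)) (Icc 0 1) t M
      + ∑ B, ∑ C, christoffel p q (γ t) M B C
          * derivWithin γ (Icc 0 1) t B * derivWithin γ (Icc 0 1) t C = 0

/-- The length of a `C¹` curve `γ : [0,1] → G_{2(2)}/SO(4)`. -/
def curveLength (p q : ℤ) (γ : ℝ → Target) : ℝ :=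
  ∫ t in (0 : ℝ)..1,
    √(metric p q (γ t) (derivWithin γ (Icc 0 1) t) (derivWithin γ (Icc 0 1) t))

/-- The Riemannian distance of `G_{2(2)}/SO(4)`: the infimum of the lengths of the `C¹` curves
joining the two points. -/
def targetDist (p q : ℤ) (x y : Target) : ℝ :=
  sInf {ℓ : ℝ | ∃ γ : ℝ → Target,
    ContDiffOn ℝ 1 γ (Icc 0 1) ∧ γ 0 = x ∧ γ 1 = y ∧ ℓ = curveLength p q γ}

/-! ### The round 3-sphere in Hopf coordinates -/

/-- The unit sphere `S³ ⊂ ℂ²`. -/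
abbrev S3 : Type := Metric.sphere (0 : EuclideanSpace ℂ (Fin 2)) 1

/-- The point of `ℂ²` with Hopf coordinates `c = (θ, φ¹, φ²)`:
`(sin(θ/2) e^{iφ¹}, cos(θ/2) e^{iφ²})`. -/
def hopfVec (c : ℝ × ℝ × ℝ) : EuclideanSpace ℂ (Fin 2) :=
  WithLp.toLp 2 ![(Real.sin (c.1 / 2) : ℂ) * Complex.exp (c.2.1 * Complex.I),
    (Real.cos (c.1 / 2) : ℂ) * Complex.exp (c.2.2 * Complex.I)]

theorem norm_hopfVec (c : ℝ × ℝ × ℝ) : ‖hopfVec c‖ = 1 := by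
  simp [hopfVec, EuclideanSpace.norm_eq, Complex.norm_exp_ofReal_mul_I, -Complex.ofReal_sin,
    -Complex.ofReal_cos, Complex.norm_real]

/-- Hopf coordinates `(θ, φ¹, φ²) ↦ (sin(θ/2) e^{iφ¹}, cos(θ/2) e^{iφ²})` on `S³`. In them the round
metric is `dθ²/4 + sin²(θ/2) (dφ¹)² + cos²(θ/2) (dφ²)²`. -/
def hopf (c : ℝ × ℝ × ℝ) : S3 := ⟨hopfVec c, by simp [norm_hopfVec]⟩

/-- The set `Γ ⊂ S³` of poles: the union of the two circles `θ = 0` and `θ = π`. -/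
def poles : Set S3 := {x | x.1 0 = 0 ∨ x.1 1 = 0}

/-- All Hopf coordinates `(θ, φ¹, φ²)`, `0 < θ < π`, `φⁱ ∈ ℝ`, of the points of `Ω \ Γ`. -/
def coordSet (Ω : Set S3) : Set (ℝ × ℝ × ℝ) := {c | c.1 ∈ Ioo 0 Real.pi ∧ hopf c ∈ Ω}

/-- The Hopf coordinates of the points of `Ω \ Γ` in one period, `0 < θ < π`, `0 ≤ φⁱ < 2π`. -/
def coordBox (Ω : Set S3) : Set (ℝ × ℝ × ℝ) :=
  coordSet Ω ∩ {c | c.2.1 ∈ Ico 0 (2 * Real.pi) ∧ c.2.2 ∈ Ico 0 (2 * Real.pi)}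

/-- `∫_Ω f d𝒱` with `d𝒱 = (sin θ / 4) dθ dφ¹ dφ²`, for `f` given in Hopf coordinates
(`Γ` is a null set). -/
def sphereIntegral (Ω : Set S3) (f : ℝ × ℝ × ℝ → ℝ) : ℝ :=
  ∫ c in coordBox Ω, f c * (Real.sin c.1 / 4)

/-- `f`, given in Hopf coordinates, is integrable over `Ω` with respect to `d𝒱`. -/
def SphereIntegrable (Ω : Set S3) (f : ℝ × ℝ × ℝ → ℝ) : Prop :=
  IntegrableOn (fun c => f c * (Real.sin c.1 / 4)) (coordBox Ω)

/-- `|∇f|²` for the round metric of `S³`, in Hopf coordinates: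
`4 (∂_θ f)² + (∂_{φ¹} f)² / sin²(θ/2) + (∂_{φ²} f)² / cos²(θ/2)`. -/
def gradSq (f : S3 → ℝ) (c : ℝ × ℝ × ℝ) : ℝ :=
  4 * deriv (fun θ => f (hopf (θ, c.2.1, c.2.2))) c.1 ^ 2
  + deriv (fun φ => f (hopf (c.1, φ, c.2.2))) c.2.1 ^ 2 / Real.sin (c.1 / 2) ^ 2
  + deriv (fun φ => f (hopf (c.1, c.2.1, φ))) c.2.2 ^ 2 / Real.cos (c.1 / 2) ^ 2

/-! ### Maps and energy -/

/-- The family of maps `Ψ t : Ω → G_{2(2)}/SO(4)`, `t ∈ [0,1]`, is smooth on `[0,1] × Ω`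
(for `Ω` avoiding the poles, where Hopf coordinates are local coordinates). -/
def SmoothFamilyOn (Ψ : ℝ → S3 → Target) (Ω : Set S3) : Prop :=
  ContDiffOn ℝ ∞ (fun z : ℝ × ℝ × ℝ × ℝ => Ψ z.1 (hopf z.2)) (Icc 0 1 ×ˢ coordSet Ω)

/-- The map `Φ` is bi-axisymmetric on `Ω`: it is a function of the Hopf coordinate `θ` alone, that
is, of `|z₁| = sin(θ/2)`. -/
def BiaxisymmetricOn (Φ : S3 → Target) (Ω : Set S3) : Prop :=
  ∀ x ∈ Ω, ∀ y ∈ Ω, ‖x.1 0‖ = ‖y.1 0‖ → Φ x = Φ y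

/-- `∂_θ Φ` in Hopf coordinates. -/
def dTheta (Φ : S3 → Target) (c : ℝ × ℝ × ℝ) : Target :=
  deriv (fun θ => Φ (hopf (θ, c.2.1, c.2.2))) c.1

/-- The integrand `ξ {G(∂_θ Φ, ∂_θ Φ) + 3 p² Λ (A / (2√2 π²))² e^{-4u} sin² θ}` of the
quasi-harmonic energy; `ξ` is a function of `cos θ`. -/
def energyDensity (p q : ℤ) (Λ A : ℝ) (ξ : ℝ → ℝ) (Φ : S3 → Target) (c : ℝ × ℝ × ℝ) : ℝ :=
  ξ (Real.cos c.1) *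
    (metric p q (Φ (hopf c)) (dTheta Φ c) (dTheta Φ c)
      + 3 * (p : ℝ) ^ 2 * Λ * (A / (2 * √2 * Real.pi ^ 2)) ^ 2
          * Real.exp (-4 * Φ (hopf c) 0) * Real.sin c.1 ^ 2)

/-- The quasi-harmonic energy `E_Ω(Φ)`. -/
def energy (p q : ℤ) (Λ A : ℝ) (ξ : ℝ → ℝ) (Ω : Set S3) (Φ : S3 → Target) : ℝ :=
  1 / Real.pi ^ 2 * sphereIntegral Ω (energyDensity p q Λ A ξ Φ)

/-- The quasi-harmonic energy of `Φ` on `Ω` is finite. -/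
def FiniteEnergy (p q : ℤ) (Λ A : ℝ) (ξ : ℝ → ℝ) (Ω : Set S3) (Φ : S3 → Target) : Prop :=
  SphereIntegrable Ω (energyDensity p q Λ A ξ Φ)

/-- `|∇ dist(Φ₁, Φ₀)|²` in Hopf coordinates. -/
def gradDistSq (p q : ℤ) (Φ₁ Φ₀ : S3 → Target) : ℝ × ℝ × ℝ → ℝ :=
  gradSq (fun x => targetDist p q (Φ₁ x) (Φ₀ x))

end QuasiHarmonic

end

open QuasiHarmonic

noncomputable section

open scoped Matrix Matrix.Norms.Frobenius

namespace QuasiHarmonic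

/-! ### Matrix calculus and the symmetric part of `𝔤₂` in seven dimensions -/

section

variable {n : Type*} [Fintype n] [DecidableEq n]

/-! The target is realised inside the positive definite 7×7 matrices. In the seven-dimensional
representation of G₂ the coset representative V = `coset` satisfies dV = QV with Q in a parabolic
subalgebra. Hence M = `spd` = VᵀV has dM = VᵀPV, where P = Q + Qᵀ depends linearly on an orthogonal
coframe, and `metric_eq_mc` identifies G with ¼ tr (M⁻¹dM)². The Cartan relation `pmat_pvec_comm`
makes the image totally geodesic, in the following form: W = M⁻¹∂ₜM is constant along every geodesic
(`IsGeodesic.mc_deriv`), so M(t) = M(0) exp(tW).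

Three facts follow. First, p²e^{-4u} is the top left entry of M, and M'' = MW² = (VW)ᵀ(VW) has
nonnegative diagonal; this is `IsGeodesic.convexOn_exp`. Second, geodesics minimise length
(`IsGeodesic.targetDist_eq`): by `norm_log_le_length`, the norm of the logarithm of a positive
definite matrix changes along a curve no faster than the arc length, so dist(Ψ¹, Ψ⁰) is the speed
½√tr W². Third, put K = M⁻¹∂_θM and X = ∂_θW for a family of geodesics. Then ∂ₜK = X + [K, W], and e
= ¼ tr K² has e'' = ½ tr((X + [K, W])X). Nonpositive curvature and Cauchy-Schwarz
(`jacobi_inequality`) give e'' ≥ 2(∂_θ dist)², so e − (∂_θ dist)²t² is convex in t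
(`convexOn_density`).

Bi-axisymmetry gives |∇dist|² = 4(∂_θ dist)². Since ξ ≥ 1 and Λ ≥ 0, the energy density minus
¼|∇dist|²t² is pointwise convex in t (`convexOn_energyDensity_sub`). Convexity passes to the
integral without differentiating under it, so finite energy suffices; the values at t = 0, ½, 1
already bound ∫|∇dist|². Where the energy has a second derivative, convexity and (t²)'' = 2 yield
the constant 1/(2π²). If the closure of Ω misses the poles, the coordinate domain is relatively
compact and differentiation under the integral gives C². -/

theorem hasDerivWithinAt_matrix_iff {A : ℝ → Matrix n n ℝ} {A' : Matrix n n ℝ} {s : Set ℝ} {t : ℝ} :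
    HasDerivWithinAt A A' s t ↔ ∀ i j, HasDerivWithinAt (fun r => A r i j) (A' i j) s t := by
  constructor
  · intro h i j
    have := (Matrix.entryLinearMap ℝ ℝ i j (m := n) (n := n)).toContinuousLinearMap.hasFDerivAt.comp_hasDerivWithinAt t h
    exact this
  · intro h
    have e : ∀ B : Matrix n n ℝ, B = ∑ i, ∑ j, B i j • Matrix.single i j (1:ℝ) := fun B => by
      conv_lhs => rw [Matrix.matrix_eq_sum_single B]
      simp [Matrix.smul_single]
    rw [e A', funext fun r => e (A r)]
    exact HasDerivWithinAt.fun_sum fun i _ => HasDerivWithinAt.fun_sum fun j _ => (h i j).smul_const _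

theorem contDiff_matrix {E : Type*} [NormedAddCommGroup E] [NormedSpace ℝ E] {A : E → Matrix n n ℝ} {N : WithTop ℕ∞}
   (h : ∀ i j, ContDiff ℝ N (fun r => A r i j)) : ContDiff ℝ N A := by
    have e : ∀ B : Matrix n n ℝ, B = ∑ i, ∑ j, B i j • Matrix.single i j (1:ℝ) := fun B => by
      conv_lhs => rw [Matrix.matrix_eq_sum_single B]
      simp [Matrix.smul_single]
    rw [funext fun r => e (A r)]
    exact ContDiff.sum fun i _ => ContDiff.sum fun j _ => (h i j).smul contDiff_const

def kk : ℝ := 1 / √3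
def ss : ℝ := √2 / √3
theorem kk_mul : kk * kk = 1 / 3 := by
  rw [kk, div_mul_div_comm, one_mul, Real.mul_self_sqrt (by norm_num)]
theorem ss_mul : ss * ss = 2 / 3 := by
  rw [ss, div_mul_div_comm, Real.mul_self_sqrt (by norm_num), Real.mul_self_sqrt (by norm_num)]

/-- The unipotent radical of the parabolic, on ℝ⁷ with block sizes 1, 2, 1, 2, 1. It is graded with
g in degree 1, h in degree 2 and f in degree 3; these slots will carry dψ, Υ and Θ. -/
def nilp (f₁ f₂ h g₁ g₂ : ℝ) : Matrix (Fin 7) (Fin 7) ℝ :=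
  !![0, -(kk * g₂), kk * g₁, ss * h, -f₁, -f₂, 0;
     0, 0, 0, ss * g₁, 0, kk * h, f₁;
     0, 0, 0, ss * g₂, -(kk * h), 0, f₂;
     0, 0, 0, 0, ss * g₁, ss * g₂, ss * h;
     0, 0, 0, 0, 0, 0, kk * g₂;
     0, 0, 0, 0, 0, 0, -(kk * g₁);
     0, 0, 0, 0, 0, 0, 0]

/-- The Levi factor 𝔤𝔩₂, acting on the five blocks by trace, standard, zero, dual of standard, and
minus the trace. -/
def glp (a b c d : ℝ) : Matrix (Fin 7) (Fin 7) ℝ :=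
  !![a + d, 0, 0, 0, 0, 0, 0;
     0, a, b, 0, 0, 0, 0;
     0, c, d, 0, 0, 0, 0;
     0, 0, 0, 0, 0, 0, 0;
     0, 0, 0, 0, -a, -c, 0;
     0, 0, 0, 0, -b, -d, 0;
     0, 0, 0, 0, 0, 0, -(a + d)]

/-- The parameter κ is the infinitesimal rotation in the Levi factor. It is antisymmetric, so it
drops out of the symmetric part and contributes nothing to the metric. -/
def parab (x : Fin 8 → ℝ) (κ : ℝ) : Matrix (Fin 7) (Fin 7) ℝ :=
  glp (-x 0 - x 1 / 2) (-x 2 / 2 - κ / 2) (-x 2 / 2 + κ / 2) (-x 0 + x 1 / 2)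
    + nilp (x 3) (x 4) (x 5) (x 6) (x 7)

def pmat (x : Fin 8 → ℝ) : Matrix (Fin 7) (Fin 7) ℝ := parab x 0 + (parab x 0)ᵀ

theorem parab_add_transpose (x κ) : parab x κ + (parab x κ)ᵀ = pmat x := by
  ext i j
  fin_cases i <;> fin_cases j <;> simp [pmat, parab, glp, nilp] <;> ring

theorem trace_pmat (x y) : (pmat x * pmat y).trace = 4 * (12 * (x 0 * y 0) + ∑ i : Fin 7, x i.succ * y i.succ) := by
  have h1 := kk_mul
  have h2 := ss_mul
  simp [pmat, parab, glp, nilp, Matrix.trace, Matrix.mul_apply, Fin.sum_univ_succ]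
  have e : Fin.succ (5:Fin 7) = 6 := rfl
  grind

theorem parab_eq (x : Fin 8 → ℝ) (κ : ℝ) : parab x κ =
  !![-2 * x 0, -(kk * x 7), kk * x 6, ss * x 5, -x 3, -x 4, 0;
     0, -x 0 - x 1 / 2, -x 2 / 2 - κ / 2, ss * x 6, 0, kk * x 5, x 3;
     0, -x 2 / 2 + κ / 2, -x 0 + x 1 / 2, ss * x 7, -(kk * x 5), 0, x 4;
     0, 0, 0, 0, ss * x 6, ss * x 7, ss * x 5;
     0, 0, 0, 0, x 0 + x 1 / 2, x 2 / 2 - κ / 2, kk * x 7;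
     0, 0, 0, 0, x 2 / 2 + κ / 2, x 0 - x 1 / 2, -(kk * x 6);
     0, 0, 0, 0, 0, 0, 2 * x 0] := by
  ext i j
  fin_cases i <;> fin_cases j <;> simp [parab, glp, nilp] <;> ring

theorem pmat_eq (x : Fin 8 → ℝ) : pmat x =
  !![-4 * x 0, -(kk * x 7), kk * x 6, ss * x 5, -x 3, -x 4, 0;
     -(kk * x 7), -2 * x 0 - x 1, -x 2, ss * x 6, 0, kk * x 5, x 3;
     kk * x 6, -x 2, -2 * x 0 + x 1, ss * x 7, -(kk * x 5), 0, x 4;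
     ss * x 5, ss * x 6, ss * x 7, 0, ss * x 6, ss * x 7, ss * x 5;
     -x 3, 0, -(kk * x 5), ss * x 6, 2 * x 0 + x 1, x 2, kk * x 7;
     -x 4, kk * x 5, 0, ss * x 7, x 2, 2 * x 0 - x 1, -(kk * x 6);
     0, x 3, x 4, ss * x 5, kk * x 7, -(kk * x 6), 4 * x 0] := by
  rw [pmat, parab_eq]
  ext i j
  fin_cases i <;> fin_cases j <;> simp [Matrix.transpose_apply] <;> ring

/-- A left inverse of `pmat` that reads each coordinate from one or two entries. The factor 3 * kk
inverts kk, because kk² = 1/3. -/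
def pvec (C : Matrix (Fin 7) (Fin 7) ℝ) : Fin 8 → ℝ :=
  ![-C 0 0 / 4, (C 2 2 - C 1 1) / 2, -C 1 2, C 1 6, C 2 6, 3 * kk * C 1 5, 3 * kk * C 0 2, -(3 * kk * C 0 1)]

/-- This is [𝔭, 𝔨] ⊆ 𝔭: `parab` is half of `pmat` plus an antisymmetric element of 𝔨, and `pmat`
commutes with itself. It is the Lie-algebraic input behind total geodesy, checked entrywise with kk²
= 1/3 and ss² = 2/3. -/
theorem pmat_pvec_comm (x κ) : pmat (pvec (pmat x * parab x κ - parab x κ * pmat x)) =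
    pmat x * parab x κ - parab x κ * pmat x := by
  have h1 := kk_mul
  have h2 := ss_mul
  simp only [parab_eq, pmat_eq x]
  generalize x 0 = x0, x 1 = x1, x 2 = x2, x 3 = x3, x 4 = x4, x 5 = x5, x 6 = x6, x 7 = x7
  rw [pmat_eq, pvec]
  simp only [Matrix.sub_apply, Matrix.mul_apply, Fin.sum_univ_seven, Matrix.of_apply, Matrix.cons_val]
  ext i j
  fin_cases i <;> fin_cases j <;> simp only [Matrix.sub_apply, Matrix.mul_apply, Fin.sum_univ_seven, Matrix.of_apply, Matrix.cons_val,
   Fin.zero_eta, Fin.mk_one, Fin.reduceFinMk]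
  all_goals first | ring1 | grind

end

/-! ### Generators of the parabolic subgroup -/

section

/-- The group version of `glp`: determinant, standard, trivial, inverse transpose, inverse
determinant. -/
def glg (a b c d : ℝ) : Matrix (Fin 7) (Fin 7) ℝ :=
  !![a * d - b * c, 0, 0, 0, 0, 0, 0;
     0, a, b, 0, 0, 0, 0;
     0, c, d, 0, 0, 0, 0;
     0, 0, 0, 1, 0, 0, 0;
     0, 0, 0, 0, d / (a * d - b * c), -c / (a * d - b * c), 0;
     0, 0, 0, 0, -b / (a * d - b * c), a / (a * d - b * c), 0;
     0, 0, 0, 0, 0, 0, 1 / (a * d - b * c)]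

def unipF (a b : ℝ) : Matrix (Fin 7) (Fin 7) ℝ :=
  !![1, 0, 0, 0, -a, -b, 0;
     0, 1, 0, 0, 0, 0, a;
     0, 0, 1, 0, 0, 0, b;
     0, 0, 0, 1, 0, 0, 0;
     0, 0, 0, 0, 1, 0, 0;
     0, 0, 0, 0, 0, 1, 0;
     0, 0, 0, 0, 0, 0, 1]

/-- The exponential of `nilp 0 0 0 a b`. The thirds are ss²/2, and the cubic term of the series
vanishes. `unipF` and `unipY` are likewise exponentials, of the f and h parts. -/
def unipE (a b : ℝ) : Matrix (Fin 7) (Fin 7) ℝ :=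
  !![1, -(kk * b), kk * a, 0, 0, 0, 0;
     0, 1, 0, ss * a, a * a / 3, a * b / 3, 0;
     0, 0, 1, ss * b, a * b / 3, b * b / 3, 0;
     0, 0, 0, 1, ss * a, ss * b, 0;
     0, 0, 0, 0, 1, 0, kk * b;
     0, 0, 0, 0, 0, 1, -(kk * a);
     0, 0, 0, 0, 0, 0, 1]

def unipY (c : ℝ) : Matrix (Fin 7) (Fin 7) ℝ :=
  !![1, 0, 0, ss * c, 0, 0, c * c / 3;
     0, 1, 0, 0, 0, kk * c, 0;
     0, 0, 1, 0, -(kk * c), 0, 0;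
     0, 0, 0, 1, 0, 0, ss * c;
     0, 0, 0, 0, 1, 0, 0;
     0, 0, 0, 0, 0, 1, 0;
     0, 0, 0, 0, 0, 0, 1]

theorem glg_mul_inv {a b c d : ℝ} (h : a * d - b * c ≠ 0) :
    glg a b c d * glg (d / (a * d - b * c)) (-b / (a * d - b * c)) (-c / (a * d - b * c)) (a / (a * d - b * c)) = 1 := by
  have e : d / (a * d - b * c) * (a / (a * d - b * c)) - -b / (a * d - b * c) * (-c / (a * d - b * c)) = 1 / (a * d - b * c) := by
    field_simp
  rw [glg, glg, e]
  simp only [div_eq_mul_inv, one_mul]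
  have he := mul_inv_cancel₀ h
  have he' := inv_inv (a * d - b * c)
  generalize (a * d - b * c)⁻¹ = e' at *
  ext i j
  fin_cases i <;> fin_cases j <;> simp [Matrix.mul_apply, Fin.sum_univ_seven, he, he'] <;> grind

theorem unipF_mul_inv (a b : ℝ) : unipF a b * unipF (-a) (-b) = 1 := by
  ext i j
  fin_cases i <;> fin_cases j <;> simp [unipF, Matrix.mul_apply, Fin.sum_univ_seven]

theorem unipE_mul_inv (a b : ℝ) : unipE a b * unipE (-a) (-b) = 1 := by
  have h1 := kk_mul
  have h2 := ss_mul
  ext i j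
  fin_cases i <;> fin_cases j <;> simp [unipE, Matrix.mul_apply, Fin.sum_univ_seven] <;> grind

theorem unipY_mul_inv (c : ℝ) : unipY c * unipY (-c) = 1 := by
  have h1 := kk_mul
  have h2 := ss_mul
  ext i j
  fin_cases i <;> fin_cases j <;> simp [unipY, Matrix.mul_apply, Fin.sum_univ_seven] <;> grind

variable {s : Set ℝ} {t : ℝ}

theorem hasDerivWithinAt_glg {a b c d : ℝ → ℝ} {m₁₁ m₁₂ m₂₁ m₂₂ : ℝ} (h : a t * d t - b t * c t ≠ 0)
    (ha : HasDerivWithinAt a (m₁₁ * a t + m₁₂ * c t) s t) (hb : HasDerivWithinAt b (m₁₁ * b t + m₁₂ * d t) s t)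
    (hc : HasDerivWithinAt c (m₂₁ * a t + m₂₂ * c t) s t) (hd : HasDerivWithinAt d (m₂₁ * b t + m₂₂ * d t) s t) :
    HasDerivWithinAt (fun r => glg (a r) (b r) (c r) (d r)) (glp m₁₁ m₁₂ m₂₁ m₂₂ * glg (a t) (b t) (c t) (d t)) s t := by
  have hδ : HasDerivWithinAt (fun r => a r * d r - b r * c r) ((m₁₁ + m₂₂) * (a t * d t - b t * c t)) s t := by
    refine ((ha.fun_mul hd).fun_sub (hb.fun_mul hc)).congr_deriv ?_
    ring
  have k := fun {f : ℝ → ℝ} {f' : ℝ} (hf : HasDerivWithinAt f f' s t) => hf.fun_div hδ h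
  have k1 := (hasDerivWithinAt_const t s (1:ℝ)).fun_div hδ h
  rw [hasDerivWithinAt_matrix_iff]
  intro i j
  fin_cases i <;> fin_cases j <;> simp [glg, glp, Matrix.mul_apply, Fin.sum_univ_seven, hasDerivWithinAt_const]
  · exact hδ
  · exact ha
  · exact hb
  · exact hc
  · exact hd
  · refine (k hd).congr_deriv ?_
    field_simp; ring
  · refine (k hc.fun_neg).congr_deriv ?_
    field_simp; ring
  · refine (k hb.fun_neg).congr_deriv ?_
    field_simp; ring
  · refine (k ha).congr_deriv ?_
    field_simp; ring
  · simp only [one_div] at k1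
    refine k1.congr_deriv ?_
    field_simp; ring

/-- GL₂ acts on the graded pieces by standard on g, determinant on h, and determinant times standard
on f. This is the source of the factor δ in `frame`. -/
theorem glg_mul_nilp {a b c d : ℝ} (h : a * d - b * c ≠ 0) (f₁ f₂ y g₁ g₂ : ℝ) :
    glg a b c d * nilp f₁ f₂ y g₁ g₂ = nilp ((a * d - b * c) * (a * f₁ + b * f₂)) ((a * d - b * c) * (c * f₁ + d * f₂))
      ((a * d - b * c) * y) (a * g₁ + b * g₂) (c * g₁ + d * g₂) * glg a b c d := by
  simp only [glg, div_eq_mul_inv, one_mul]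
  have he := mul_inv_cancel₀ h
  generalize (a * d - b * c)⁻¹ = e' at *
  ext i j
  fin_cases i <;> fin_cases j <;> simp [nilp, Matrix.mul_apply, Fin.sum_univ_seven] <;> grind

/-- The degree 3 piece is central in the unipotent radical. -/
theorem unipF_mul_nilp (a b f₁ f₂ y g₁ g₂ : ℝ) :
    unipF a b * nilp f₁ f₂ y g₁ g₂ = nilp f₁ f₂ y g₁ g₂ * unipF a b := by
  ext i j
  fin_cases i <;> fin_cases j <;> simp [unipF, nilp, Matrix.mul_apply, Fin.sum_univ_seven] <;> ring

theorem unipE_mul_nilp (a b y : ℝ) :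
    unipE a b * nilp 0 0 y 0 0 = nilp (a * y) (b * y) y 0 0 * unipE a b := by
  have h1 := kk_mul
  have h2 := ss_mul
  ext i j
  fin_cases i <;> fin_cases j <;> simp [unipE, nilp, Matrix.mul_apply, Fin.sum_univ_seven] <;> grind

theorem hasDerivWithinAt_unipF {a b : ℝ → ℝ} {a' b' : ℝ} (ha : HasDerivWithinAt a a' s t)
    (hb : HasDerivWithinAt b b' s t) :
    HasDerivWithinAt (fun r => unipF (a r) (b r)) (nilp a' b' 0 0 0 * unipF (a t) (b t)) s t := by
  rw [hasDerivWithinAt_matrix_iff]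
  intro i j
  fin_cases i <;> fin_cases j <;> simp [unipF, nilp, Matrix.mul_apply, Fin.sum_univ_seven, hasDerivWithinAt_const]
  exacts [ha.fun_neg, hb.fun_neg, ha, hb]

theorem hasDerivWithinAt_unipY {c : ℝ → ℝ} {c' : ℝ} (hc : HasDerivWithinAt c c' s t) :
    HasDerivWithinAt (fun r => unipY (c r)) (nilp 0 0 c' 0 0 * unipY (c t)) s t := by
  have h2 := ss_mul
  rw [hasDerivWithinAt_matrix_iff]
  intro i j
  fin_cases i <;> fin_cases j <;> simp [unipY, nilp, Matrix.mul_apply, Fin.sum_univ_seven, hasDerivWithinAt_const]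
  · exact hc.const_mul _
  · refine ((hc.fun_mul hc).div_const 3).congr_deriv ?_
    grind
  · exact hc.const_mul _
  · exact (hc.const_mul _).fun_neg
  · exact hc.const_mul _

/-- The degree 1 piece does not commute with itself. Its brackets produce the terms (1/√3)ψ∧dψ of Υ,
as kk, and (1/(3√3))ψ∧dψ of Θ, as kk / 3. -/
theorem hasDerivWithinAt_unipE {a b : ℝ → ℝ} {a' b' : ℝ} (ha : HasDerivWithinAt a a' s t)
    (hb : HasDerivWithinAt b b' s t) :
    HasDerivWithinAt (fun r => unipE (a r) (b r))
      (nilp (kk / 3 * (a t * b' - b t * a') * a t) (kk / 3 * (a t * b' - b t * a') * b t) (kk * (a t * b' - b t * a')) a' b'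
        * unipE (a t) (b t)) s t := by
  have h1 := kk_mul
  have h2 := ss_mul
  rw [hasDerivWithinAt_matrix_iff]
  intro i j
  have q := fun {f g : ℝ → ℝ} {f' g' : ℝ} (hf : HasDerivWithinAt f f' s t) (hg : HasDerivWithinAt g g' s t)  => (hf.fun_mul hg).div_const 3
  fin_cases i <;> fin_cases j <;> simp [unipE, nilp, Matrix.mul_apply, Fin.sum_univ_seven, hasDerivWithinAt_const]
  all_goals first
    | exact ha.const_mul _
    | exact hb.const_mul _
    | exact (ha.const_mul _).fun_neg
    | exact (hb.const_mul _).fun_neg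
    | (refine (q ha ha).congr_deriv ?_; grind)
    | (refine (q ha hb).congr_deriv ?_; grind)
    | (refine (q hb hb).congr_deriv ?_; grind)
    | (refine (hasDerivWithinAt_const _ _ _).congr_deriv ?_; grind)

end

/-! ### The coset representative and its Maurer-Cartan form -/

section

/-- The entries of the `GL₂` component of the coset representative. -/
def gl₁₁ (q : ℤ) (x : Target) : ℝ := Real.exp (-x 0) *
  (Real.cosh (x 2 / 2) * Real.exp (-x 1 / 2) - q * Real.sinh (x 2 / 2) * Real.exp (x 1 / 2))
def gl₁₂ (p : ℤ) (x : Target) : ℝ := Real.exp (-x 0) * (-p * Real.sinh (x 2 / 2) * Real.exp (x 1 / 2))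
def gl₂₁ (q : ℤ) (x : Target) : ℝ := Real.exp (-x 0) *
  (-Real.sinh (x 2 / 2) * Real.exp (-x 1 / 2) + q * Real.cosh (x 2 / 2) * Real.exp (x 1 / 2))
def gl₂₂ (p : ℤ) (x : Target) : ℝ := Real.exp (-x 0) * (p * Real.cosh (x 2 / 2) * Real.exp (x 1 / 2))

/-- The block is L = e^{-u} · H · diag(e^{-v/2}, e^{v/2}) · Zᵀ, where H is the symmetric hyperbolic
matrix of parameter −w/2. Thus LᵀL = λ⁻¹, and only the scalar factor, the diagonal one (of
determinant 1) and Zᵀ can affect det L. -/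
theorem gl_det (p q : ℤ) (x : Target) :
    gl₁₁ q x * gl₂₂ p x - gl₁₂ p x * gl₂₁ q x = p * Real.exp (-2 * x 0) := by
  have h1 := Real.cosh_sq (x 2 / 2)
  have h2 : Real.exp (-x 1 / 2) * Real.exp (x 1 / 2) = 1 := by rw [← Real.exp_add]; simp; ring
  have h3 : Real.exp (-2 * x 0) = Real.exp (-x 0) * Real.exp (-x 0) := by rw [← Real.exp_add]; ring_nf
  rw [h3]
  simp only [gl₁₁, gl₁₂, gl₂₁, gl₂₂]
  grind

theorem gl_det_ne {p : ℤ} (hp : p ≠ 0) (q : ℤ) (x : Target) :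
    gl₁₁ q x * gl₂₂ p x - gl₁₂ p x * gl₂₁ q x ≠ 0 := by
  rw [gl_det]
  have : (p : ℝ) ≠ 0 := by exact_mod_cast hp
  positivity

/-- The coset representative in the seven-dimensional representation of `G₂`. -/
def coset (p q : ℤ) (x : Target) : Matrix (Fin 7) (Fin 7) ℝ :=
  glg (gl₁₁ q x) (gl₁₂ p x) (gl₂₁ q x) (gl₂₂ p x) * unipF (x 3) (x 4) * unipE (x 6) (x 7) * unipY (x 5)

/-- The inverse of the coset representative. -/
def cosetInv (p q : ℤ) (x : Target) : Matrix (Fin 7) (Fin 7) ℝ :=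
  unipY (-x 5) * unipE (-x 6) (-x 7) * unipF (-x 3) (-x 4) *
    glg (gl₂₂ p x / (p * Real.exp (-2 * x 0))) (-gl₁₂ p x / (p * Real.exp (-2 * x 0)))
        (-gl₂₁ q x / (p * Real.exp (-2 * x 0))) (gl₁₁ q x / (p * Real.exp (-2 * x 0)))

theorem coset_mul_inv {p : ℤ} (hp : p ≠ 0) (q : ℤ) (x : Target) : coset p q x * cosetInv p q x = 1 := by
  have h1 := unipY_mul_inv (x 5)
  have h2 := unipE_mul_inv (x 6) (x 7)
  have h3 := unipF_mul_inv (x 3) (x 4)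
  have h4 := glg_mul_inv (gl_det_ne hp q x)
  rw [gl_det] at h4
  rw [coset, cosetInv]
  calc _ = glg (gl₁₁ q x) (gl₁₂ p x) (gl₂₁ q x) (gl₂₂ p x) * (unipF (x 3) (x 4) * (unipE (x 6) (x 7) *
      (unipY (x 5) * unipY (-x 5)) * unipE (-x 6) (-x 7)) * unipF (-x 3) (-x 4)) *
      glg (gl₂₂ p x / (p * Real.exp (-2 * x 0))) (-gl₁₂ p x / (p * Real.exp (-2 * x 0)))
        (-gl₂₁ q x / (p * Real.exp (-2 * x 0))) (gl₁₁ q x / (p * Real.exp (-2 * x 0))) := by noncomm_ring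
    _ = 1 := by rw [h1, mul_one, h2, mul_one, h3, mul_one, h4]

theorem cosetInv_mul {p : ℤ} (hp : p ≠ 0) (q : ℤ) (x : Target) : cosetInv p q x * coset p q x = 1 :=
  mul_eq_one_comm.1 (coset_mul_inv hp q x)

/-- The components of the tangent vector `a` at `x` in a `G`-orthogonal moving coframe. -/
def frame (p q : ℤ) (x a : Target) : Fin 8 → ℝ :=
  let δ := p * Real.exp (-2 * x 0)
  ![a 0, Real.cosh (x 2) * a 1, a 2,
    δ * (gl₁₁ q x * Theta1 x a + gl₁₂ p x * Theta2 x a),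
    δ * (gl₂₁ q x * Theta1 x a + gl₂₂ p x * Theta2 x a),
    δ * Upsilon x a,
    gl₁₁ q x * a 6 + gl₁₂ p x * a 7, gl₂₁ q x * a 6 + gl₂₂ p x * a 7]

variable {s : Set ℝ} {t : ℝ}

/-- The logarithmic derivative of each factor is moved to the left through the preceding ones. The
unipotent contributions add up to Θ, Υ and dψ, and conjugation by the GL₂ block turns them into
frame components. The rotation sinh w dv appears because the hyperbolic and diagonal factors of that
block do not commute. -/
theorem hasDerivWithinAt_coset {p : ℤ} (hp : p ≠ 0) (q : ℤ) {γ : ℝ → Target} {a : Target}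
    (h : HasDerivWithinAt γ a s t) :
    HasDerivWithinAt (fun r => coset p q (γ r))
      (parab (frame p q (γ t) a) (Real.sinh (γ t 2) * a 1) * coset p q (γ t)) s t := by
  have hi := hasDerivWithinAt_pi.1 h
  have hc := ((hi 2).div_const 2).cosh
  have hs := ((hi 2).div_const 2).sinh
  have hu := (hi 0).fun_neg.exp
  have hv := ((hi 1).div_const 2).exp
  have hv' := ((hi 1).fun_neg.div_const 2).exp
  have c2 : Real.cosh (γ t 2) = Real.cosh (γ t 2 / 2) ^ 2 + Real.sinh (γ t 2 / 2) ^ 2 := by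
    rw [← Real.cosh_two_mul]; ring_nf
  have s2 : Real.sinh (γ t 2) = 2 * Real.sinh (γ t 2 / 2) * Real.cosh (γ t 2 / 2) := by
    rw [← Real.sinh_two_mul]; ring_nf
  have csq := Real.cosh_sq (γ t 2 / 2)
  set X := frame p q (γ t) a with hX
  set κ := Real.sinh (γ t 2) * a 1 with hκ
  have X0 : X 0 = a 0 := rfl
  have X1 : X 1 = Real.cosh (γ t 2) * a 1 := rfl
  have X2 : X 2 = a 2 := rfl
  have hA : HasDerivWithinAt (fun r => glg (gl₁₁ q (γ r)) (gl₁₂ p (γ r)) (gl₂₁ q (γ r)) (gl₂₂ p (γ r)))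
      (glp (-X 0 - X 1 / 2) (-X 2 / 2 - κ / 2) (-X 2 / 2 + κ / 2) (-X 0 + X 1 / 2) *
        glg (gl₁₁ q (γ t)) (gl₁₂ p (γ t)) (gl₂₁ q (γ t)) (gl₂₂ p (γ t))) s t := by
    apply hasDerivWithinAt_glg (gl_det_ne hp q _)
    · refine (hu.fun_mul ((hc.fun_mul hv').fun_sub ((hs.const_mul (q : ℝ)).fun_mul hv))).congr_deriv ?_
      rw [X0, X1, X2, hκ, c2, s2]
      simp only [gl₁₁, gl₂₁]
      grind
    · refine (hu.fun_mul ((hs.const_mul (-p : ℝ)).fun_mul hv)).congr_deriv ?_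
      rw [X0, X1, X2, hκ, c2, s2]
      simp only [gl₁₂, gl₂₂]
      grind
    · refine (hu.fun_mul ((hs.fun_neg.fun_mul hv').fun_add ((hc.const_mul (q : ℝ)).fun_mul hv))).congr_deriv ?_
      rw [X0, X1, X2, hκ, c2, s2]
      simp only [gl₁₁, gl₂₁]
      grind
    · refine (hu.fun_mul ((hc.const_mul (p : ℝ)).fun_mul hv)).congr_deriv ?_
      rw [X0, X1, X2, hκ, c2, s2]
      simp only [gl₁₂, gl₂₂]
      grind
  have hF := hasDerivWithinAt_unipF (hi 3) (hi 4)
  have hE := hasDerivWithinAt_unipE (hi 6) (hi 7)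
  have hY := hasDerivWithinAt_unipY (hi 5)
  refine (((hA.fun_mul hF).fun_mul hE).fun_mul hY).congr_deriv ?_
  have cE := unipE_mul_nilp (γ t 6) (γ t 7) (a 5)
  have cF := unipF_mul_nilp (γ t 3) (γ t 4)
  have cA := glg_mul_nilp (gl_det_ne hp q (γ t))
  -- The three unipotent contributions assemble into the 1-forms Θ and Υ of the metric; this fixes
  -- the order of the factors in `coset`.
  have hn : nilp (a 3) (a 4) 0 0 0 + (nilp (kk / 3 * (γ t 6 * a 7 - γ t 7 * a 6) * γ t 6)
      (kk / 3 * (γ t 6 * a 7 - γ t 7 * a 6) * γ t 7) (kk * (γ t 6 * a 7 - γ t 7 * a 6)) (a 6) (a 7)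
      + nilp (γ t 6 * a 5) (γ t 7 * a 5) (a 5) 0 0)
      = nilp (Theta1 (γ t) a) (Theta2 (γ t) a) (Upsilon (γ t) a) (a 6) (a 7) := by
    have e : 1 / (3 * √3) = kk / 3 := by rw [kk]; field_simp
    rw [Theta1, Theta2, Upsilon, e, ← kk, psiWedge]
    ext i j
    fin_cases i <;> fin_cases j <;> simp [nilp] <;> ring
  have hP : parab X κ = glp (-X 0 - X 1 / 2) (-X 2 / 2 - κ / 2) (-X 2 / 2 + κ / 2) (-X 0 + X 1 / 2) +
      nilp (X 3) (X 4) (X 5) (X 6) (X 7) := rfl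
  have cA' := cA (Theta1 (γ t) a) (Theta2 (γ t) a) (Upsilon (γ t) a) (a 6) (a 7)
  rw [gl_det] at cA'
  change _ = nilp (X 3) (X 4) (X 5) (X 6) (X 7) * _ at cA'
  rw [hP, coset]
  rw [← hn] at cA'
  set G := glg (gl₁₁ q (γ t)) (gl₁₂ p (γ t)) (gl₂₁ q (γ t)) (gl₂₂ p (γ t))
  set F := unipF (γ t 3) (γ t 4)
  set E := unipE (γ t 6) (γ t 7)
  set Y := unipY (γ t 5)
  rw [add_mul, add_mul (glp _ _ _ _)]
  have : nilp (X 3) (X 4) (X 5) (X 6) (X 7) * (G * F * E * Y) = nilp (X 3) (X 4) (X 5) (X 6) (X 7) * G * F * E * Y := by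
    simp only [Matrix.mul_assoc]
  rw [this, ← cA']
  have m1 : G * F * E * (nilp 0 0 (a 5) 0 0 * Y) = G * (F * (E * nilp 0 0 (a 5) 0 0)) * Y := by
    simp only [Matrix.mul_assoc]
  rw [m1, cE, ← Matrix.mul_assoc F, cF]
  have m2 : ∀ n, G * F * (n * E) = G * (F * n) * E := fun n => by simp only [Matrix.mul_assoc]
  rw [m2, cF]
  noncomm_ring

theorem metric_eq_frame (p q : ℤ) (x a b : Target) :
    metric p q x a b = 12 * (frame p q x a 0 * frame p q x b 0)
      + ∑ i : Fin 7, frame p q x a i.succ * frame p q x b i.succ := by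
  have c2 : Real.cosh (x 2) = Real.cosh (x 2 / 2) ^ 2 + Real.sinh (x 2 / 2) ^ 2 := by
    rw [← Real.cosh_two_mul]; ring_nf
  have s2 : Real.sinh (x 2) = 2 * Real.sinh (x 2 / 2) * Real.cosh (x 2 / 2) := by
    rw [← Real.sinh_two_mul]; ring_nf
  have csq := Real.cosh_sq (x 2 / 2)
  have hc := Real.cosh_pos (x 2)
  have hcs := Real.cosh_sq (x 2)
  have e2 : Real.exp (-2 * x 0) = Real.exp (-x 0) ^ 2 := by rw [← Real.exp_nat_mul]; ring_nf
  have e4 : Real.exp (-4 * x 0) = Real.exp (-x 0) ^ 4 := by rw [← Real.exp_nat_mul]; ring_nf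
  have v1 : Real.exp (-x 1) = Real.exp (-x 1 / 2) ^ 2 := by rw [← Real.exp_nat_mul]; ring_nf
  have v2 : Real.exp (x 1) = Real.exp (x 1 / 2) ^ 2 := by rw [← Real.exp_nat_mul]; ring_nf
  have e21 : Real.exp (-2 * x 0 - x 1) = Real.exp (-x 0) ^ 2 * Real.exp (-x 1 / 2) ^ 2 := by
    rw [← e2, ← v1, ← Real.exp_add]; ring_nf
  have e22 : Real.exp (-2 * x 0 + x 1) = Real.exp (-x 0) ^ 2 * Real.exp (x 1 / 2) ^ 2 := by
    rw [← e2, ← v2, ← Real.exp_add]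
  have e6 : Real.exp (-6 * x 0) = Real.exp (-x 0) ^ 6 := by rw [← Real.exp_nat_mul]; ring_nf
  have e61 : Real.exp (-6 * x 0 - x 1) = Real.exp (-x 0) ^ 6 * Real.exp (-x 1 / 2) ^ 2 := by
    rw [← e6, ← v1, ← Real.exp_add]; ring_nf
  have e62 : Real.exp (-6 * x 0 + x 1) = Real.exp (-x 0) ^ 6 * Real.exp (x 1 / 2) ^ 2 := by
    rw [← e6, ← v2, ← Real.exp_add]
  have vv : Real.exp (-x 1 / 2) * Real.exp (x 1 / 2) = 1 := by rw [← Real.exp_add]; simp; ring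
  -- The metric gives the form of λ̄⁻¹ with its square completed; cosh² = 1 + sinh² expands it
  -- again.
  have quad : ∀ α₁ α₂ β₁ β₂ : ℝ,
      Real.exp (-x 1 / 2) ^ 2 / Real.cosh (x 2) * (α₁ * β₁) + Real.exp (x 1 / 2) ^ 2 * Real.cosh (x 2) *
        ((Real.exp (-x 1 / 2) ^ 2 * (Real.sinh (x 2) / Real.cosh (x 2)) * α₁ - bar2 p q α₁ α₂) *
          (Real.exp (-x 1 / 2) ^ 2 * (Real.sinh (x 2) / Real.cosh (x 2)) * β₁ - bar2 p q β₁ β₂)) =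
      Real.cosh (x 2) * Real.exp (-x 1 / 2) ^ 2 * α₁ * β₁
        - Real.sinh (x 2) * (α₁ * bar2 p q β₁ β₂ + β₁ * bar2 p q α₁ α₂)
        + Real.cosh (x 2) * Real.exp (x 1 / 2) ^ 2 * bar2 p q α₁ α₂ * bar2 p q β₁ β₂ := by
    intro α₁ α₂ β₁ β₂
    have hc' := mul_inv_cancel₀ hc.ne'
    simp only [div_eq_mul_inv _ (Real.cosh (x 2))]
    generalize (Real.cosh (x 2))⁻¹ = ci at *
    generalize bar2 p q α₁ α₂ = A
    generalize bar2 p q β₁ β₂ = B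
    generalize Real.exp (-x 1 / 2) = e at *
    generalize Real.exp (x 1 / 2) = e' at *
    generalize Real.cosh (x 2) = c at *
    generalize Real.sinh (x 2) = s at *
    clear c2 s2
    grind
  -- The same form as LᵀL, with half-angle formulas turning w/2 into w.
  have quad' : ∀ α₁ α₂ β₁ β₂ : ℝ,
      (gl₁₁ q x * α₁ + gl₁₂ p x * α₂) * (gl₁₁ q x * β₁ + gl₁₂ p x * β₂)
       + (gl₂₁ q x * α₁ + gl₂₂ p x * α₂) * (gl₂₁ q x * β₁ + gl₂₂ p x * β₂) =
      Real.exp (-x 0) ^ 2 * (Real.cosh (x 2) * Real.exp (-x 1 / 2) ^ 2 * α₁ * β₁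
        - Real.sinh (x 2) * (α₁ * bar2 p q β₁ β₂ + β₁ * bar2 p q α₁ α₂)
        + Real.cosh (x 2) * Real.exp (x 1 / 2) ^ 2 * bar2 p q α₁ α₂ * bar2 p q β₁ β₂) := by
    intro α₁ α₂ β₁ β₂
    rw [c2, s2]
    simp only [gl₁₁, gl₂₁, gl₁₂, gl₂₂, bar2]
    generalize Real.exp (-x 1 / 2) = e at *
    generalize Real.exp (x 1 / 2) = e' at *
    generalize Real.cosh (x 2 / 2) = c at *
    generalize Real.sinh (x 2 / 2) = s at *
    generalize Real.exp (-x 0) = f at *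
    linear_combination (-2 * f ^ 2 * s * c * (α₁ * (q * β₁ + p * β₂) + β₁ * (q * α₁ + p * α₂))) * vv
  have q1 := quad (Theta1 x a) (Theta2 x a) (Theta1 x b) (Theta2 x b)
  have q2 := quad (a 6) (a 7) (b 6) (b 7)
  have q1' := quad' (Theta1 x a) (Theta2 x a) (Theta1 x b) (Theta2 x b)
  have q2' := quad' (a 6) (a 7) (b 6) (b 7)
  simp only [metric, Real.tanh_eq_sinh_div_cosh, ThetaBar1, ThetaBar2, dPsiBar1, dPsiBar2, bar1, e61, e62, e21, e22, e4, v1]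
  simp only [Fin.sum_univ_seven, frame, e2, Fin.reduceSucc, Matrix.cons_val, Fin.succ_zero_eq_one]
  linear_combination (p : ℝ) ^ 2 * Real.exp (-x 0) ^ 6 * q1 + Real.exp (-x 0) ^ 2 * q2
    - (p : ℝ) ^ 2 * Real.exp (-x 0) ^ 4 * q1' - q2'

theorem metric_eq_trace (p q : ℤ) (x a b : Target) :
    metric p q x a b = 1 / 4 * (pmat (frame p q x a) * pmat (frame p q x b)).trace := by
  rw [metric_eq_frame, trace_pmat]; ring

theorem frame_add (p q : ℤ) (x a b : Target) : frame p q x (a + b) = frame p q x a + frame p q x b := by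
  ext i
  fin_cases i <;> simp [frame, Theta1, Theta2, Upsilon, psiWedge] <;> ring

theorem frame_smul (p q : ℤ) (x a : Target) (c : ℝ) : frame p q x (c • a) = c • frame p q x a := by
  ext i
  fin_cases i <;> simp [frame, Theta1, Theta2, Upsilon, psiWedge] <;> ring

/-- The coframe at `x` as a linear map. -/
def frameₗ (p q : ℤ) (x : Target) : Target →ₗ[ℝ] (Fin 8 → ℝ) where
  toFun := frame p q x
  map_add' := frame_add p q x
  map_smul' c a := frame_smul p q x a c

theorem frame_eq_zero {p : ℤ} (hp : p ≠ 0) {q : ℤ} {x a : Target} (h : frame p q x a = 0) : a = 0 := by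
  have hp' : (p : ℝ) ≠ 0 := by exact_mod_cast hp
  have hδ : (p : ℝ) * Real.exp (-2 * x 0) ≠ 0 := by positivity
  have hd := gl_det_ne hp q x
  have inj : ∀ α₁ α₂ : ℝ, gl₁₁ q x * α₁ + gl₁₂ p x * α₂ = 0 → gl₂₁ q x * α₁ + gl₂₂ p x * α₂ = 0 →
      α₁ = 0 ∧ α₂ = 0 := by
    intro α₁ α₂ h1 h2
    constructor
    · refine (mul_eq_zero.1 (?_ : (gl₁₁ q x * gl₂₂ p x - gl₁₂ p x * gl₂₁ q x) * α₁ = 0)).resolve_left hd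
      linear_combination gl₂₂ p x * h1 - gl₁₂ p x * h2
    · refine (mul_eq_zero.1 (?_ : (gl₁₁ q x * gl₂₂ p x - gl₁₂ p x * gl₂₁ q x) * α₂ = 0)).resolve_left hd
      linear_combination gl₁₁ q x * h2 - gl₂₁ q x * h1
  have h0 : a 0 = 0 := congrFun h 0
  have h1 : Real.cosh (x 2) * a 1 = 0 := congrFun h 1
  have h2 : a 2 = 0 := congrFun h 2
  have h3 : _ * (gl₁₁ q x * Theta1 x a + gl₁₂ p x * Theta2 x a) = 0 := congrFun h 3
  have h4 : _ * (gl₂₁ q x * Theta1 x a + gl₂₂ p x * Theta2 x a) = 0 := congrFun h 4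
  have h5 : _ * Upsilon x a = 0 := congrFun h 5
  obtain ⟨h6, h7⟩ := inj (a 6) (a 7) (congrFun h 6) (congrFun h 7)
  obtain ⟨t1, t2⟩ := inj _ _ ((mul_eq_zero.1 h3).resolve_left hδ) ((mul_eq_zero.1 h4).resolve_left hδ)
  have h5 := (mul_eq_zero.1 h5).resolve_left hδ
  have h1 := (mul_eq_zero.1 h1).resolve_left (Real.cosh_pos _).ne'
  simp only [Upsilon, Theta1, Theta2, psiWedge, h6, h7, mul_zero, sub_zero, add_zero] at h5 t1 t2
  simp only [h5, mul_zero, add_zero] at t1 t2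
  ext i
  fin_cases i <;> simp [*]

theorem frame_surjective {p : ℤ} (hp : p ≠ 0) (q : ℤ) (x : Target) : Function.Surjective (frame p q x) := by
  have : Function.Injective (frameₗ p q x) :=
    (injective_iff_map_eq_zero _).2 fun a ha => frame_eq_zero hp ha
  exact LinearMap.injective_iff_surjective.1 this

end

-- Makes all continuity statements for 7×7 matrices refer to the topology of the Frobenius norm, the
-- one used by the differential calculus.
local instance (priority := 2000) matrixTopology : TopologicalSpace (Matrix (Fin 7) (Fin 7) ℝ) :=
  PseudoMetricSpace.toUniformSpace.toTopologicalSpace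

/-! ### Embedding into positive definite matrices -/

section

variable {p q : ℤ}

theorem contDiff_coord (i : Fin 8) : ContDiff ℝ ∞ (fun x : Target => x i) := contDiff_apply ℝ ℝ i

theorem contDiff_gl₁₁ : ContDiff ℝ ∞ (gl₁₁ q) := by
  have h := contDiff_coord
  unfold gl₁₁
  exact (h 0).neg.exp.mul ((((h 2).div_const 2).cosh.mul ((h 1).neg.div_const 2).exp).sub
    ((contDiff_const.mul ((h 2).div_const 2).sinh).mul ((h 1).div_const 2).exp))

theorem contDiff_gl₁₂ : ContDiff ℝ ∞ (gl₁₂ p) := by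
  have h := contDiff_coord
  unfold gl₁₂
  exact (h 0).neg.exp.mul ((contDiff_const.mul ((h 2).div_const 2).sinh).mul ((h 1).div_const 2).exp)

theorem contDiff_gl₂₁ : ContDiff ℝ ∞ (gl₂₁ q) := by
  have h := contDiff_coord
  unfold gl₂₁
  exact (h 0).neg.exp.mul ((((h 2).div_const 2).sinh.neg.mul ((h 1).neg.div_const 2).exp).add
    ((contDiff_const.mul ((h 2).div_const 2).cosh).mul ((h 1).div_const 2).exp))

theorem contDiff_gl₂₂ : ContDiff ℝ ∞ (gl₂₂ p) := by
  have h := contDiff_coord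
  unfold gl₂₂
  exact (h 0).neg.exp.mul ((contDiff_const.mul ((h 2).div_const 2).cosh).mul ((h 1).div_const 2).exp)

section
variable {E : Type*} [NormedAddCommGroup E] [NormedSpace ℝ E] {a b c d : E → ℝ}

theorem contDiff_glg (ha : ContDiff ℝ ∞ a) (hb : ContDiff ℝ ∞ b)
    (hc : ContDiff ℝ ∞ c) (hd : ContDiff ℝ ∞ d) (h : ∀ x, a x * d x - b x * c x ≠ 0) :
    ContDiff ℝ ∞ (fun x => glg (a x) (b x) (c x) (d x)) := by
  have hδ := (ha.mul hd).sub (hb.mul hc)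
  refine contDiff_matrix fun i j => ?_
  fin_cases i <;> fin_cases j <;> simp [glg, contDiff_const]
  exacts [hδ, ha, hb, hc, hd, hd.div hδ h, hc.neg.div hδ h, hb.neg.div hδ h, ha.div hδ h, hδ.inv h]

theorem contDiff_unipF (ha : ContDiff ℝ ∞ a) (hb : ContDiff ℝ ∞ b) :
    ContDiff ℝ ∞ (fun x => unipF (a x) (b x)) := by
  refine contDiff_matrix fun i j => ?_
  fin_cases i <;> fin_cases j <;> simp [unipF, contDiff_const] <;> fun_prop

theorem contDiff_unipE (ha : ContDiff ℝ ∞ a) (hb : ContDiff ℝ ∞ b) :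
    ContDiff ℝ ∞ (fun x => unipE (a x) (b x)) := by
  refine contDiff_matrix fun i j => ?_
  fin_cases i <;> fin_cases j <;> simp [unipE, contDiff_const] <;> fun_prop

theorem contDiff_unipY (ha : ContDiff ℝ ∞ a) :
    ContDiff ℝ ∞ (fun x => unipY (a x)) := by
  refine contDiff_matrix fun i j => ?_
  fin_cases i <;> fin_cases j <;> simp [unipY, contDiff_const] <;> fun_prop
end

theorem contDiff_coset (hp : p ≠ 0) (q : ℤ) : ContDiff ℝ ∞ (coset p q) :=
  (((contDiff_glg contDiff_gl₁₁ contDiff_gl₁₂ contDiff_gl₂₁ contDiff_gl₂₂ fun x => gl_det_ne hp q x).mul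
    (contDiff_unipF (contDiff_coord 3) (contDiff_coord 4))).mul
    (contDiff_unipE (contDiff_coord 6) (contDiff_coord 7))).mul (contDiff_unipY (contDiff_coord 5))

theorem contDiff_cosetInv (hp : p ≠ 0) (q : ℤ) : ContDiff ℝ ∞ (cosetInv p q) := by
  have hp' : (p : ℝ) ≠ 0 := by exact_mod_cast hp
  have hδ : ContDiff ℝ ∞ (fun x : Target => (p : ℝ) * Real.exp (-2 * x 0)) :=
    contDiff_const.mul (contDiff_const.mul (contDiff_coord 0)).exp
  have hδ0 : ∀ x : Target, (p : ℝ) * Real.exp (-2 * x 0) ≠ 0 := fun x => by positivity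
  refine (((contDiff_unipY (contDiff_coord 5).neg).mul
    (contDiff_unipE (contDiff_coord 6).neg (contDiff_coord 7).neg)).mul
    (contDiff_unipF (contDiff_coord 3).neg (contDiff_coord 4).neg)).mul
    (contDiff_glg (contDiff_gl₂₂.div hδ hδ0) (contDiff_gl₁₂.neg.div hδ hδ0)
      (contDiff_gl₂₁.neg.div hδ hδ0) (contDiff_gl₁₁.div hδ hδ0) fun x => ?_)
  have := gl_det p q x
  have h0 := hδ0 x
  rw [← this] at h0 ⊢
  have e : gl₂₂ p x / (gl₁₁ q x * gl₂₂ p x - gl₁₂ p x * gl₂₁ q x) * (gl₁₁ q x / (gl₁₁ q x * gl₂₂ p x - gl₁₂ p x * gl₂₁ q x))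
      - -gl₁₂ p x / (gl₁₁ q x * gl₂₂ p x - gl₁₂ p x * gl₂₁ q x) * (-gl₂₁ q x / (gl₁₁ q x * gl₂₂ p x - gl₁₂ p x * gl₂₁ q x))
      = 1 / (gl₁₁ q x * gl₂₂ p x - gl₁₂ p x * gl₂₁ q x) := by
    field_simp
  rw [e]
  exact one_div_ne_zero h0

/-- The embedding of the target into the positive definite `7 × 7` matrices. -/
def spd (p q : ℤ) (x : Target) : Matrix (Fin 7) (Fin 7) ℝ := (coset p q x)ᵀ * coset p q x

def spdInv (p q : ℤ) (x : Target) : Matrix (Fin 7) (Fin 7) ℝ := cosetInv p q x * (cosetInv p q x)ᵀ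

theorem spdInv_mul (hp : p ≠ 0) (q : ℤ) (x : Target) : spdInv p q x * spd p q x = 1 := by
  have h := coset_mul_inv hp q x
  have h' : (cosetInv p q x)ᵀ * (coset p q x)ᵀ = 1 := by rw [← Matrix.transpose_mul, h, Matrix.transpose_one]
  rw [spdInv, spd, Matrix.mul_assoc, ← Matrix.mul_assoc _ _ (coset p q x), h', Matrix.one_mul, cosetInv_mul hp]

theorem spd_mul_inv (hp : p ≠ 0) (q : ℤ) (x : Target) : spd p q x * spdInv p q x = 1 :=
  mul_eq_one_comm.1 (spdInv_mul hp q x)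

theorem contDiff_transpose {E : Type*} [NormedAddCommGroup E] [NormedSpace ℝ E] {N : WithTop ℕ∞}
    {f : E → Matrix (Fin 7) (Fin 7) ℝ} (hf : ContDiff ℝ N f) : ContDiff ℝ N (fun x => (f x)ᵀ) :=
  (Matrix.transposeLinearEquiv (Fin 7) (Fin 7) ℝ ℝ).toLinearMap.toContinuousLinearMap.contDiff.comp hf

theorem contDiff_spd (hp : p ≠ 0) (q : ℤ) : ContDiff ℝ ∞ (spd p q) :=
  (contDiff_transpose (contDiff_coset hp q)).mul (contDiff_coset hp q)

theorem contDiff_spdInv (hp : p ≠ 0) (q : ℤ) : ContDiff ℝ ∞ (spdInv p q) :=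
  (contDiff_cosetInv hp q).mul (contDiff_transpose (contDiff_cosetInv hp q))

section
variable {s : Set ℝ} {t : ℝ}

theorem _root_.HasDerivWithinAt.matrix_transpose {f : ℝ → Matrix (Fin 7) (Fin 7) ℝ} {f' : Matrix (Fin 7) (Fin 7) ℝ}
    (hf : HasDerivWithinAt f f' s t) : HasDerivWithinAt (fun x => (f x)ᵀ) f'ᵀ s t :=
  (Matrix.transposeLinearEquiv (Fin 7) (Fin 7) ℝ ℝ).toLinearMap.toContinuousLinearMap.hasFDerivAt.comp_hasDerivWithinAt t hf

theorem _root_.HasDerivWithinAt.matrix_trace {f : ℝ → Matrix (Fin 7) (Fin 7) ℝ} {f' : Matrix (Fin 7) (Fin 7) ℝ}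
    (hf : HasDerivWithinAt f f' s t) : HasDerivWithinAt (fun x => (f x).trace) f'.trace s t :=
  (Matrix.traceLinearMap (Fin 7) ℝ ℝ).toContinuousLinearMap.hasFDerivAt.comp_hasDerivWithinAt t hf

/-- From V' = QV one gets (VᵀV)' = Vᵀ(Q + Qᵀ)V, and the rotation part of Q cancels in the sum. -/
theorem hasDerivWithinAt_spd (hp : p ≠ 0) (q : ℤ) {γ : ℝ → Target} {a : Target}
    (h : HasDerivWithinAt γ a s t) :
    HasDerivWithinAt (fun r => spd p q (γ r))
      ((coset p q (γ t))ᵀ * pmat (frame p q (γ t) a) * coset p q (γ t)) s t := by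
  have hV := hasDerivWithinAt_coset hp q h
  refine (hV.matrix_transpose.fun_mul hV).congr_deriv ?_
  rw [← parab_add_transpose _ (Real.sinh (γ t 2) * a 1), Matrix.transpose_mul]
  noncomm_ring
end

theorem hasDerivAt_line {F : Type*} [NormedAddCommGroup F] [NormedSpace ℝ F] {f : Target → F} {x : Target}
    (hf : DifferentiableAt ℝ f x) (a : Target) :
    HasDerivWithinAt (fun r : ℝ => f (x + r • a)) (fderiv ℝ f x a) univ 0 := by
  have h : HasDerivAt (fun r : ℝ => x + r • a) a 0 := by
    simpa using ((hasDerivAt_id (0:ℝ)).smul_const a).const_add x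
  rw [hasDerivWithinAt_univ]
  have hf' : HasFDerivAt f (fderiv ℝ f x) (x + (0:ℝ) • a) := by simpa using hf.hasFDerivAt
  exact hf'.comp_hasDerivAt (0:ℝ) h

theorem fderiv_spd (hp : p ≠ 0) (q : ℤ) (x a : Target) : fderiv ℝ (spd p q) x a =
    (coset p q x)ᵀ * pmat (frame p q x a) * coset p q x := by
  have h1 := hasDerivAt_line ((contDiff_spd hp q).differentiable (by simp) x) a
  have h : HasDerivAt (fun r : ℝ => x + r • a) a 0 := by
    simpa using ((hasDerivAt_id (0:ℝ)).smul_const a).const_add x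
  have h2 := hasDerivWithinAt_spd hp q h.hasDerivWithinAt (s := univ)
  have h3 := uniqueDiffWithinAt_univ.eq_deriv _ h1 h2
  rw [zero_smul, add_zero] at h3
  exact h3

/-- The Maurer-Cartan-type form `M⁻¹ dM`. -/
def mc (p q : ℤ) (x a : Target) : Matrix (Fin 7) (Fin 7) ℝ := spdInv p q x * fderiv ℝ (spd p q) x a

theorem mc_eq (hp : p ≠ 0) (q : ℤ) (x a : Target) :
    mc p q x a = cosetInv p q x * pmat (frame p q x a) * coset p q x := by
  have h := coset_mul_inv hp q x
  have h' : (cosetInv p q x)ᵀ * (coset p q x)ᵀ = 1 := by rw [← Matrix.transpose_mul, h, Matrix.transpose_one]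
  rw [mc, fderiv_spd hp, spdInv]
  calc _ = cosetInv p q x * ((cosetInv p q x)ᵀ * (coset p q x)ᵀ) * pmat (frame p q x a) * coset p q x := by
        simp only [Matrix.mul_assoc]
    _ = _ := by rw [h', Matrix.mul_one]

theorem trace_conj (hp : p ≠ 0) (q : ℤ) (x : Target) (A B : Matrix (Fin 7) (Fin 7) ℝ) :
    ((cosetInv p q x * A * coset p q x) * (cosetInv p q x * B * coset p q x)).trace = (A * B).trace := by
  have h := coset_mul_inv hp q x
  calc _ = (cosetInv p q x * A * (coset p q x * cosetInv p q x) * B * coset p q x).trace := by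
        simp only [Matrix.mul_assoc]
    _ = _ := by
      rw [h, Matrix.mul_one, Matrix.trace_mul_comm, ← Matrix.mul_assoc, ← Matrix.mul_assoc, h, Matrix.one_mul]

/-- G is a quarter of the pullback of the affine-invariant metric tr(M⁻¹dM M⁻¹dM). The trace is
unchanged by conjugation with V, which turns M⁻¹dM into `pmat` of the frame. -/
theorem metric_eq_mc (hp : p ≠ 0) (q : ℤ) (x a b : Target) :
    metric p q x a b = 1 / 4 * (mc p q x a * mc p q x b).trace := by
  rw [metric_eq_trace, mc_eq hp, mc_eq hp, trace_conj hp]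

theorem fderiv_spdInv (hp : p ≠ 0) (q : ℤ) (x a : Target) : fderiv ℝ (spdInv p q) x a =
    -(mc p q x a * spdInv p q x) := by
  have h1 := hasDerivAt_line ((contDiff_spd hp q).differentiable (by simp) x) a
  have h2 := hasDerivAt_line ((contDiff_spdInv hp q).differentiable (by simp) x) a
  have h3 := h2.fun_mul h1
  simp only [spdInv_mul hp] at h3
  have := uniqueDiffWithinAt_univ.eq_deriv _ h3 (hasDerivWithinAt_const (0:ℝ) univ _)
  simp only [zero_smul, add_zero] at this
  have := congrArg (· * spdInv p q x) this
  simp only [add_mul, Matrix.mul_assoc, spd_mul_inv hp, zero_mul, Matrix.mul_one] at this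
  rw [mc, Matrix.mul_assoc]
  exact eq_neg_of_add_eq_zero_left this

/-- The second derivative of the embedding. -/
def hess (p q : ℤ) (x a b : Target) : Matrix (Fin 7) (Fin 7) ℝ := fderiv ℝ (fderiv ℝ (spd p q)) x a b

theorem hess_symm (hp : p ≠ 0) (q : ℤ) (x a b : Target) : hess p q x a b = hess p q x b a :=
  ((contDiff_spd hp q).contDiffAt.isSymmSndFDerivAt (by simp; exact WithTop.coe_le_coe.2 le_top)) a b

theorem differentiable_fderiv_spd (hp : p ≠ 0) (q : ℤ) : Differentiable ℝ (fderiv ℝ (spd p q)) :=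
  ((contDiff_spd hp q).fderiv_right (m := ∞) (by simp)).differentiable (by simp)

theorem hasDerivAt_mc_line (hp : p ≠ 0) (q : ℤ) (x a b : Target) :
    HasDerivWithinAt (fun r : ℝ => mc p q (x + r • a) b)
      (-(mc p q x a * mc p q x b) + spdInv p q x * hess p q x a b) univ 0 := by
  have h1 := hasDerivAt_line (F := Target →L[ℝ] Matrix (Fin 7) (Fin 7) ℝ) (f := fderiv ℝ (spd p q)) (differentiable_fderiv_spd hp q x) a
  have h2 := hasDerivAt_line ((contDiff_spdInv hp q).differentiable (by simp) x) a
  have h3 : HasDerivWithinAt (fun r : ℝ => fderiv ℝ (spd p q) (x + r • a) b) (hess p q x a b) univ 0 := by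
    simpa [hess] using h1.clm_apply (hasDerivWithinAt_const (0:ℝ) univ b)
  refine (h2.fun_mul h3).congr_deriv ?_
  simp only [zero_smul, add_zero, fderiv_spdInv hp, mc, Matrix.mul_assoc, neg_mul]

theorem differentiable_mc (hp : p ≠ 0) (q : ℤ) (b : Target) : Differentiable ℝ (fun x => mc p q x b) :=
  ((contDiff_spdInv hp q).differentiable (by simp)).mul
    ((differentiable_fderiv_spd hp q).clm_apply (differentiable_const b))

theorem dGram_eq (hp : p ≠ 0) (q : ℤ) (x : Target) (D B C : Fin 8) :
    dGram p q x D B C = 1 / 4 *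
      ((-(mc p q x (coordVec D) * mc p q x (coordVec B)) + spdInv p q x * hess p q x (coordVec D) (coordVec B))
          * mc p q x (coordVec C)
        + mc p q x (coordVec B) *
          (-(mc p q x (coordVec D) * mc p q x (coordVec C)) + spdInv p q x * hess p q x (coordVec D) (coordVec C))).trace := by
  have e : (fun y : Target => gram p q y B C) =
      fun y => 1 / 4 * (mc p q y (coordVec B) * mc p q y (coordVec C)).trace := by
    ext y; simp [gram, metric_eq_mc hp]
  have hd : DifferentiableAt ℝ (fun y => 1 / 4 * (mc p q y (coordVec B) * mc p q y (coordVec C)).trace) x := by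
    refine DifferentiableAt.const_mul ?_ _
    exact (Matrix.traceLinearMap (Fin 7) ℝ ℝ).toContinuousLinearMap.differentiableAt.comp x
      (((differentiable_mc hp q _).mul (differentiable_mc hp q _)) x)
  rw [dGram, e]
  have h1 := hasDerivAt_line hd (coordVec D)
  have h2 := ((hasDerivAt_mc_line hp q x (coordVec D) (coordVec B)).fun_mul
    (hasDerivAt_mc_line hp q x (coordVec D) (coordVec C))).matrix_trace.const_mul (1 / 4)
  have := uniqueDiffWithinAt_univ.eq_deriv _ h1 h2
  simpa using this

end

/-! ### Geodesics of the target -/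

section

variable {p q : ℤ}

theorem eq_sum_coordVec (a : Target) : a = ∑ B, a B • coordVec B := by
  ext i; simp [coordVec, Finset.sum_apply, Pi.single_apply]

theorem mc_eq_sum (p q : ℤ) (x a : Target) : mc p q x a = ∑ B, a B • mc p q x (coordVec B) := by
  conv_lhs => rw [mc, eq_sum_coordVec a]
  simp only [mc, map_sum, map_smul, Matrix.mul_sum, Matrix.mul_smul]

theorem hess_eq_sum (p q : ℤ) (x a b : Target) :
    hess p q x a b = ∑ B, ∑ C, (a B * b C) • hess p q x (coordVec B) (coordVec C) := by
  conv_lhs => rw [hess, eq_sum_coordVec a, eq_sum_coordVec b]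
  simp only [map_sum, map_smul, sum_apply, smul_apply, smul_smul,
    Finset.smul_sum]
  rw [Finset.sum_comm]
  simp only [mul_comm, hess]

theorem gram_mulVec (hp : p ≠ 0) (q : ℤ) (x a : Target) (N : Fin 8) :
    (gram p q x *ᵥ a) N = metric p q x (coordVec N) a := by
  rw [metric_eq_mc hp, mc_eq_sum p q x a]
  simp only [Matrix.mulVec, dotProduct, gram, Matrix.of_apply, metric_eq_mc hp, Matrix.mul_smul,
    Matrix.trace_sum, Matrix.trace_smul, smul_eq_mul, Finset.mul_sum]
  exact Finset.sum_congr rfl fun i _ => by ring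

theorem metric_self_nonneg (p q : ℤ) (x a : Target) : 0 ≤ metric p q x a a := by
  rw [metric_eq_frame]
  have : 0 ≤ ∑ i : Fin 7, frame p q x a i.succ * frame p q x a i.succ :=
    Finset.sum_nonneg fun i _ => mul_self_nonneg _
  have := mul_self_nonneg (frame p q x a 0)
  linarith

theorem eq_zero_of_norm_sq {Y : Fin 8 → ℝ} (h : 12 * (Y 0 * Y 0) + ∑ i : Fin 7, Y i.succ * Y i.succ ≤ 0) : Y = 0 := by
  have h1 : ∀ i ∈ Finset.univ, (0:ℝ) ≤ Y (Fin.succ i) * Y i.succ := fun i _ => mul_self_nonneg _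
  have h2 := Finset.sum_nonneg h1
  have h0 := mul_self_nonneg (Y 0)
  have h3 := (Finset.sum_eq_zero_iff_of_nonneg h1).1 (by linarith)
  have h4 : Y 0 * Y 0 = 0 := by linarith
  ext i
  refine Fin.cases ?_ (fun j => ?_) i
  · simpa using h4
  · simpa using h3 j (Finset.mem_univ _)

theorem eq_zero_of_metric (hp : p ≠ 0) {x a : Target} (h : metric p q x a a = 0) : a = 0 := by
  rw [metric_eq_frame] at h
  exact frame_eq_zero hp (eq_zero_of_norm_sq h.le)

theorem gram_det_ne (hp : p ≠ 0) (q : ℤ) (x : Target) : IsUnit (gram p q x).det := by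
  rw [isUnit_iff_ne_zero]
  intro h
  obtain ⟨v, hv, h0⟩ := Matrix.exists_mulVec_eq_zero_iff.2 h
  apply hv
  refine eq_zero_of_metric hp (x := x) (q := q) ?_
  have : ∀ N, metric p q x (coordVec N) v = 0 := fun N => by rw [← gram_mulVec hp, h0]; rfl
  rw [metric_eq_mc hp, mc_eq_sum p q x v, Matrix.sum_mul, Matrix.trace_sum, Finset.mul_sum]
  refine Finset.sum_eq_zero fun N _ => ?_
  rw [← mc_eq_sum, Matrix.smul_mul, Matrix.trace_smul]
  have := this N
  rw [metric_eq_mc hp] at this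
  simp only [smul_eq_mul]
  linear_combination v N * this

/-- Second derivatives of M are symmetric, so those involving the direction D cancel in pairs.
Cyclicity of the trace collects the cubic terms. -/
theorem christoffel_first_kind (hp : p ≠ 0) (q : ℤ) (x : Target) (D B C : Fin 8) :
    dGram p q x B D C + dGram p q x C D B - dGram p q x D B C =
      1 / 4 * (2 * (mc p q x (coordVec D) * (spdInv p q x * hess p q x (coordVec B) (coordVec C))).trace
        - (mc p q x (coordVec D) * (mc p q x (coordVec B) * mc p q x (coordVec C))).trace
        - (mc p q x (coordVec D) * (mc p q x (coordVec C) * mc p q x (coordVec B))).trace) := by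
  simp only [dGram_eq hp]
  rw [hess_symm hp q x (coordVec D) (coordVec B), hess_symm hp q x (coordVec D) (coordVec C),
    hess_symm hp q x (coordVec C) (coordVec B)]
  generalize mc p q x (coordVec B) = b
  generalize mc p q x (coordVec C) = c
  generalize mc p q x (coordVec D) = d
  generalize spdInv p q x * hess p q x (coordVec B) (coordVec C) = hbc
  generalize spdInv p q x * hess p q x (coordVec B) (coordVec D) = hbd
  generalize spdInv p q x * hess p q x (coordVec C) (coordVec D) = hcd
  simp only [Matrix.add_mul, Matrix.mul_add, Matrix.trace_add, Matrix.trace_neg, neg_mul, mul_neg, Matrix.mul_assoc]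
  have cyc : ∀ u v w : Matrix (Fin 7) (Fin 7) ℝ, (u * (v * w)).trace = (v * (w * u)).trace := fun u v w => by
    rw [Matrix.trace_mul_comm, Matrix.mul_assoc]
  rw [Matrix.trace_mul_comm hbd, Matrix.trace_mul_comm hcd]
  have e1 : (b * (d * c)).trace = (d * (c * b)).trace := cyc _ _ _
  have e2 : (c * (d * b)).trace = (d * (b * c)).trace := cyc _ _ _
  simp only [e1, e2]
  ring

/-- The matrix paired with `mc p q x a` is the derivative of M⁻¹M' along a curve with velocity v and
acceleration w. Lowering the index in the geodesic equation shows that it is trace-orthogonal to all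
tangent directions, which is the first variation of the Dirichlet energy. -/
theorem geodesic_orthogonality (hp : p ≠ 0) (q : ℤ) (x v w : Target)
    (h : ∀ M : Fin 8, w M + ∑ B, ∑ C, christoffel p q x M B C * v B * v C = 0) (a : Target) :
    (mc p q x a * (mc p q x w + (-(mc p q x v * mc p q x v) + spdInv p q x * hess p q x v v))).trace = 0 := by
  set S : Fin 8 → ℝ := fun D => ∑ B, ∑ C,
    (dGram p q x B D C + dGram p q x C D B - dGram p q x D B C) * v B * v C with hS
  have hw : w = -((1 / 2 : ℝ) • ((gram p q x)⁻¹ *ᵥ S)) := by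
    ext M
    have := h M
    rw [eq_neg_of_add_eq_zero_left this]
    simp only [christoffel, Pi.neg_apply, Pi.smul_apply, smul_eq_mul, Matrix.mulVec, dotProduct, hS, Finset.mul_sum,
      Finset.sum_mul]
    congr 1
    exact (Finset.sum_congr rfl fun B _ => Finset.sum_comm).trans (Finset.sum_comm.trans
      (Finset.sum_congr rfl fun D _ => Finset.sum_congr rfl fun B _ => Finset.sum_congr rfl fun C _ => by ring))
  have hG : ∀ N, metric p q x (coordVec N) w = -(1 / 2 * S N) := by
    intro N
    rw [← gram_mulVec hp, hw, Matrix.mulVec_neg, Matrix.mulVec_smul, Matrix.mulVec_mulVec,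
      Matrix.mul_nonsing_inv _ (gram_det_ne hp q x), Matrix.one_mulVec]
    rfl
  have hSN : ∀ N, S N = 1 / 2 * (mc p q x (coordVec N) * (-(mc p q x v * mc p q x v)
      + spdInv p q x * hess p q x v v)).trace := by
    intro N
    have e1 : ∑ B, ∑ C, (mc p q x (coordVec N) * (spdInv p q x * hess p q x (coordVec B) (coordVec C))).trace * v B * v C
        = (mc p q x (coordVec N) * (spdInv p q x * hess p q x v v)).trace := by
      rw [hess_eq_sum p q x v v]
      simp only [Matrix.mul_sum, Matrix.mul_smul, Matrix.trace_sum, Matrix.trace_smul, smul_eq_mul]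
      exact Finset.sum_congr rfl fun B _ => Finset.sum_congr rfl fun C _ => by ring
    have e2 : ∑ B, ∑ C, (mc p q x (coordVec N) * (mc p q x (coordVec B) * mc p q x (coordVec C))).trace * v B * v C
        = (mc p q x (coordVec N) * (mc p q x v * mc p q x v)).trace := by
      rw [mc_eq_sum p q x v]
      simp only [Matrix.sum_mul, Matrix.mul_smul, Matrix.smul_mul, Matrix.trace_sum, Matrix.trace_smul, smul_eq_mul, Finset.mul_sum]
      rw [Finset.sum_comm]
      exact Finset.sum_congr rfl fun B _ => Finset.sum_congr rfl fun C _ => by ring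
    have e3 : ∑ B, ∑ C, (mc p q x (coordVec N) * (mc p q x (coordVec C) * mc p q x (coordVec B))).trace * v B * v C
        = (mc p q x (coordVec N) * (mc p q x v * mc p q x v)).trace := by
      rw [← e2, Finset.sum_comm]
      exact Finset.sum_congr rfl fun B _ => Finset.sum_congr rfl fun C _ => by ring
    rw [Matrix.mul_add, Matrix.mul_neg, Matrix.trace_add, Matrix.trace_neg, ← e1]
    conv_rhs => rw [show ∀ a b : ℝ, 1 / 2 * (-a + b) = 1 / 4 * (2 * b - a - a) from fun a b => by ring]
    nth_rw 1 [← e2]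
    rw [← e3]
    simp only [hS, christoffel_first_kind hp, Finset.mul_sum, ← Finset.sum_sub_distrib]
    exact Finset.sum_congr rfl fun B _ => Finset.sum_congr rfl fun C _ => by ring
  have hN : ∀ N, (mc p q x (coordVec N) * (mc p q x w + (-(mc p q x v * mc p q x v) + spdInv p q x * hess p q x v v))).trace = 0 := by
    intro N
    have h1 := hG N
    rw [hSN, metric_eq_mc hp] at h1
    rw [Matrix.mul_add, Matrix.trace_add]
    linarith
  rw [mc_eq_sum p q x a, Matrix.sum_mul, Matrix.trace_sum]
  refine Finset.sum_eq_zero fun N _ => ?_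
  rw [Matrix.smul_mul, Matrix.trace_smul, hN, smul_zero]

theorem pvec_pmat (x : Fin 8 → ℝ) : pvec (pmat x) = x := by
  have h1 := kk_mul
  rw [pmat_eq, pvec]
  ext i
  fin_cases i <;> simp <;> grind

/-- `pmat` as a linear map. -/
def pmatₗ : (Fin 8 → ℝ) →ₗ[ℝ] Matrix (Fin 7) (Fin 7) ℝ where
  toFun := pmat
  map_add' x y := by
    rw [pmat_eq, pmat_eq x, pmat_eq y]
    ext i j
    fin_cases i <;> fin_cases j <;> simp <;> ring
  map_smul' c x := by
    rw [pmat_eq, pmat_eq x]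
    ext i j
    fin_cases i <;> fin_cases j <;> simp <;> ring

/-- `pvec` as a linear map. -/
def pvecₗ : Matrix (Fin 7) (Fin 7) ℝ →ₗ[ℝ] (Fin 8 → ℝ) where
  toFun := pvec
  map_add' x y := by
    ext i
    fin_cases i <;> simp [pvec] <;> ring
  map_smul' c x := by
    ext i
    fin_cases i <;> simp [pvec] <;> ring

theorem hasDerivWithinAt_mc_curve (hp : p ≠ 0) (q : ℤ) {γ γ' : ℝ → Target} {w : Target} {s : Set ℝ} {t : ℝ}
    (h : HasDerivWithinAt γ (γ' t) s t) (h' : HasDerivWithinAt γ' w s t) :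
    HasDerivWithinAt (fun r => mc p q (γ r) (γ' r)) (mc p q (γ t) w + (-(mc p q (γ t) (γ' t) * mc p q (γ t) (γ' t))
      + spdInv p q (γ t) * hess p q (γ t) (γ' t) (γ' t))) s t := by
  have h1 := ((contDiff_spdInv hp q).differentiable (by simp) (γ t)).hasFDerivAt.comp_hasDerivWithinAt t h
  have h2 := (differentiable_fderiv_spd hp q (γ t)).hasFDerivAt.comp_hasDerivWithinAt t h
  have h3 := h1.fun_mul (h2.clm_apply h')
  refine h3.congr_deriv ?_
  simp only [Function.comp_apply, fderiv_spdInv hp, mc, hess, Matrix.mul_assoc, neg_mul, Matrix.mul_add]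
  abel

theorem IsGeodesic.hasDerivWithinAt {γ : ℝ → Target} (h : IsGeodesic p q γ) {t : ℝ} (ht : t ∈ Icc (0:ℝ) 1) :
    HasDerivWithinAt γ (derivWithin γ (Icc 0 1) t) (Icc 0 1) t :=
  (h.1.differentiableOn (by simp) t ht).hasDerivWithinAt

theorem IsGeodesic.hasDerivWithinAt' {γ : ℝ → Target} (h : IsGeodesic p q γ) {t : ℝ} (ht : t ∈ Icc (0:ℝ) 1) :
    HasDerivWithinAt (derivWithin γ (Icc 0 1)) (derivWithin (derivWithin γ (Icc 0 1)) (Icc 0 1) t) (Icc 0 1) t :=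
  (((h.1.derivWithin (uniqueDiffOn_Icc zero_lt_one) (m := 1) (by norm_num)).differentiableOn (by simp)) t ht).hasDerivWithinAt

/-- The geodesic equation makes W' orthogonal to the tangent directions of the target. Total geodesy
makes W' itself such a direction, so definiteness forces W' = 0. -/
theorem IsGeodesic.mc_deriv (hp : p ≠ 0) {γ : ℝ → Target} (h : IsGeodesic p q γ) {t : ℝ} (ht : t ∈ Icc (0:ℝ) 1) :
    HasDerivWithinAt (fun r => mc p q (γ r) (derivWithin γ (Icc 0 1) r)) 0 (Icc 0 1) t := by
  have hγ := h.hasDerivWithinAt ht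
  have hW := hasDerivWithinAt_mc_curve hp q hγ (h.hasDerivWithinAt' ht)
  have orth := geodesic_orthogonality hp q (γ t) _ _ (h.2 t ht)
  have hu := uniqueDiffOn_Icc zero_lt_one t ht
  generalize mc p q (γ t) (derivWithin (derivWithin γ (Icc 0 1)) (Icc 0 1) t) +
        (-(mc p q (γ t) (derivWithin γ (Icc 0 1) t) * mc p q (γ t) (derivWithin γ (Icc 0 1) t)) +
          spdInv p q (γ t) * hess p q (γ t) (derivWithin γ (Icc 0 1) t) (derivWithin γ (Icc 0 1) t)) = W' at hW orth
  refine hW.congr_deriv ?_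
  set γ' := derivWithin γ (Icc 0 1)
  have hV := hasDerivWithinAt_coset hp q hγ
  have hVi := ((contDiff_cosetInv hp q).differentiable (by simp) (γ t)).hasFDerivAt.comp_hasDerivWithinAt t hγ
  set Q := parab (frame p q (γ t) (γ' t)) (Real.sinh (γ t 2) * γ' t 1)
  have hPeq : ∀ r, coset p q (γ r) * mc p q (γ r) (γ' r) * cosetInv p q (γ r) = pmat (frame p q (γ r) (γ' r)) := by
    intro r
    rw [mc_eq hp]
    calc _ = coset p q (γ r) * cosetInv p q (γ r) * pmat (frame p q (γ r) (γ' r)) *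
          (coset p q (γ r) * cosetInv p q (γ r)) := by simp only [Matrix.mul_assoc]
      _ = _ := by rw [coset_mul_inv hp, Matrix.one_mul, Matrix.mul_one]
  have hP := (hV.fun_mul hW).fun_mul hVi
  simp only [Function.comp_apply, hPeq] at hP
  generalize (_ + _ : Matrix (Fin 7) (Fin 7) ℝ) = P' at hP
  -- P = VWV⁻¹ stays in the range of `pmat`, on which `pmatₗ ∘ₗ pvecₗ` is the identity; hence its
  -- derivative lies in that range too.
  have hP2 := (pmatₗ ∘ₗ pvecₗ).toContinuousLinearMap.hasFDerivAt.comp_hasDerivWithinAt t hP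
  have hP3 : HasDerivWithinAt (fun r => pmat (frame p q (γ r) (γ' r))) (pmat (pvec P')) (Icc 0 1) t := by
    refine HasDerivWithinAt.congr_deriv (HasDerivWithinAt.congr_of_eventuallyEq hP2 ?_ ?_) rfl
    · refine Eventually.of_forall fun r => ?_
      change _ = pmat (pvec (pmat _))
      rw [pvec_pmat]
    · change _ = pmat (pvec (pmat _))
      rw [pvec_pmat]
  have e1 := hP3.fun_mul hV
  have e2 := hV.fun_mul hW
  have e3 : ∀ r, pmat (frame p q (γ r) (γ' r)) * coset p q (γ r) = coset p q (γ r) * mc p q (γ r) (γ' r) := by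
    intro r
    rw [← hPeq, Matrix.mul_assoc, cosetInv_mul hp, Matrix.mul_one]
  simp only [e3] at e1
  -- Differentiating PV = VW in both ways gives VW' = (P' + [P, Q])V, where both summands lie in the
  -- range of `pmat`.
  have e4 := hu.eq_deriv _ e1 e2
  rw [Matrix.mul_assoc Q, ← e3] at e4
  have hY := pmat_pvec_comm (frame p q (γ t) (γ' t)) (Real.sinh (γ t 2) * γ' t 1)
  set X := frame p q (γ t) (γ' t)
  set Y := pvec (pmat X * Q - Q * pmat X)
  have e5 : coset p q (γ t) * W' = pmat (pvec P' + Y) * coset p q (γ t) := by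
    rw [show pmat (pvec P' + Y) = pmat (pvec P') + pmat Y from map_add pmatₗ _ _, hY, Matrix.add_mul, Matrix.sub_mul]
    rw [← Matrix.mul_assoc, ← Matrix.mul_assoc] at e4
    rw [← sub_eq_iff_eq_add'.2 e4]
    abel
  have e6 : W' = cosetInv p q (γ t) * pmat (pvec P' + Y) * coset p q (γ t) := by
    rw [Matrix.mul_assoc, ← e5, ← Matrix.mul_assoc, cosetInv_mul hp, Matrix.one_mul]
  obtain ⟨a, ha⟩ := frame_surjective hp q (γ t) (pvec P' + Y)
  have e7 := orth a
  rw [e6, mc_eq hp, trace_conj hp, ha, trace_pmat] at e7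
  have hz : pvec P' + Y = 0 := eq_zero_of_norm_sq (by linarith)
  rw [e6, hz]
  rw [show pmat 0 = 0 from map_zero pmatₗ]
  simp

theorem IsGeodesic.mc_const (hp : p ≠ 0) {γ : ℝ → Target} (h : IsGeodesic p q γ) {t : ℝ} (ht : t ∈ Icc (0:ℝ) 1) :
    mc p q (γ t) (derivWithin γ (Icc 0 1) t) = mc p q (γ 0) (derivWithin γ (Icc 0 1) 0) := by
  refine (convex_Icc (0:ℝ) 1).is_const_of_fderivWithin_eq_zero (𝕜 := ℝ) 
    (f := fun r => mc p q (γ r) (derivWithin γ (Icc 0 1) r)) (fun r hr => (h.mc_deriv hp hr).differentiableWithinAt) ?_ ht (by simp)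
  intro r hr
  ext1
  change derivWithin _ _ _ = _
  rw [(h.mc_deriv hp hr).derivWithin (uniqueDiffOn_Icc zero_lt_one r hr)]
  simp

end

/-! ### Lengths of curves of positive definite matrices -/

section

/-! ### Spectral estimates for symmetric matrices. -/

section
variable {n : Type*} [Fintype n] [DecidableEq n]

theorem exists_orthogonal_diagonalization {A : Matrix n n ℝ} (hA : A.IsSymm) :
    ∃ (U : Matrix n n ℝ) (a : n → ℝ), Uᵀ * U = 1 ∧ U * Uᵀ = 1 ∧ A = U * Matrix.diagonal a * Uᵀ := by
  have hH : A.IsHermitian := by rwa [Matrix.IsHermitian, Matrix.conjTranspose_eq_transpose_of_trivial]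
  have h1 := (Matrix.mem_unitaryGroup_iff' (A := (hH.eigenvectorUnitary : Matrix n n ℝ))).1 hH.eigenvectorUnitary.2
  rw [Matrix.star_eq_conjTranspose, Matrix.conjTranspose_eq_transpose_of_trivial] at h1
  refine ⟨hH.eigenvectorUnitary, hH.eigenvalues, h1, mul_eq_one_comm.1 h1, ?_⟩
  have := hH.spectral_theorem
  rw [Unitary.conjStarAlgAut_apply, Matrix.star_eq_conjTranspose, Matrix.conjTranspose_eq_transpose_of_trivial] at this
  exact this

theorem conj_diagonal_apply_self (O : Matrix n n ℝ) (b : n → ℝ) (i : n) :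
    (O * Matrix.diagonal b * Oᵀ) i i = ∑ j, O i j ^ 2 * b j := by
  rw [Matrix.mul_apply]
  simp only [Matrix.mul_diagonal, Matrix.transpose_apply]
  exact Finset.sum_congr rfl fun j _ => by ring

theorem sum_sq_row {O : Matrix n n ℝ} (h : O * Oᵀ = 1) (i : n) : ∑ j, O i j ^ 2 = 1 := by
  have := congrFun (congrFun h i) i
  simpa [Matrix.mul_apply, sq] using this

/-- For orthogonal T = UᵀO the numbers T i j ^ 2 form a doubly stochastic matrix, and every term is
an average with these weights of a scalar expression in a i and b j. The scalar Taylor bound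
therefore carries over. This differentiates spectral sums without choosing eigenvalues or
eigenvectors smoothly. -/
theorem spectral_sum_taylor_bound {U O : Matrix n n ℝ} {a b : n → ℝ} (hU : Uᵀ * U = 1) (hU' : U * Uᵀ = 1)
    (hO' : O * Oᵀ = 1) {φ φ' : ℝ → ℝ} {C : ℝ}
    (hφ : ∀ i j, |φ (b j) - φ (a i) - φ' (a i) * (b j - a i)| ≤ C * (b j - a i) ^ 2) :
    |∑ j, φ (b j) - ∑ i, φ (a i) - ∑ i, φ' (a i) *
        (Uᵀ * (O * Matrix.diagonal b * Oᵀ - U * Matrix.diagonal a * Uᵀ) * U) i i| ≤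
      C * ((O * Matrix.diagonal b * Oᵀ - U * Matrix.diagonal a * Uᵀ) *
        (O * Matrix.diagonal b * Oᵀ - U * Matrix.diagonal a * Uᵀ)).trace := by
  set T := Uᵀ * O with hT
  have hT1 : T * Tᵀ = 1 := by
    rw [hT, Matrix.transpose_mul, Matrix.transpose_transpose, Matrix.mul_assoc, ← Matrix.mul_assoc O, hO', Matrix.one_mul, hU]
  have hT2 : Tᵀ * T = 1 := mul_eq_one_comm.1 hT1
  have row := sum_sq_row hT1
  have col : ∀ j, ∑ i, T i j ^ 2 = 1 := fun j => by
    simpa using sum_sq_row (O := Tᵀ) (by simpa using hT2) j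
  set B := O * Matrix.diagonal b * Oᵀ with hB
  set A := U * Matrix.diagonal a * Uᵀ with hA
  have hUB : Uᵀ * B * U = T * Matrix.diagonal b * Tᵀ := by
    rw [hT, hB, Matrix.transpose_mul, Matrix.transpose_transpose]; simp only [Matrix.mul_assoc]
  have hUA : Uᵀ * A * U = Matrix.diagonal a := by
    rw [hA]
    calc _ = Uᵀ * U * Matrix.diagonal a * (Uᵀ * U) := by simp only [Matrix.mul_assoc]
      _ = _ := by rw [hU, Matrix.one_mul, Matrix.mul_one]
  have hdiag : ∀ i, (Uᵀ * (B - A) * U) i i = ∑ j, T i j ^ 2 * (b j - a i) := by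
    intro i
    rw [Matrix.mul_sub, Matrix.sub_mul, Matrix.sub_apply, hUB, hUA, conj_diagonal_apply_self, Matrix.diagonal_apply_eq]
    simp only [mul_sub, Finset.sum_sub_distrib, ← Finset.sum_mul, row, one_mul]
  have htr : ((B - A) * (B - A)).trace = ∑ i, ∑ j, T i j ^ 2 * (b j - a i) ^ 2 := by
    have e1 : ((B - A) * (B - A)).trace = (((T * Matrix.diagonal b * Tᵀ) - Matrix.diagonal a) *
        ((T * Matrix.diagonal b * Tᵀ) - Matrix.diagonal a)).trace := by
      rw [← hUB, ← hUA, ← Matrix.sub_mul, ← Matrix.mul_sub]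
      calc _ = (U * Uᵀ * (B - A) * (U * Uᵀ) * (B - A)).trace := by rw [hU', Matrix.one_mul, Matrix.mul_one]
        _ = (U * (Uᵀ * (B - A) * U * (Uᵀ * (B - A)))).trace := by simp only [Matrix.mul_assoc]
        _ = _ := by rw [Matrix.trace_mul_comm]; simp only [Matrix.mul_assoc]
    have e2 : (T * Matrix.diagonal b * Tᵀ) * (T * Matrix.diagonal b * Tᵀ) = T * Matrix.diagonal (fun j => b j ^ 2) * Tᵀ := by
      calc _ = T * Matrix.diagonal b * (Tᵀ * T) * Matrix.diagonal b * Tᵀ := by simp only [Matrix.mul_assoc]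
        _ = _ := by rw [hT2, Matrix.mul_one, Matrix.mul_assoc T, Matrix.diagonal_mul_diagonal]; simp only [sq]
    have e3 : ∀ i, ((T * Matrix.diagonal b * Tᵀ) * Matrix.diagonal a) i i = ∑ j, T i j ^ 2 * b j * a i := fun i => by
      rw [Matrix.mul_diagonal, conj_diagonal_apply_self, Finset.sum_mul]
    have e4 : ∀ i, (Matrix.diagonal a * (T * Matrix.diagonal b * Tᵀ)) i i = ∑ j, T i j ^ 2 * b j * a i := fun i => by
      rw [Matrix.diagonal_mul, conj_diagonal_apply_self, mul_comm, Finset.sum_mul]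
    rw [e1, Matrix.sub_mul, Matrix.mul_sub, Matrix.mul_sub, e2, Matrix.diagonal_mul_diagonal]
    simp only [Matrix.trace, Matrix.diag_apply, Matrix.sub_apply, e3, e4, conj_diagonal_apply_self, Matrix.diagonal_apply_eq]
    refine Finset.sum_congr rfl fun i _ => ?_
    have : a i * a i = ∑ j, T i j ^ 2 * (a i * a i) := by rw [← Finset.sum_mul, row, one_mul]
    rw [this, ← Finset.sum_sub_distrib, ← Finset.sum_sub_distrib, ← Finset.sum_sub_distrib]
    exact Finset.sum_congr rfl fun j _ => by ring
  have hb : ∑ j, φ (b j) = ∑ i, ∑ j, T i j ^ 2 * φ (b j) := by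
    rw [Finset.sum_comm]
    simp only [← Finset.sum_mul, col, one_mul]
  have ha : ∑ i, φ (a i) = ∑ i, ∑ j, T i j ^ 2 * φ (a i) := by
    simp only [← Finset.sum_mul, row, one_mul]
  have key : ∑ j, φ (b j) - ∑ i, φ (a i) - ∑ i, φ' (a i) * (Uᵀ * (B - A) * U) i i =
      ∑ i, ∑ j, T i j ^ 2 * (φ (b j) - φ (a i) - φ' (a i) * (b j - a i)) := by
    simp only [hdiag, hb, ha, Finset.mul_sum, ← Finset.sum_sub_distrib]
    exact Finset.sum_congr rfl fun i _ => Finset.sum_congr rfl fun j _ => by ring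
  rw [key, htr, Finset.mul_sum]
  refine (Finset.abs_sum_le_sum_abs _ _).trans (Finset.sum_le_sum fun i _ => ?_)
  rw [Finset.mul_sum]
  refine (Finset.abs_sum_le_sum_abs _ _).trans (Finset.sum_le_sum fun j _ => ?_)
  rw [abs_mul, abs_of_nonneg (sq_nonneg (T i j))]
  nlinarith [mul_le_mul_of_nonneg_left (hφ i j) (sq_nonneg (T i j))]

theorem le_trace_of_pos {U : Matrix n n ℝ} {a : n → ℝ} (hU : Uᵀ * U = 1) (ha : ∀ i, 0 ≤ a i) (i : n) :
    a i ≤ (U * Matrix.diagonal a * Uᵀ).trace := by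
  rw [Matrix.trace_mul_comm, ← Matrix.mul_assoc, hU, Matrix.one_mul, Matrix.trace_diagonal]
  exact Finset.single_le_sum (fun j _ => ha j) (Finset.mem_univ i)

theorem inv_conj_diagonal {U : Matrix n n ℝ} {a : n → ℝ} (hU : Uᵀ * U = 1) (hU' : U * Uᵀ = 1) (ha : ∀ i, a i ≠ 0) 
    {B : Matrix n n ℝ} (hB : B * (U * Matrix.diagonal a * Uᵀ) = 1) : B = U * Matrix.diagonal (fun i => (a i)⁻¹) * Uᵀ := by
  have : (U * Matrix.diagonal a * Uᵀ) * (U * Matrix.diagonal (fun i => (a i)⁻¹) * Uᵀ) = 1 := by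
    calc _ = U * Matrix.diagonal a * (Uᵀ * U) * Matrix.diagonal (fun i => (a i)⁻¹) * Uᵀ := by simp only [Matrix.mul_assoc]
      _ = U * (Matrix.diagonal a * Matrix.diagonal (fun i => (a i)⁻¹)) * Uᵀ := by rw [hU, Matrix.mul_one, Matrix.mul_assoc U]
      _ = 1 := by
        rw [Matrix.diagonal_mul_diagonal]
        simp only [mul_inv_cancel₀ (ha _)]
        rw [Matrix.diagonal_one, Matrix.mul_one, hU']
  calc B = B * ((U * Matrix.diagonal a * Uᵀ) * (U * Matrix.diagonal (fun i => (a i)⁻¹) * Uᵀ)) := by rw [this, Matrix.mul_one]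
    _ = _ := by rw [← Matrix.mul_assoc, hB, Matrix.one_mul]

/-- Cauchy-Schwarz for the affine-invariant inner product, against a matrix commuting with the base point. -/
theorem abs_sum_spectral_le {U D B : Matrix n n ℝ} {a c : n → ℝ} (hU : Uᵀ * U = 1) (hU' : U * Uᵀ = 1)
    (ha : ∀ i, 0 < a i) (hB : B * (U * Matrix.diagonal a * Uᵀ) = 1) (hD : D.IsSymm) :
    |∑ i, c i / a i * (Uᵀ * D * U) i i| ≤ √(∑ i, c i ^ 2) * √((B * D * (B * D)).trace) := by
  set Y := Uᵀ * D * U with hY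
  have hYs : ∀ i j, Y j i = Y i j := fun i j => by
    have : Yᵀ = Y := by
      rw [hY, Matrix.transpose_mul, Matrix.transpose_mul, Matrix.transpose_transpose, hD.eq, Matrix.mul_assoc]
    exact congrFun (congrFun this i) j
  have htr : (B * D * (B * D)).trace = ∑ i, ∑ j, (a i)⁻¹ * Y i j * ((a j)⁻¹ * Y j i) := by
    rw [inv_conj_diagonal hU hU' (fun i => (ha i).ne') hB]
    set E := Matrix.diagonal (fun i => (a i)⁻¹)
    calc _ = (U * (E * (Uᵀ * D * U) * E * Uᵀ * D)).trace := by simp only [Matrix.mul_assoc]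
      _ = ((E * Y) * (E * Y)).trace := by rw [Matrix.trace_mul_comm, hY]; simp only [Matrix.mul_assoc]
      _ = _ := by
        simp only [Matrix.trace, Matrix.diag_apply]
        refine Finset.sum_congr rfl fun i _ => ?_
        rw [Matrix.mul_apply]
        simp only [E, Matrix.diagonal_mul]
  -- Only the diagonal terms of a sum of nonnegative terms are kept.
  have hle : ∑ i, (Y i i / a i) ^ 2 ≤ (B * D * (B * D)).trace := by
    rw [htr]
    refine Finset.sum_le_sum fun i _ => ?_
    refine le_trans (le_of_eq ?_) (Finset.single_le_sum (f := fun j => (a i)⁻¹ * Y i j * ((a j)⁻¹ * Y j i)) (fun j _ => ?_) (Finset.mem_univ i))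
    · ring
    · rw [hYs i j]
      have := ha i; have := ha j
      have h2 := mul_self_nonneg (Y i j)
      calc (0:ℝ) ≤ (a i)⁻¹ * (a j)⁻¹ * (Y i j * Y i j) := by positivity
        _ = _ := by ring
  refine (Real.abs_le_sqrt (y := (∑ i, c i ^ 2) * (B * D * (B * D)).trace) ?_).trans_eq (Real.sqrt_mul (Finset.sum_nonneg fun i _ => sq_nonneg _) _)
  calc _ = (∑ i, c i * (Y i i / a i)) ^ 2 := by
        congr 1; exact Finset.sum_congr rfl fun i _ => by ring
    _ ≤ _ := Finset.sum_mul_sq_le_sq_mul_sq _ _ _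
    _ ≤ _ := mul_le_mul_of_nonneg_left hle (Finset.sum_nonneg fun i _ => sq_nonneg _)
end

/-- The derivative 2 log x / x of log² is Lipschitz on a compact interval away from 0; the mean
value inequality is applied once for this and once more for the remainder. -/
theorem log_sq_taylor {l L : ℝ} (hl : 0 < l) : ∃ C : ℝ, 0 ≤ C ∧ ∀ x ∈ Icc l L, ∀ y ∈ Icc l L,
    |Real.log y ^ 2 - Real.log x ^ 2 - 2 * (Real.log x / x) * (y - x)| ≤ C * (y - x) ^ 2 := by
  have hpos : ∀ z ∈ Icc l L, 0 < z := fun z hz => hl.trans_le hz.1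
  have hcont : ContinuousOn (fun z : ℝ => 2 * ((z⁻¹ * z - Real.log z * 1) / z ^ 2)) (Icc l L) := by
    have : ∀ z ∈ Icc l L, z ≠ 0 := fun z hz => (hpos z hz).ne'
    refine ContinuousOn.mul continuousOn_const (ContinuousOn.div (ContinuousOn.sub ((continuousOn_inv₀.mono this).mul continuousOn_id)
      ((Real.continuousOn_log.mono this).mul continuousOn_const)) (by fun_prop) fun z hz => ?_)
    exact pow_ne_zero 2 (this z hz)
  obtain ⟨C, hC⟩ := isCompact_Icc.exists_bound_of_continuousOn hcont
  refine ⟨max C 0, le_max_right _ _, fun x hx y hy => ?_⟩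
  have hlip : ∀ z ∈ Icc l L, ‖2 * (Real.log z / z) - 2 * (Real.log x / x)‖ ≤ max C 0 * ‖z - x‖ := fun z hz =>
    (convex_Icc l L).norm_image_sub_le_of_norm_hasDerivWithin_le (f := fun z => 2 * (Real.log z / z)) 
      (fun w hw => (((Real.hasDerivAt_log (hpos w hw).ne').fun_div (hasDerivAt_id w) (hpos w hw).ne').const_mul 2).hasDerivWithinAt)
      (fun w hw => (hC w hw).trans (le_max_left _ _)) hx hz
  have hseg : uIcc x y ⊆ Icc l L := uIcc_subset_Icc hx hy
  have := (convex_uIcc x y).norm_image_sub_le_of_norm_hasDerivWithin_le (f := fun z => Real.log z ^ 2 - 2 * (Real.log x / x) * z)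
    (f' := fun z => 2 * (Real.log z / z) - 2 * (Real.log x / x)) (C := max C 0 * |y - x|) (x := x) (y := y)
    (fun w hw => by
      refine HasDerivAt.hasDerivWithinAt ?_
      refine (((Real.hasDerivAt_log (hpos w (hseg hw)).ne').fun_pow 2).fun_sub ((hasDerivAt_id w).const_mul _)).congr_deriv ?_
      simp; ring)
    (fun w hw => (hlip w (hseg hw)).trans (mul_le_mul_of_nonneg_left (by
        rw [Real.norm_eq_abs]
        exact abs_sub_left_of_mem_uIcc hw) (le_max_right _ _)))
    left_mem_uIcc right_mem_uIcc
  rw [Real.norm_eq_abs, Real.norm_eq_abs] at this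
  calc _ = |Real.log y ^ 2 - 2 * (Real.log x / x) * y - (Real.log x ^ 2 - 2 * (Real.log x / x) * x)| := by congr 1; ring
    _ ≤ _ := this
    _ = _ := by rw [mul_assoc, abs_mul_abs_self]; ring

/-- This integrates |(√R)'| ≤ σ. As √ is not differentiable at 0, R is replaced by R + δ² and δ is
arbitrary at the end. -/
theorem sqrt_le_sqrt_add_integral {R R' σ : ℝ → ℝ} (hR : ∀ t ∈ Icc (0:ℝ) 1, HasDerivWithinAt R (R' t) (Icc 0 1) t)
    (hR0 : ∀ t ∈ Icc (0:ℝ) 1, 0 ≤ R t) (hR1 : R 1 = 0) (hσ : ContinuousOn σ (Icc 0 1)) (hσ0 : ∀ t ∈ Icc (0:ℝ) 1, 0 ≤ σ t)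
    (hRσ : ∀ t ∈ Icc (0:ℝ) 1, |R' t| ≤ 2 * (√(R t) * σ t)) : √(R 0) ≤ ∫ t in (0:ℝ)..1, σ t := by
  refine le_of_forall_pos_le_add fun δ hδ => ?_
  have hpos : ∀ t ∈ Icc (0:ℝ) 1, 0 < R t + δ ^ 2 := fun t ht => by have := hR0 t ht; positivity
  have hint : IntervalIntegrable σ volume 0 1 := (hσ.mono (by rw [uIcc_of_le zero_le_one])).intervalIntegrable
  have hmono : MonotoneOn (fun t => √(R t + δ ^ 2) + ∫ r in (0:ℝ)..t, σ r) (Icc 0 1) := by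
    have hd : ∀ t ∈ Ioo (0:ℝ) 1, HasDerivAt (fun t => √(R t + δ ^ 2) + ∫ r in (0:ℝ)..t, σ r)
        (R' t / (2 * √(R t + δ ^ 2)) + σ t) t := by
      intro t ht
      have ht' := Ioo_subset_Icc_self ht
      have h1 := ((hR t ht').hasDerivAt (Icc_mem_nhds ht.1 ht.2)).add_const (δ ^ 2)
      refine (h1.sqrt (hpos t ht').ne').add (intervalIntegral.integral_hasDerivAt_right ?_ ?_ ?_)
      · exact (hσ.mono (by rw [uIcc_of_le ht.1.le]; exact Icc_subset_Icc le_rfl ht.2.le)).intervalIntegrable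
      · exact (hσ.mono Ioo_subset_Icc_self).stronglyMeasurableAtFilter isOpen_Ioo t ht
      · exact hσ.continuousAt (Icc_mem_nhds ht.1 ht.2)
    refine monotoneOn_of_deriv_nonneg (convex_Icc 0 1) ?_ ?_ ?_
    · refine ContinuousOn.add ?_ ?_
      · exact (ContinuousOn.add (fun t ht => (hR t ht).continuousWithinAt) continuousOn_const).sqrt
      · have := intervalIntegral.continuousOn_primitive_interval (f := σ) (μ := volume) (a := 0) (b := 1)
          (by rw [uIcc_of_le zero_le_one]; exact hσ.integrableOn_Icc)
        rwa [uIcc_of_le zero_le_one] at this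
    · rw [interior_Icc]
      exact fun t ht => (hd t ht).differentiableAt.differentiableWithinAt
    · rw [interior_Icc]
      intro t ht
      have ht' := Ioo_subset_Icc_self ht
      rw [(hd t ht).deriv]
      have h2 := hRσ t ht'
      have h3 : √(R t) ≤ √(R t + δ ^ 2) := Real.sqrt_le_sqrt (by nlinarith)
      have h4 := Real.sqrt_pos.2 (hpos t ht')
      have h5 : -σ t ≤ R' t / (2 * √(R t + δ ^ 2)) := by
        rw [le_div_iff₀ (by positivity)]
        nlinarith [neg_abs_le (R' t), mul_le_mul_of_nonneg_right h3 (hσ0 t ht')]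
      linarith
  have := hmono (left_mem_Icc.2 zero_le_one) (right_mem_Icc.2 zero_le_one) zero_le_one
  simp only [intervalIntegral.integral_same, add_zero, hR1, zero_add, Real.sqrt_sq hδ.le] at this
  have h6 : √(R 0) ≤ √(R 0 + δ ^ 2) := Real.sqrt_le_sqrt (by nlinarith)
  linarith

theorem continuous_matrix_trace : Continuous (fun A : Matrix (Fin 7) (Fin 7) ℝ => A.trace) :=
  (Matrix.traceLinearMap (Fin 7) ℝ ℝ).toContinuousLinearMap.continuous

theorem _root_.HasDerivWithinAt.matrix_apply {f : ℝ → Matrix (Fin 7) (Fin 7) ℝ} {f' : Matrix (Fin 7) (Fin 7) ℝ} {s : Set ℝ} {t : ℝ}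
    (hf : HasDerivWithinAt f f' s t) (i j : Fin 7) : HasDerivWithinAt (fun x => f x i j) (f' i j) s t :=
  (Matrix.entryLinearMap ℝ ℝ i j (m := Fin 7) (n := Fin 7)).toContinuousLinearMap.hasFDerivAt.comp_hasDerivWithinAt t hf

/-- The Taylor bound with zero increment: the two diagonalizations belong to the same matrix, so the
error term vanishes. -/
theorem eigenvalues_unique {U O : Matrix (Fin 7) (Fin 7) ℝ} {a b : Fin 7 → ℝ} (hU : Uᵀ * U = 1) (hU' : U * Uᵀ = 1)
    (hO' : O * Oᵀ = 1) (ha : ∀ i, 0 < a i) (hb : ∀ i, 0 < b i)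
    (h : O * Matrix.diagonal b * Oᵀ = U * Matrix.diagonal a * Uᵀ) :
    ∑ j, Real.log (b j) ^ 2 = ∑ i, Real.log (a i) ^ 2 := by
  obtain ⟨l, hl, hla⟩ : ∃ l : ℝ, 0 < l ∧ ∀ i, l ≤ a i ∧ l ≤ b i := by
    refine ⟨Finset.univ.inf' Finset.univ_nonempty (fun i => min (a i) (b i)), ?_, fun i => ?_⟩
    · rw [Finset.lt_inf'_iff]
      exact fun i _ => lt_min (ha i) (hb i)
    · have := Finset.inf'_le (s := Finset.univ) (fun i => min (a i) (b i)) (Finset.mem_univ i)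
      exact ⟨this.trans (min_le_left _ _), this.trans (min_le_right _ _)⟩
  obtain ⟨C, -, hC⟩ := log_sq_taylor (l := l) (L := ∑ i, (a i + b i)) hl
  have hL : ∀ i, a i + b i ≤ ∑ i, (a i + b i) := fun i =>
    Finset.single_le_sum (f := fun i => a i + b i) (fun j _ => (add_pos (ha j) (hb j)).le) (Finset.mem_univ i)
  have := spectral_sum_taylor_bound (φ := fun z => Real.log z ^ 2) (φ' := fun z => 2 * (Real.log z / z)) (C := C) hU hU' hO' (a := a) (b := b)
    fun i j => hC _ ⟨(hla i).1, by linarith [hL i, hb i]⟩ _ ⟨(hla j).2, by linarith [hL j, ha j]⟩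
  rw [h, sub_self] at this
  simp at this
  linarith

/-- In the space of positive definite matrices the length of a curve ending at the identity is at least the norm of
the logarithm of its starting point. -/
theorem norm_log_le_length {N N' Ni : ℝ → Matrix (Fin 7) (Fin 7) ℝ}
    (hN : ∀ t ∈ Icc (0:ℝ) 1, HasDerivWithinAt N (N' t) (Icc 0 1) t) (hN' : ContinuousOn N' (Icc 0 1))
    (hNi : ContinuousOn Ni (Icc 0 1)) (hinv : ∀ t, Ni t * N t = 1) (hsymm : ∀ t, (N t).IsSymm) (hsymm' : ∀ t, (N' t).IsSymm)
    (hpos : ∀ t (U : Matrix (Fin 7) (Fin 7) ℝ) (a : Fin 7 → ℝ), Uᵀ * U = 1 → N t = U * Matrix.diagonal a * Uᵀ → ∀ i, 0 < a i)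
    {U : Matrix (Fin 7) (Fin 7) ℝ} {a : Fin 7 → ℝ} (hU : Uᵀ * U = 1) (hU' : U * Uᵀ = 1)
    (h0 : N 0 = U * Matrix.diagonal (fun i => Real.exp (a i)) * Uᵀ) (h1 : N 1 = 1) :
    √(∑ i, a i ^ 2) ≤ ∫ t in (0:ℝ)..1, √((Ni t * N' t * (Ni t * N' t)).trace) := by
  choose O b hO hO' hNO using fun t => exists_orthogonal_diagonalization (hsymm t)
  have hb : ∀ t i, 0 < b t i := fun t => hpos t _ _ (hO t) (hNO t)
  have hNc : ContinuousOn N (Icc 0 1) := fun t ht => (hN t ht).continuousWithinAt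
  -- Bounds on the traces of N and of its inverse confine all eigenvalues to one compact interval in
  -- (0, ∞), so a single Taylor constant serves for all times.
  obtain ⟨L, hL⟩ := isCompact_Icc.exists_bound_of_continuousOn (continuous_matrix_trace.comp_continuousOn hNc)
  obtain ⟨L', hL'⟩ := isCompact_Icc.exists_bound_of_continuousOn (continuous_matrix_trace.comp_continuousOn hNi)
  have hbL : ∀ t ∈ Icc (0:ℝ) 1, ∀ i, b t i ≤ L := fun t ht i => by
    have h := le_trace_of_pos (hO t) (fun i => (hb t i).le) i
    rw [← hNO] at h
    exact h.trans ((le_abs_self _).trans (hL t ht))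
  have hbL' : ∀ t ∈ Icc (0:ℝ) 1, ∀ i, (b t i)⁻¹ ≤ max L' 1 := fun t ht i => by
    have h := le_trace_of_pos (hO t) (fun i => (inv_pos.2 (hb t i)).le) i
    rw [← inv_conj_diagonal (hO t) (hO' t) (fun i => (hb t i).ne') (by rw [← hNO]; exact hinv t)] at h
    exact h.trans (((le_abs_self _).trans (hL' t ht)).trans (le_max_left _ _))
  have hm : (0:ℝ) < max L' 1 := lt_max_of_lt_right one_pos
  obtain ⟨C, -, hC⟩ := log_sq_taylor (l := (max L' 1)⁻¹) (L := L) (inv_pos.2 hm)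
  have hbI : ∀ t ∈ Icc (0:ℝ) 1, ∀ i, b t i ∈ Icc (max L' 1)⁻¹ L := fun t ht i =>
    ⟨(inv_le_comm₀ hm (hb t i)).2 (hbL' t ht i), hbL t ht i⟩
  set R : ℝ → ℝ := fun t => ∑ i, Real.log (b t i) ^ 2 with hRdef
  set R' : ℝ → ℝ := fun t => ∑ i, 2 * (Real.log (b t i) / b t i) * ((O t)ᵀ * N' t * O t) i i with hR'def
  have hR : ∀ t ∈ Icc (0:ℝ) 1, HasDerivWithinAt R (R' t) (Icc 0 1) t := by
    intro t ht
    -- The linear model of R at t: the diagonalizing matrix is frozen and only N varies. The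
    -- difference from R is bounded by a multiple of tr((N r − N t)²), which has zero derivative at
    -- t.
    set g : ℝ → ℝ := fun r => ∑ i, 2 * (Real.log (b t i) / b t i) * ((O t)ᵀ * (N r - N t) * O t) i i with hg
    have hgd : HasDerivWithinAt g (R' t) (Icc 0 1) t := by
      refine HasDerivWithinAt.fun_sum fun i _ => HasDerivWithinAt.const_mul _ ?_
      have h := ((((hN t ht).sub_const (N t)).const_mul (O t)ᵀ).mul_const (O t)).matrix_apply i i
      exact h
    have hh : HasDerivWithinAt (fun r => ((N r - N t) * (N r - N t)).trace) 0 (Icc 0 1) t := by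
      have h := ((hN t ht).sub_const (N t)).fun_mul ((hN t ht).sub_const (N t))
      refine h.matrix_trace.congr_deriv ?_
      simp
    have hbound : ∀ r ∈ Icc (0:ℝ) 1, ‖(R r - R t - g r)‖ ≤ C * ‖((N r - N t) * (N r - N t)).trace‖ := by
      intro r hr
      have hnn : 0 ≤ ((N r - N t) * (N r - N t)).trace := by
        have : (N r - N t)ᵀ = N r - N t := by rw [Matrix.transpose_sub, (hsymm r).eq, (hsymm t).eq]
        nth_rw 1 [← this]
        simp only [Matrix.trace, Matrix.diag_apply, Matrix.mul_apply, Matrix.transpose_apply]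
        exact Finset.sum_nonneg fun i _ => Finset.sum_nonneg fun j _ => mul_self_nonneg _
      have h := spectral_sum_taylor_bound (φ := fun z => Real.log z ^ 2) (φ' := fun z => 2 * (Real.log z / z)) (C := C)
        (hO t) (hO' t) (hO' r) (a := b t) (b := b r) fun i j => hC _ (hbI t ht i) _ (hbI r hr j)
      rw [← hNO, ← hNO] at h
      rw [Real.norm_eq_abs, Real.norm_of_nonneg hnn]
      exact h
    have hd : HasDerivWithinAt (fun r => R r - R t - g r) 0 (Icc 0 1) t := by
      rw [hasDerivWithinAt_iff_isLittleO] at hh ⊢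
      have e2 : g t = 0 := by simp [hg]
      simp only [e2, sub_self, sub_zero, smul_zero, mul_zero, Matrix.trace_zero] at hh ⊢
      refine Asymptotics.IsBigO.trans_isLittleO (Asymptotics.IsBigO.of_bound C ?_) hh
      filter_upwards [self_mem_nhdsWithin] with r hr using hbound r hr
    have := (hd.fun_add hgd).add_const (R t)
    simp only [zero_add] at this
    refine this.congr_of_mem (fun r _ => ?_) ht
    ring
  have hRσ : ∀ t ∈ Icc (0:ℝ) 1, |R' t| ≤ 2 * (√(R t) * √((Ni t * N' t * (Ni t * N' t)).trace)) := by
    intro t ht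
    have h := abs_sum_spectral_le (c := fun i => Real.log (b t i)) (hO t) (hO' t) (hb t) (by rw [← hNO]; exact hinv t) (hsymm' t)
    have e : R' t = 2 * ∑ i, Real.log (b t i) / b t i * ((O t)ᵀ * N' t * O t) i i := by
      rw [hR'def, Finset.mul_sum]
      exact Finset.sum_congr rfl fun i _ => by ring
    rw [e, abs_mul, abs_two]
    exact mul_le_mul_of_nonneg_left h two_pos.le
  have hR1 : R 1 = 0 := by
    rw [hRdef]
    have := eigenvalues_unique (U := 1) (a := fun _ => 1) (by simp) (by simp) (hO' 1) (fun _ => one_pos) (hb 1)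
      (by rw [← hNO, h1]; simp)
    simpa using this
  have hR0 : R 0 = ∑ i, a i ^ 2 := by
    rw [hRdef]
    have := eigenvalues_unique hU hU' (hO' 0) (fun i => Real.exp_pos (a i)) (hb 0) (by rw [← hNO, h0])
    simpa using this
  rw [← hR0]
  refine sqrt_le_sqrt_add_integral hR (fun t _ => Finset.sum_nonneg fun i _ => sq_nonneg _) hR1 ?_ (fun t _ => Real.sqrt_nonneg _) hRσ
  exact (continuous_matrix_trace.comp_continuousOn ((hNi.mul hN').mul (hNi.mul hN'))).sqrt

end

/-! ### Distance along geodesics and convexity of `e^{-4u}` -/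

section

variable {p q : ℤ}

theorem coset_transpose_mul_inv (hp : p ≠ 0) (q : ℤ) (x : Target) : (coset p q x)ᵀ * (cosetInv p q x)ᵀ = 1 := by
  rw [← Matrix.transpose_mul, cosetInv_mul hp, Matrix.transpose_one]

theorem cosetInv_transpose_mul (hp : p ≠ 0) (q : ℤ) (x : Target) : (cosetInv p q x)ᵀ * (coset p q x)ᵀ = 1 := by
  rw [← Matrix.transpose_mul, coset_mul_inv hp, Matrix.transpose_one]

theorem isSymm_pmat (x : Fin 8 → ℝ) : (pmat x).IsSymm := by
  rw [Matrix.IsSymm, pmat, Matrix.transpose_add, Matrix.transpose_transpose, add_comm]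

theorem fderiv_spd_eq_mul_mc (hp : p ≠ 0) (q : ℤ) (x a : Target) :
    fderiv ℝ (spd p q) x a = spd p q x * mc p q x a := by
  rw [mc, ← Matrix.mul_assoc, spd_mul_inv hp, Matrix.one_mul]

theorem IsGeodesic.hasDerivWithinAt_spd (hp : p ≠ 0) {γ : ℝ → Target} (h : IsGeodesic p q γ) {t : ℝ} (ht : t ∈ Icc (0:ℝ) 1) :
    HasDerivWithinAt (fun r => spd p q (γ r)) (spd p q (γ t) * mc p q (γ 0) (derivWithin γ (Icc 0 1) 0)) (Icc 0 1) t := by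
  have := ((contDiff_spd hp q).differentiable (by simp) (γ t)).hasFDerivAt.comp_hasDerivWithinAt t (h.hasDerivWithinAt ht)
  rw [fderiv_spd_eq_mul_mc hp, h.mc_const hp ht] at this
  exact this

/-- The embedded geodesic is a one-parameter subgroup orbit; its endpoint. -/
theorem IsGeodesic.spd_one (hp : p ≠ 0) {γ : ℝ → Target} (h : IsGeodesic p q γ) {U : Matrix (Fin 7) (Fin 7) ℝ} {a : Fin 7 → ℝ}
    (hU : Uᵀ * U = 1) (hU' : U * Uᵀ = 1)
    (hP : pmat (frame p q (γ 0) (derivWithin γ (Icc 0 1) 0)) = U * Matrix.diagonal a * Uᵀ) :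
    spd p q (γ 1) = (coset p q (γ 0))ᵀ * (U * Matrix.diagonal (fun i => Real.exp (a i)) * Uᵀ) * coset p q (γ 0) := by
  set V := coset p q (γ 0)
  set Vi := cosetInv p q (γ 0)
  set W := mc p q (γ 0) (derivWithin γ (Icc 0 1) 0) with hW
  have hVV : V * Vi = 1 := coset_mul_inv hp q _
  have hVV' : Vi * V = 1 := cosetInv_mul hp q _
  have hW' : W = Vi * (U * Matrix.diagonal a * Uᵀ) * V := by rw [hW, mc_eq hp, hP]
  set D : ℝ → Matrix (Fin 7) (Fin 7) ℝ := fun t => Matrix.diagonal (fun i => Real.exp (-(t * a i)))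
  have hD : ∀ t, HasDerivWithinAt D (-(Matrix.diagonal a * D t)) (Icc 0 1) t := by
    intro t
    rw [Matrix.diagonal_mul_diagonal]
    refine hasDerivWithinAt_matrix_iff.2 fun i j => ?_
    by_cases hij : i = j
    · subst hij
      simp only [D, Matrix.diagonal_apply_eq, Matrix.neg_apply]
      refine ((((hasDerivAt_id t).mul_const (a i)).fun_neg).exp.congr_deriv ?_).hasDerivWithinAt
      simp; ring
    · simp only [D, Matrix.diagonal_apply_ne _ hij, Matrix.neg_apply, neg_zero]
      exact hasDerivWithinAt_const _ _ _
  -- Z t is exp(−tW), written in the diagonalizing basis; the product of M with Z is constant in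
  -- time.
  set Z : ℝ → Matrix (Fin 7) (Fin 7) ℝ := fun t => Vi * (U * D t * Uᵀ) * V with hZ
  have hZd : ∀ t, HasDerivWithinAt Z (-(W * Z t)) (Icc 0 1) t := by
    intro t
    refine (((((hD t).const_mul U).mul_const Uᵀ).const_mul Vi).mul_const V).congr_deriv ?_
    rw [hW', hZ]
    simp only [Matrix.mul_assoc, Matrix.mul_neg, Matrix.neg_mul]
    rw [← Matrix.mul_assoc V Vi, hVV, Matrix.one_mul, ← Matrix.mul_assoc Uᵀ U, hU, Matrix.one_mul]
  have hconst : spd p q (γ 1) * Z 1 = spd p q (γ 0) * Z 0 := by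
    have hd : ∀ t ∈ Icc (0:ℝ) 1, HasDerivWithinAt (fun r => spd p q (γ r) * Z r) 0 (Icc 0 1) t := by
      intro t ht
      refine ((h.hasDerivWithinAt_spd hp ht).fun_mul (hZd t)).congr_deriv ?_
      rw [← hW, Matrix.mul_neg, Matrix.mul_assoc, add_neg_cancel]
    refine (convex_Icc (0:ℝ) 1).is_const_of_fderivWithin_eq_zero (𝕜 := ℝ) 
      (f := fun r => spd p q (γ r) * Z r) (fun r hr => (hd r hr).differentiableWithinAt) ?_ (by simp) (by simp)
    intro r hr
    ext1
    change derivWithin _ _ _ = _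
    rw [(hd r hr).derivWithin (uniqueDiffOn_Icc zero_lt_one r hr)]
    simp
  have hZ0 : Z 0 = 1 := by
    have : D 0 = 1 := by simp [D]
    rw [hZ]
    simp only [this, Matrix.mul_one, hU', hVV']
  have hZ1 : Z 1 * (Vi * (U * Matrix.diagonal (fun i => Real.exp (a i)) * Uᵀ) * V) = 1 := by
    have e : D 1 * Matrix.diagonal (fun i => Real.exp (a i)) = 1 := by
      simp only [D, Matrix.diagonal_mul_diagonal, one_mul, ← Real.exp_add, neg_add_cancel, Real.exp_zero, Matrix.diagonal_one]
    simp only [hZ, Matrix.mul_assoc]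
    rw [← Matrix.mul_assoc V Vi, hVV, Matrix.one_mul, ← Matrix.mul_assoc Uᵀ U, hU, Matrix.one_mul, ← Matrix.mul_assoc (D 1), e,
      Matrix.one_mul, ← Matrix.mul_assoc U, hU', Matrix.one_mul, hVV']
  calc spd p q (γ 1) = spd p q (γ 1) * Z 1 * (Vi * (U * Matrix.diagonal (fun i => Real.exp (a i)) * Uᵀ) * V) := by
        rw [Matrix.mul_assoc, hZ1, Matrix.mul_one]
    _ = Vᵀ * (V * Vi) * (U * Matrix.diagonal (fun i => Real.exp (a i)) * Uᵀ) * V := by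
        rw [hconst, hZ0, Matrix.mul_one, spd]; simp only [Matrix.mul_assoc]; rfl
    _ = _ := by rw [hVV, Matrix.mul_one]

theorem continuousOn_mc_curve (hp : p ≠ 0) (q : ℤ) {c c' : ℝ → Target} {s : Set ℝ} (hc : ContinuousOn c s) (hc' : ContinuousOn c' s) :
    ContinuousOn (fun t => fderiv ℝ (spd p q) (c t) (c' t)) s :=
  (((contDiff_spd hp q).continuous_fderiv (by simp)).comp_continuousOn hc).clm_apply hc'

/-- Translating by V⁻¹ moves γ 0 to the identity and γ 1 to exp P, whose logarithm P has norm twice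
the speed of γ. The factor ½ on both sides comes from the ¼ in `metric_eq_mc`. -/
theorem length_ge (hp : p ≠ 0) {γ : ℝ → Target} (h : IsGeodesic p q γ) {c : ℝ → Target}
    (hc : ContDiffOn ℝ 1 c (Icc 0 1)) (h0 : c 0 = γ 1) (h1 : c 1 = γ 0) :
    √(metric p q (γ 0) (derivWithin γ (Icc 0 1) 0) (derivWithin γ (Icc 0 1) 0)) ≤ curveLength p q c := by
  obtain ⟨U, a, hU, hU', hP⟩ := exists_orthogonal_diagonalization (isSymm_pmat (frame p q (γ 0) (derivWithin γ (Icc 0 1) 0)))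
  set V := coset p q (γ 0) with hVdef
  set Vi := cosetInv p q (γ 0) with hVidef
  have hVV : V * Vi = 1 := coset_mul_inv hp q _
  have hVV' : Vi * V = 1 := cosetInv_mul hp q _
  have hVt : Vᵀ * Viᵀ = 1 := coset_transpose_mul_inv hp q _
  have hVt' : Viᵀ * Vᵀ = 1 := cosetInv_transpose_mul hp q _
  set c' := derivWithin c (Icc 0 1) with hc'
  have hcc : ContinuousOn c (Icc 0 1) := hc.continuousOn
  have hcd : ∀ t ∈ Icc (0:ℝ) 1, HasDerivWithinAt c (c' t) (Icc 0 1) t := fun t ht =>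
    (hc.differentiableOn (by simp) t ht).hasDerivWithinAt
  have hcc' : ContinuousOn c' (Icc 0 1) := hc.continuousOn_derivWithin (uniqueDiffOn_Icc zero_lt_one) le_rfl
  have key := norm_log_le_length (N := fun t => Viᵀ * spd p q (c t) * Vi)
    (N' := fun t => Viᵀ * fderiv ℝ (spd p q) (c t) (c' t) * Vi) (Ni := fun t => V * spdInv p q (c t) * Vᵀ) (U := U) (a := a)
    (fun t ht => ?_) ?_ ?_ (fun t => ?_) (fun t => ?_) (fun t => ?_) ?_ hU hU' ?_ ?_
  · have e1 : metric p q (γ 0) (derivWithin γ (Icc 0 1) 0) (derivWithin γ (Icc 0 1) 0) = (1 / 2) ^ 2 * ∑ i, a i ^ 2 := by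
      rw [metric_eq_trace, hP]
      have : (U * Matrix.diagonal a * Uᵀ * (U * Matrix.diagonal a * Uᵀ)).trace = ∑ i, a i ^ 2 := by
        calc _ = (U * (Matrix.diagonal a * (Uᵀ * U) * Matrix.diagonal a) * Uᵀ).trace := by simp only [Matrix.mul_assoc]
          _ = _ := by
            rw [hU, Matrix.mul_one, Matrix.trace_mul_comm, ← Matrix.mul_assoc, hU, Matrix.one_mul, Matrix.diagonal_mul_diagonal,
              Matrix.trace_diagonal]
            simp only [sq]
      rw [this]; norm_num
    have e2 : ∀ t, √(metric p q (c t) (c' t) (c' t)) = 1 / 2 * √(((V * spdInv p q (c t) * Vᵀ) * (Viᵀ * fderiv ℝ (spd p q) (c t) (c' t) * Vi) *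
        ((V * spdInv p q (c t) * Vᵀ) * (Viᵀ * fderiv ℝ (spd p q) (c t) (c' t) * Vi))).trace) := by
      intro t
      have e3 : (V * spdInv p q (c t) * Vᵀ) * (Viᵀ * fderiv ℝ (spd p q) (c t) (c' t) * Vi) = V * mc p q (c t) (c' t) * Vi := by
        calc _ = V * spdInv p q (c t) * (Vᵀ * Viᵀ) * fderiv ℝ (spd p q) (c t) (c' t) * Vi := by simp only [Matrix.mul_assoc]
          _ = _ := by rw [hVt, Matrix.mul_one, Matrix.mul_assoc V]; rfl
      have e4 : (V * mc p q (c t) (c' t) * Vi * (V * mc p q (c t) (c' t) * Vi)).trace = (mc p q (c t) (c' t) * mc p q (c t) (c' t)).trace := by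
        calc _ = (V * (mc p q (c t) (c' t) * (Vi * V) * mc p q (c t) (c' t) * Vi)).trace := by simp only [Matrix.mul_assoc]
          _ = _ := by rw [hVV', Matrix.mul_one, Matrix.trace_mul_comm, Matrix.mul_assoc, hVV', Matrix.mul_one]
      rw [e3, e4, metric_eq_mc hp, show (1:ℝ) / 4 = (1 / 2) ^ 2 by norm_num, Real.sqrt_mul (by norm_num), Real.sqrt_sq (by norm_num)]
    rw [e1, Real.sqrt_mul (by norm_num), Real.sqrt_sq (by norm_num), curveLength]
    simp only [← hc', e2]
    rw [intervalIntegral.integral_const_mul]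
    exact mul_le_mul_of_nonneg_left key (by norm_num)
  · have := ((contDiff_spd hp q).differentiable (by simp) (c t)).hasFDerivAt.comp_hasDerivWithinAt t (hcd t ht)
    exact (this.const_mul Viᵀ).mul_const Vi
  · exact (continuousOn_const.mul (continuousOn_mc_curve hp q hcc hcc')).mul continuousOn_const
  · exact (continuousOn_const.mul ((contDiff_spdInv hp q).continuous.comp_continuousOn hcc)).mul continuousOn_const
  · calc _ = V * (spdInv p q (c t) * (Vᵀ * Viᵀ) * spd p q (c t)) * Vi := by simp only [Matrix.mul_assoc]
      _ = _ := by rw [hVt, Matrix.mul_one, spdInv_mul hp, Matrix.mul_one, hVV]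
  · simp only [Matrix.IsSymm, spd, Matrix.transpose_mul, Matrix.transpose_transpose, Matrix.mul_assoc]
  · rw [Matrix.IsSymm, fderiv_spd hp]
    simp only [Matrix.transpose_mul, Matrix.transpose_transpose, Matrix.mul_assoc, (isSymm_pmat _).eq]
  · intro t O b hO hN i
    set T := coset p q (c t) * Vi * O with hT
    -- Each eigenvalue is the squared norm of a column of an invertible matrix, hence positive.
    have hT' : Matrix.diagonal b = Tᵀ * T := by
      calc Matrix.diagonal b = (Oᵀ * O) * Matrix.diagonal b * (Oᵀ * O) := by rw [hO, Matrix.one_mul, Matrix.mul_one]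
        _ = Oᵀ * (O * Matrix.diagonal b * Oᵀ) * O := by simp only [Matrix.mul_assoc]
        _ = _ := by
          rw [← hN, hT, spd]
          simp only [Matrix.transpose_mul, Matrix.mul_assoc]
    have hTu : (Oᵀ * V * cosetInv p q (c t)) * T = 1 := by
      calc _ = Oᵀ * (V * (cosetInv p q (c t) * coset p q (c t)) * Vi) * O := by rw [hT]; simp only [Matrix.mul_assoc]
        _ = _ := by rw [cosetInv_mul hp, Matrix.mul_one, hVV, Matrix.mul_one, hO]
    have e : b i = ∑ j, T j i ^ 2 := by
      have := congrFun (congrFun hT' i) i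
      simpa [Matrix.mul_apply, sq] using this
    rw [e]
    refine lt_of_le_of_ne (Finset.sum_nonneg fun j _ => sq_nonneg _) fun h0 => ?_
    have hz := (Finset.sum_eq_zero_iff_of_nonneg fun j _ => sq_nonneg (T j i)).1 h0.symm
    have := congrFun (congrFun hTu i) i
    rw [Matrix.mul_apply, Matrix.one_apply_eq] at this
    have hz' : ∀ j, T j i = 0 := fun j => by simpa using hz j (Finset.mem_univ j)
    simp [hz'] at this
  · simp only [h0, h.spd_one hp hU hU' hP]
    calc _ = (Viᵀ * Vᵀ) * (U * Matrix.diagonal (fun i => Real.exp (a i)) * Uᵀ) * (V * Vi) := by simp only [Matrix.mul_assoc]; rfl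
      _ = _ := by rw [hVt', hVV, Matrix.mul_one, Matrix.one_mul]
  · simp only [h1, spd]
    calc _ = (Viᵀ * Vᵀ) * (V * Vi) := by simp only [Matrix.mul_assoc]; rfl
      _ = _ := by rw [hVt', hVV, Matrix.mul_one]

theorem metric_neg (p q : ℤ) (x a : Target) : metric p q x (-a) (-a) = metric p q x a a := by
  have : frame p q x (-a) = -frame p q x a := by simpa using frame_smul p q x a (-1)
  rw [metric_eq_frame, metric_eq_frame, this]
  simp

theorem IsGeodesic.speed_const (hp : p ≠ 0) {γ : ℝ → Target} (h : IsGeodesic p q γ) {t : ℝ} (ht : t ∈ Icc (0:ℝ) 1) :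
    metric p q (γ t) (derivWithin γ (Icc 0 1) t) (derivWithin γ (Icc 0 1) t) =
      metric p q (γ 0) (derivWithin γ (Icc 0 1) 0) (derivWithin γ (Icc 0 1) 0) := by
  rw [metric_eq_mc hp, metric_eq_mc hp, h.mc_const hp ht]

/-- Geodesics of the target minimize length. -/
theorem IsGeodesic.targetDist_eq (hp : p ≠ 0) {γ : ℝ → Target} (h : IsGeodesic p q γ) :
    targetDist p q (γ 1) (γ 0) = √(metric p q (γ 0) (derivWithin γ (Icc 0 1) 0) (derivWithin γ (Icc 0 1) 0)) := by
  -- The distance is taken from γ 1 to γ 0, so the competitor attaining the infimum is the reversed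
  -- geodesic.
  have hrev : ContDiffOn ℝ 1 (fun t => γ (1 - t)) (Icc 0 1) :=
    (h.1.of_le (by norm_num)).comp (by fun_prop) fun t ht => by simpa [and_comm] using ht
  have hmem : √(metric p q (γ 0) (derivWithin γ (Icc 0 1) 0) (derivWithin γ (Icc 0 1) 0)) ∈ {ℓ : ℝ | ∃ c : ℝ → Target,
    ContDiffOn ℝ 1 c (Icc 0 1) ∧ c 0 = γ 1 ∧ c 1 = γ 0 ∧ ℓ = curveLength p q c} := by
    refine ⟨_, hrev, by simp, by simp, ?_⟩
    have : ∀ t ∈ uIcc (0:ℝ) 1, √(metric p q (γ (1 - t)) (derivWithin (fun t => γ (1 - t)) (Icc 0 1) t) (derivWithin (fun t => γ (1 - t)) (Icc 0 1) t)) =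
        √(metric p q (γ 0) (derivWithin γ (Icc 0 1) 0) (derivWithin γ (Icc 0 1) 0)) := by
      intro t ht
      rw [uIcc_of_le zero_le_one] at ht
      have ht' : 1 - t ∈ Icc (0:ℝ) 1 := ⟨by linarith [ht.2], by linarith [ht.1]⟩
      have hd : HasDerivWithinAt (fun t => γ (1 - t)) (-derivWithin γ (Icc 0 1) (1 - t)) (Icc 0 1) t := by
        have := (h.hasDerivWithinAt ht').scomp t (((hasDerivAt_id t).const_sub 1).hasDerivWithinAt (s := Icc 0 1))
          (fun r hr => by simpa [and_comm] using hr)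
        exact this.congr_deriv (by simp)
      rw [hd.derivWithin (uniqueDiffOn_Icc zero_lt_one t ht), metric_neg, h.speed_const hp ht']
    rw [curveLength, intervalIntegral.integral_congr this]
    simp
  refine le_antisymm (csInf_le ⟨0, ?_⟩ hmem) (le_csInf ⟨_, hmem⟩ ?_)
  · rintro _ ⟨c, -, -, -, rfl⟩
    exact intervalIntegral.integral_nonneg zero_le_one fun t _ => Real.sqrt_nonneg _
  · rintro _ ⟨c, hc, h0, h1, rfl⟩
    exact length_ge hp h hc h0 h1

theorem spd_zero_zero (p q : ℤ) (x : Target) : spd p q x 0 0 = (p : ℝ) ^ 2 * Real.exp (-4 * x 0) := by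
  have e4 : Real.exp (-4 * x 0) = Real.exp (-2 * x 0) * Real.exp (-2 * x 0) := by rw [← Real.exp_add]; ring_nf
  have h : ∀ i, coset p q x i 0 = if i = 0 then (p : ℝ) * Real.exp (-2 * x 0) else 0 := by
    intro i
    rw [coset]
    fin_cases i <;> simp [glg, unipF, unipE, unipY, Matrix.mul_apply, Fin.sum_univ_seven, gl_det]
  rw [spd, Matrix.mul_apply]
  simp only [Matrix.transpose_apply, h, Fin.sum_univ_seven, e4]
  simp
  ring

theorem IsGeodesic.convexOn_exp (hp : p ≠ 0) {γ : ℝ → Target} (h : IsGeodesic p q γ) :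
    ConvexOn ℝ (Icc 0 1) (fun t => Real.exp (-4 * γ t 0)) := by
  have hp' : (0:ℝ) < (p : ℝ) ^ 2 := by have : (p : ℝ) ≠ 0 := by exact_mod_cast hp
                                       positivity
  set W := mc p q (γ 0) (derivWithin γ (Icc 0 1) 0) with hW
  have hd1 : ∀ t ∈ Icc (0:ℝ) 1, HasDerivWithinAt (fun r => spd p q (γ r) 0 0) ((spd p q (γ t) * W) 0 0) (Icc 0 1) t :=
    fun t ht => (h.hasDerivWithinAt_spd hp ht).matrix_apply 0 0
  have hd2 : ∀ t ∈ Icc (0:ℝ) 1, HasDerivWithinAt (fun r => (spd p q (γ r) * W) 0 0) ((spd p q (γ t) * W * W) 0 0) (Icc 0 1) t :=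
    fun t ht => ((h.hasDerivWithinAt_spd hp ht).mul_const W).matrix_apply 0 0
  have hconv : ConvexOn ℝ (Icc 0 1) (fun r => spd p q (γ r) 0 0) := by
    refine convexOn_of_hasDerivWithinAt2_nonneg (convex_Icc 0 1) (fun t ht => (hd1 t ht).continuousWithinAt)
      (fun t ht => (hd1 t (interior_subset ht)).mono interior_subset) (fun t ht => (hd2 t (interior_subset ht)).mono interior_subset) ?_
    intro t ht
    have ht' := interior_subset ht
    set V := coset p q (γ t)
    -- MW = M' is symmetric, so MW² = WᵀMW is a Gram matrix.
    have e : spd p q (γ t) * W * W = (V * W)ᵀ * (V * W) := by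
      have hsym : spd p q (γ t) * W = Wᵀ * spd p q (γ t) := by
        have e1 : spd p q (γ t) * W = fderiv ℝ (spd p q) (γ t) (derivWithin γ (Icc 0 1) t) := by
          rw [fderiv_spd_eq_mul_mc hp, h.mc_const hp ht']
        have e2 : (spd p q (γ t) * W)ᵀ = spd p q (γ t) * W := by
          rw [e1, fderiv_spd hp]
          simp only [Matrix.transpose_mul, Matrix.transpose_transpose, Matrix.mul_assoc, (isSymm_pmat _).eq]
        rw [← e2, Matrix.transpose_mul, spd, Matrix.transpose_mul, Matrix.transpose_transpose]
      rw [hsym, spd, Matrix.transpose_mul]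
      simp only [Matrix.mul_assoc]; rfl
    rw [e, Matrix.mul_apply]
    exact Finset.sum_nonneg fun j _ => mul_self_nonneg _
  have : (fun t => Real.exp (-4 * γ t 0)) = fun t => ((p : ℝ) ^ 2)⁻¹ * spd p q (γ t) 0 0 := by
    ext t; rw [spd_zero_zero, inv_mul_cancel_left₀ hp'.ne']
  rw [this]
  exact hconv.smul (inv_nonneg.2 hp'.le)

end

/-! ### Families of geodesics -/

section

variable {p q : ℤ}

/-! ### Nonpositive curvature of positive definite matrices. -/

section
variable {n : Type*} [Fintype n]

theorem trace_mul_self_nonneg_of_isSymm {A : Matrix n n ℝ} (hA : A.IsSymm) : 0 ≤ (A * A).trace := by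
  nth_rw 1 [← hA.eq]
  simp only [Matrix.trace, Matrix.diag_apply, Matrix.mul_apply, Matrix.transpose_apply]
  exact Finset.sum_nonneg fun i _ => Finset.sum_nonneg fun j _ => mul_self_nonneg _

theorem trace_mul_sq_le_of_isSymm {A B : Matrix n n ℝ} (hA : A.IsSymm) (hB : B.IsSymm) :
    (A * B).trace ^ 2 ≤ (A * A).trace * (B * B).trace := by
  have e : ∀ X Y : Matrix n n ℝ, X.IsSymm → (X * Y).trace = ∑ z : n × n, X z.1 z.2 * Y z.1 z.2 := by
    intro X Y hX
    conv_lhs => rw [← hX.eq]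
    simp only [Matrix.trace, Matrix.diag_apply, Matrix.mul_apply, Matrix.transpose_apply, Fintype.sum_prod_type]
    exact Finset.sum_comm
  rw [e A B hA, e A A hA, e B B hB]
  have := Finset.sum_mul_sq_le_sq_mul_sq Finset.univ (fun z : n × n => A z.1 z.2) (fun z => B z.1 z.2)
  simpa only [sq] using this

/-- Nonpositive curvature of the space of positive definite matrices, at the identity. -/
theorem jacobi_inequality {k w x : Matrix n n ℝ} (hk : k.IsSymm) (hw : w.IsSymm) (hx : (x + k * w).IsSymm) :
    0 ≤ ((x + k * w - w * k) * x).trace ∧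
      (w * x).trace ^ 2 ≤ (w * w).trace * ((x + k * w - w * k) * x).trace := by
  set c := k * w - w * k with hc
  -- D is the symmetrized, covariant derivative of w in the direction k. The trace in question is tr
  -- D² − ¼ tr c², the second term being the curvature contribution, nonnegative since c is
  -- antisymmetric. As tr(wc) = 0, Cauchy-Schwarz applies to w and D.
  set D := x + (1 / 2 : ℝ) • c with hD
  have hDs : D.IsSymm := by
    have : D = (x + k * w) - (1 / 2 : ℝ) • (k * w + w * k) := by rw [hD, hc]; module
    rw [this]
    refine hx.sub (Matrix.IsSymm.smul ?_ _)
    rw [Matrix.IsSymm, Matrix.transpose_add, Matrix.transpose_mul, Matrix.transpose_mul, hk.eq, hw.eq, add_comm]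
  have hct : cᵀ = -c := by
    rw [hc, Matrix.transpose_sub, Matrix.transpose_mul, Matrix.transpose_mul, hk.eq, hw.eq, neg_sub]
  have hcc : (c * c).trace ≤ 0 := by
    have h1 : (c * c).trace = -(cᵀ * c).trace := by rw [hct, Matrix.neg_mul, Matrix.trace_neg, neg_neg]
    have h2 : 0 ≤ (cᵀ * c).trace := by
      simp only [Matrix.trace, Matrix.diag_apply, Matrix.mul_apply, Matrix.transpose_apply]
      exact Finset.sum_nonneg fun i _ => Finset.sum_nonneg fun j _ => mul_self_nonneg _
    linarith
  have hxD : x = D - (1 / 2 : ℝ) • c := by rw [hD]; module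
  have h1 : ((x + k * w - w * k) * x).trace = (D * D).trace - 1 / 4 * (c * c).trace := by
    have : x + k * w - w * k = D + (1 / 2 : ℝ) • c := by rw [hD, add_sub_assoc, ← hc]; module
    rw [this, hxD]
    simp only [Matrix.add_mul, Matrix.mul_sub, Matrix.smul_mul, Matrix.mul_smul, Matrix.trace_add, Matrix.trace_sub,
      Matrix.trace_smul, smul_eq_mul]
    rw [Matrix.trace_mul_comm c D]
    ring
  have h2 : (w * x).trace = (w * D).trace := by
    have : (w * c).trace = 0 := by
      rw [hc, Matrix.mul_sub, Matrix.trace_sub, ← Matrix.mul_assoc, Matrix.trace_mul_comm (w * k), sub_self]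
    rw [hxD, Matrix.mul_sub, Matrix.trace_sub, Matrix.mul_smul, Matrix.trace_smul, this]
    simp
  rw [h1, h2]
  have h3 := trace_mul_sq_le_of_isSymm hw hDs
  have h4 := trace_mul_self_nonneg_of_isSymm hw
  have h5 := trace_mul_self_nonneg_of_isSymm hDs
  refine ⟨by linarith, ?_⟩
  nlinarith [mul_nonneg h4 (neg_nonneg.2 hcc)]
end

theorem jacobi_inequality_spd (hp : p ≠ 0) {x a b : Target} {X : Matrix (Fin 7) (Fin 7) ℝ}
    (hX : (spd p q x * (X + mc p q x a * mc p q x b)).IsSymm) :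
    0 ≤ ((X + mc p q x a * mc p q x b - mc p q x b * mc p q x a) * X).trace ∧
    (mc p q x b * X).trace ^ 2 ≤ (mc p q x b * mc p q x b).trace *
      ((X + mc p q x a * mc p q x b - mc p q x b * mc p q x a) * X).trace := by
  set V := coset p q x with hVdef
  set Vi := cosetInv p q x with hVidef
  have hVV : V * Vi = 1 := coset_mul_inv hp q _
  have hVV' : Vi * V = 1 := cosetInv_mul hp q _
  have hVt' : Viᵀ * Vᵀ = 1 := cosetInv_transpose_mul hp q _
  have e : ∀ Y Z : Matrix (Fin 7) (Fin 7) ℝ, (V * Y * Vi) * (V * Z * Vi) = V * (Y * Z) * Vi := fun Y Z => by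
    calc _ = V * Y * (Vi * V) * Z * Vi := by simp only [Matrix.mul_assoc]
      _ = _ := by rw [hVV', Matrix.mul_one]; simp only [Matrix.mul_assoc]
  have et : ∀ Y : Matrix (Fin 7) (Fin 7) ℝ, (V * Y * Vi).trace = Y.trace := fun Y => by
    rw [Matrix.trace_mul_comm, ← Matrix.mul_assoc, hVV', Matrix.one_mul]
  have hm : ∀ c, V * mc p q x c * Vi = pmat (frame p q x c) := fun c => by
    rw [mc_eq hp]
    calc _ = (V * Vi) * pmat (frame p q x c) * (V * Vi) := by simp only [Matrix.mul_assoc]; rfl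
      _ = _ := by rw [hVV, Matrix.mul_one, Matrix.one_mul]
  have hx : (V * X * Vi + (V * mc p q x a * Vi) * (V * mc p q x b * Vi)).IsSymm := by
    rw [e, ← Matrix.add_mul, ← Matrix.mul_add]
    have : V * (X + mc p q x a * mc p q x b) * Vi = Viᵀ * (spd p q x * (X + mc p q x a * mc p q x b)) * Vi := by
      rw [spd]
      calc _ = (Viᵀ * Vᵀ) * V * (X + mc p q x a * mc p q x b) * Vi := by rw [hVt', Matrix.one_mul]
        _ = _ := by simp only [Matrix.mul_assoc]; rfl
    rw [this, Matrix.IsSymm, Matrix.transpose_mul, Matrix.transpose_mul, Matrix.transpose_transpose, hX.eq]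
    simp only [Matrix.mul_assoc]
  have := jacobi_inequality (k := V * mc p q x a * Vi) (w := V * mc p q x b * Vi) (x := V * X * Vi)
    (by rw [hm]; exact isSymm_pmat _) (by rw [hm]; exact isSymm_pmat _) hx
  simpa only [e, ← Matrix.add_mul, ← Matrix.mul_add, ← Matrix.sub_mul, ← Matrix.mul_sub, et] using this

theorem isSymm_fderiv_spd (hp : p ≠ 0) (q : ℤ) (x a : Target) : (fderiv ℝ (spd p q) x a).IsSymm := by
  rw [Matrix.IsSymm, fderiv_spd hp]
  simp only [Matrix.transpose_mul, Matrix.transpose_transpose, Matrix.mul_assoc, (isSymm_pmat _).eq]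

/-- The squared speed, at time `1/2`, of the curves `t ↦ f (t, θ)`. -/
def speedSq (p q : ℤ) (f : ℝ × ℝ → Target) (θ : ℝ) : ℝ :=
  metric p q (f (1 / 2, θ)) (fderiv ℝ f (1 / 2, θ) (1, 0)) (fderiv ℝ f (1 / 2, θ) (1, 0))

/-! ### Smooth one-parameter families of geodesics. -/

section
variable {f : ℝ × ℝ → Target} {I : Set ℝ}

theorem half_mem : (1 / 2 : ℝ) ∈ Ioo (0:ℝ) 1 := by constructor <;> norm_num

theorem contDiffAt_of_family (hI : IsOpen I) (hf : ContDiffOn ℝ ∞ f (Icc 0 1 ×ˢ I)) {t θ : ℝ} (ht : t ∈ Ioo (0:ℝ) 1) (hθ : θ ∈ I) :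
    ContDiffAt ℝ ∞ f (t, θ) :=
  hf.contDiffAt (prod_mem_nhds (Icc_mem_nhds ht.1 ht.2) (hI.mem_nhds hθ))

theorem hasDerivAt_time (hI : IsOpen I) (hf : ContDiffOn ℝ ∞ f (Icc 0 1 ×ˢ I)) {t θ : ℝ} (ht : t ∈ Ioo (0:ℝ) 1) (hθ : θ ∈ I) :
    HasDerivAt (fun r => f (r, θ)) (fderiv ℝ f (t, θ) (1, 0)) t :=
  (((contDiffAt_of_family hI hf ht hθ).differentiableAt (by simp)).hasFDerivAt).comp_hasDerivAt t
    ((hasDerivAt_id t).prodMk (hasDerivAt_const t θ))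

theorem hasDerivAt_space (hI : IsOpen I) (hf : ContDiffOn ℝ ∞ f (Icc 0 1 ×ˢ I)) {t θ : ℝ} (ht : t ∈ Ioo (0:ℝ) 1) (hθ : θ ∈ I) :
    HasDerivAt (fun r => f (t, r)) (fderiv ℝ f (t, θ) (0, 1)) θ :=
  (((contDiffAt_of_family hI hf ht hθ).differentiableAt (by simp)).hasFDerivAt).comp_hasDerivAt θ
    ((hasDerivAt_const θ t).prodMk (hasDerivAt_id θ))

theorem mc_time_const (hp : p ≠ 0) (hI : IsOpen I) (hf : ContDiffOn ℝ ∞ f (Icc 0 1 ×ˢ I))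
    (hgeo : ∀ θ ∈ I, IsGeodesic p q (fun t => f (t, θ))) {t θ : ℝ} (ht : t ∈ Ioo (0:ℝ) 1) (hθ : θ ∈ I) :
    mc p q (f (t, θ)) (fderiv ℝ f (t, θ) (1, 0)) = mc p q (f (1 / 2, θ)) (fderiv ℝ f (1 / 2, θ) (1, 0)) := by
  have h : ∀ r ∈ Ioo (0:ℝ) 1, derivWithin (fun t => f (t, θ)) (Icc 0 1) r = fderiv ℝ f (r, θ) (1, 0) := fun r hr => by
    rw [derivWithin_of_mem_nhds (Icc_mem_nhds hr.1 hr.2), (hasDerivAt_time hI hf hr hθ).deriv]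
  have h1 := (hgeo θ hθ).mc_const hp (Ioo_subset_Icc_self ht)
  have h2 := (hgeo θ hθ).mc_const hp (Ioo_subset_Icc_self half_mem)
  rw [h t ht] at h1
  rw [h _ half_mem] at h2
  rw [h1, h2]

theorem targetDist_family (hp : p ≠ 0) (hI : IsOpen I) (hf : ContDiffOn ℝ ∞ f (Icc 0 1 ×ˢ I))
    (hgeo : ∀ θ ∈ I, IsGeodesic p q (fun t => f (t, θ))) {θ : ℝ} (hθ : θ ∈ I) :
    targetDist p q (f (1, θ)) (f (0, θ)) = √(speedSq p q f θ) := by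
  have h := (hgeo θ hθ).targetDist_eq hp
  -- Speed is constant, so it may be read at t = ½, where the family is differentiable in a full
  -- neighbourhood.
  have h2 := (hgeo θ hθ).speed_const hp (Ioo_subset_Icc_self half_mem)
  rw [derivWithin_of_mem_nhds (Icc_mem_nhds half_mem.1 half_mem.2), (hasDerivAt_time hI hf half_mem hθ).deriv] at h2
  rw [h, speedSq, h2]

theorem speedSq_nonneg (p q : ℤ) (f : ℝ × ℝ → Target) (θ : ℝ) : 0 ≤ speedSq p q f θ := metric_self_nonneg _ _ _ _

/-- At a zero of g the root has a minimum, so its derivative is 0, also by default if it is not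
differentiable there. The quotient is 0 by the convention for division by zero. -/
theorem deriv_sqrt_of_differentiableAt {g : ℝ → ℝ} {x : ℝ} (hd : DifferentiableAt ℝ g x) :
    deriv (fun y => √(g y)) x = deriv g x / (2 * √(g x)) := by
  by_cases h : g x = 0
  · rw [h, Real.sqrt_zero, mul_zero, div_zero]
    refine IsLocalMin.deriv_eq_zero (Eventually.of_forall fun y => ?_)
    simp only [h, Real.sqrt_zero]
    exact Real.sqrt_nonneg _
  · exact (hd.hasDerivAt.sqrt h).deriv

theorem hasDerivAt_mc_half (hp : p ≠ 0) (hI : IsOpen I) (hf : ContDiffOn ℝ ∞ f (Icc 0 1 ×ˢ I)) {θ : ℝ} (hθ : θ ∈ I) :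
    DifferentiableAt ℝ (fun r => mc p q (f (1 / 2, r)) (fderiv ℝ f (1 / 2, r) (1, 0))) θ := by
  have h1 := contDiffAt_of_family hI hf half_mem hθ
  have h2 : DifferentiableAt ℝ (fun r => fderiv ℝ f (1 / 2, r)) θ :=
    ((h1.fderiv_right (m := 1) (by norm_cast)).differentiableAt (by simp)).comp θ
      ((differentiableAt_const _).prodMk differentiableAt_id)
  have h3 := (hasDerivAt_space hI hf half_mem hθ).differentiableAt
  have h4 : DifferentiableAt ℝ (fun r => spdInv p q (f (1 / 2, r))) θ :=
    ((contDiff_spdInv hp q).differentiable (by simp) _).comp θ h3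
  have h5 : DifferentiableAt ℝ (fun r => fderiv ℝ (spd p q) (f (1 / 2, r))) θ :=
    (differentiable_fderiv_spd hp q _).comp θ h3
  exact h4.mul (h5.clm_apply (h2.clm_apply (differentiableAt_const _)))

theorem hasDerivAt_speedSq (hp : p ≠ 0) (hI : IsOpen I) (hf : ContDiffOn ℝ ∞ f (Icc 0 1 ×ˢ I)) {θ : ℝ} (hθ : θ ∈ I) :
    HasDerivAt (speedSq p q f) (1 / 2 * (mc p q (f (1 / 2, θ)) (fderiv ℝ f (1 / 2, θ) (1, 0)) *
      deriv (fun r => mc p q (f (1 / 2, r)) (fderiv ℝ f (1 / 2, r) (1, 0))) θ).trace) θ := by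
  have h := (hasDerivAt_mc_half hp hI hf hθ (q := q)).hasDerivAt.hasDerivWithinAt (s := univ)
  have h2 := (h.fun_mul h).matrix_trace.const_mul (1 / 4)
  rw [hasDerivWithinAt_univ] at h2
  have e : speedSq p q f = fun r => 1 / 4 * (mc p q (f (1 / 2, r)) (fderiv ℝ f (1 / 2, r) (1, 0)) *
      mc p q (f (1 / 2, r)) (fderiv ℝ f (1 / 2, r) (1, 0))).trace := by
    ext r; rw [speedSq, metric_eq_mc hp]
  rw [e]
  refine h2.congr_deriv ?_
  rw [Matrix.trace_add, Matrix.trace_mul_comm]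
  ring

theorem deriv_targetDist_family (hp : p ≠ 0) (hI : IsOpen I) (hf : ContDiffOn ℝ ∞ f (Icc 0 1 ×ˢ I))
    (hgeo : ∀ θ ∈ I, IsGeodesic p q (fun t => f (t, θ))) {θ : ℝ} (hθ : θ ∈ I) :
    deriv (fun r => targetDist p q (f (1, r)) (f (0, r))) θ = deriv (speedSq p q f) θ / (2 * √(speedSq p q f θ)) := by
  rw [← deriv_sqrt_of_differentiableAt (hasDerivAt_speedSq hp hI hf hθ).differentiableAt]
  refine Filter.EventuallyEq.deriv_eq ?_
  filter_upwards [hI.mem_nhds hθ] with r hr using targetDist_family hp hI hf hgeo hr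

/-- Both claims come from the symmetry of the mixed second derivatives of M. Since ∂ₜM = MW with W
independent of t, ∂_θ∂ₜM = M(X + KW), which is a symmetric matrix; differentiating K = M⁻¹∂_θM in t
then gives the Maurer-Cartan equation. -/
theorem hasDerivAt_mc_space (hp : p ≠ 0) (hI : IsOpen I) (hf : ContDiffOn ℝ ∞ f (Icc 0 1 ×ˢ I))
    (hgeo : ∀ θ ∈ I, IsGeodesic p q (fun t => f (t, θ))) {t θ : ℝ} (ht : t ∈ Ioo (0:ℝ) 1) (hθ : θ ∈ I) 
    {W X K : Matrix (Fin 7) (Fin 7) ℝ} (hW : W = mc p q (f (1 / 2, θ)) (fderiv ℝ f (1 / 2, θ) (1, 0)))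
    (hX : X = deriv (fun r => mc p q (f (1 / 2, r)) (fderiv ℝ f (1 / 2, r) (1, 0))) θ)
    (hK : K = mc p q (f (t, θ)) (fderiv ℝ f (t, θ) (0, 1))) :
    HasDerivAt (fun r => mc p q (f (r, θ)) (fderiv ℝ f (r, θ) (0, 1))) (X + K * W - W * K) t ∧
      (spd p q (f (t, θ)) * (X + K * W)).IsSymm := by
  set g : ℝ × ℝ → Matrix (Fin 7) (Fin 7) ℝ := fun z => spd p q (f z) with hg
  have hU : ∀ {r s : ℝ}, r ∈ Ioo (0:ℝ) 1 → s ∈ I → ContDiffAt ℝ ∞ g (r, s) := fun hr hs =>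
    (contDiff_spd hp q).contDiffAt.comp _ (contDiffAt_of_family hI hf hr hs)
  have hgf : ∀ {r s : ℝ}, r ∈ Ioo (0:ℝ) 1 → s ∈ I → ∀ v, fderiv ℝ g (r, s) v = fderiv ℝ (spd p q) (f (r, s)) (fderiv ℝ f (r, s) v) := by
    intro r s hr hs v
    have h1 := (contDiffAt_of_family hI hf hr hs).differentiableAt (by simp)
    have h2 := (contDiff_spd hp q).differentiable (by simp) (f (r, s))
    rw [hg, fderiv_fun_comp (r, s) h2 h1]
    rfl
  have hgt : ∀ {r s : ℝ}, r ∈ Ioo (0:ℝ) 1 → s ∈ I →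
      fderiv ℝ g (r, s) (1, 0) = g (r, s) * mc p q (f (1 / 2, s)) (fderiv ℝ f (1 / 2, s) (1, 0)) := by
    intro r s hr hs
    rw [hgf hr hs, fderiv_spd_eq_mul_mc hp, mc_time_const hp hI hf hgeo hr hs]
  have hd2 : HasFDerivAt (fderiv ℝ g) (fderiv ℝ (fderiv ℝ g) (t, θ)) (t, θ) :=
    (((hU ht hθ).fderiv_right (m := 1) (by norm_cast)).differentiableAt (by simp)).hasFDerivAt
  have hsym : fderiv ℝ (fderiv ℝ g) (t, θ) (1, 0) (0, 1) = fderiv ℝ (fderiv ℝ g) (t, θ) (0, 1) (1, 0) :=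
    ((hU ht hθ).isSymmSndFDerivAt (by simp; exact WithTop.coe_le_coe.2 le_top)) _ _
  have hs1 : HasDerivAt (fun r => fderiv ℝ g (r, θ) (0, 1)) (fderiv ℝ (fderiv ℝ g) (t, θ) (1, 0) (0, 1)) t := by
    have := hd2.comp_hasDerivAt t ((hasDerivAt_id t).prodMk (hasDerivAt_const t θ))
    simpa using this.clm_apply (hasDerivAt_const t ((0:ℝ), (1:ℝ)))
  have hs2 : HasDerivAt (fun s => fderiv ℝ g (t, s) (1, 0)) (fderiv ℝ (fderiv ℝ g) (t, θ) (0, 1) (1, 0)) θ := by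
    have := hd2.comp_hasDerivAt θ ((hasDerivAt_const θ t).prodMk (hasDerivAt_id θ))
    simpa using this.clm_apply (hasDerivAt_const θ ((1:ℝ), (0:ℝ)))
  have hgθ : HasDerivAt (fun s => g (t, s)) (fderiv ℝ g (t, θ) (0, 1)) θ :=
    (((hU ht hθ).differentiableAt (by simp)).hasFDerivAt).comp_hasDerivAt θ
      ((hasDerivAt_const θ t).prodMk (hasDerivAt_id θ))
  have hWd := (hasDerivAt_mc_half hp hI hf hθ (q := q)).hasDerivAt
  rw [← hX] at hWd
  have hs3 := hgθ.fun_mul hWd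
  have hs4 : HasDerivAt (fun s => fderiv ℝ g (t, s) (1, 0)) (fderiv ℝ g (t, θ) (0, 1) * W + g (t, θ) * X) θ := by
    rw [hW]
    refine hs3.congr_of_eventuallyEq ?_
    filter_upwards [hI.mem_nhds hθ] with s hs using hgt ht hs
  have hgK : fderiv ℝ g (t, θ) (0, 1) = g (t, θ) * K := by
    rw [hgf ht hθ, fderiv_spd_eq_mul_mc hp, hK]
  have hmixed : fderiv ℝ (fderiv ℝ g) (t, θ) (1, 0) (0, 1) = spd p q (f (t, θ)) * (X + K * W) := by
    rw [hsym, hs2.unique hs4, hgK, Matrix.mul_add, Matrix.mul_assoc, add_comm]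
  rw [hmixed] at hs1
  constructor
  · have hi : HasDerivAt (fun r => spdInv p q (f (r, θ))) (-(W * spdInv p q (f (t, θ)))) t := by
      have := ((contDiff_spdInv hp q).differentiable (by simp) (f (t, θ))).hasFDerivAt.comp_hasDerivAt t (hasDerivAt_time hI hf ht hθ)
      rw [fderiv_spdInv hp, mc_time_const hp hI hf hgeo ht hθ, ← hW] at this
      exact this
    have h := hi.fun_mul hs1
    have h' : HasDerivAt (fun r => mc p q (f (r, θ)) (fderiv ℝ f (r, θ) (0, 1)))
        (-(W * spdInv p q (f (t, θ))) * fderiv ℝ g (t, θ) (0, 1) + spdInv p q (f (t, θ)) * (spd p q (f (t, θ)) * (X + K * W))) t := by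
      refine h.congr_of_eventuallyEq ?_
      filter_upwards [Ioo_mem_nhds ht.1 ht.2] with r hr
      rw [hgf hr hθ]; rfl
    refine h'.congr_deriv ?_
    rw [hgK, ← Matrix.mul_assoc (spdInv p q _), spdInv_mul hp, Matrix.one_mul, Matrix.neg_mul, Matrix.mul_assoc W,
      ← Matrix.mul_assoc (spdInv p q _), spdInv_mul hp, Matrix.one_mul]
    abel
  · have h1 := hs1.hasDerivWithinAt (s := univ)
    have h2 := h1.matrix_transpose
    have h3 : HasDerivWithinAt (fun r => fderiv ℝ g (r, θ) (0, 1)) (spd p q (f (t, θ)) * (X + K * W))ᵀ univ t := by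
      rw [hasDerivWithinAt_univ] at h2 ⊢
      refine h2.congr_of_eventuallyEq ?_
      filter_upwards [Ioo_mem_nhds ht.1 ht.2] with r hr
      rw [hgf hr hθ, (isSymm_fderiv_spd hp q _ _).eq]
    exact uniqueDiffWithinAt_univ.eq_deriv _ h3 h1

/-- Convexity of the Dirichlet density along a family of geodesics. -/
theorem convexOn_density (hp : p ≠ 0) (hI : IsOpen I) (hf : ContDiffOn ℝ ∞ f (Icc 0 1 ×ˢ I))
    (hgeo : ∀ θ ∈ I, IsGeodesic p q (fun t => f (t, θ))) {θ : ℝ} (hθ : θ ∈ I) :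
    ConvexOn ℝ (Icc 0 1) (fun t => metric p q (f (t, θ)) (deriv (fun r => f (t, r)) θ) (deriv (fun r => f (t, r)) θ)
      - deriv (fun r => targetDist p q (f (1, r)) (f (0, r))) θ ^ 2 * t ^ 2) := by
  set d := deriv (fun r => targetDist p q (f (1, r)) (f (0, r))) θ with hd
  set W := mc p q (f (1 / 2, θ)) (fderiv ℝ f (1 / 2, θ) (1, 0)) with hW
  set X := deriv (fun r => mc p q (f (1 / 2, r)) (fderiv ℝ f (1 / 2, r) (1, 0))) θ with hX
  set K : ℝ → Matrix (Fin 7) (Fin 7) ℝ := fun t => mc p q (f (t, θ)) (fderiv ℝ f (t, θ) (0, 1)) with hK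
  have hd1 : ∀ t ∈ Ioo (0:ℝ) 1, HasDerivAt K (X + K t * W - W * K t) t := fun t ht =>
    (hasDerivAt_mc_space hp hI hf hgeo ht hθ hW hX rfl).1
  have hd2 : ∀ t ∈ Ioo (0:ℝ) 1, HasDerivAt (fun t => 1 / 4 * (K t * K t).trace) (1 / 2 * (K t * X).trace) t := by
    intro t ht
    have h1 := (hd1 t ht).hasDerivWithinAt (s := univ)
    have h2 := (h1.fun_mul h1).matrix_trace.const_mul (1 / 4)
    rw [hasDerivWithinAt_univ] at h2
    refine h2.congr_deriv ?_
    rw [Matrix.trace_add, Matrix.trace_mul_comm _ (K t)]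
    have : (K t * (X + K t * W - W * K t)).trace = (K t * X).trace := by
      rw [Matrix.mul_sub, Matrix.mul_add, Matrix.trace_sub, Matrix.trace_add, ← Matrix.mul_assoc (K t) W,
        Matrix.trace_mul_comm (K t * W) (K t)]
      ring
    rw [this]; ring
  have hd3 : ∀ t ∈ Ioo (0:ℝ) 1, HasDerivAt (fun t => 1 / 2 * (K t * X).trace) (1 / 2 * ((X + K t * W - W * K t) * X).trace) t := by
    intro t ht
    have h1 := (hd1 t ht).hasDerivWithinAt (s := univ)
    have h2 := (h1.mul_const X).matrix_trace.const_mul (1 / 2)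
    rwa [hasDerivWithinAt_univ] at h2
  have hmetric : ∀ t ∈ Ioo (0:ℝ) 1, metric p q (f (t, θ)) (deriv (fun r => f (t, r)) θ) (deriv (fun r => f (t, r)) θ)
      = 1 / 4 * (K t * K t).trace := by
    intro t ht
    rw [metric_eq_mc hp, (hasDerivAt_space hI hf ht hθ).deriv]
  refine convexOn_of_hasDerivWithinAt2_nonneg (convex_Icc 0 1) (f' := fun t => 1 / 2 * (K t * X).trace - d ^ 2 * (2 * t))
    (f'' := fun t => 1 / 2 * ((X + K t * W - W * K t) * X).trace - d ^ 2 * 2) ?_ ?_ ?_ ?_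
  -- Continuity up to t = 0 and t = 1 uses derivatives within the closed strip; the second
  -- derivative test then needs only interior times.
  · have hu : UniqueDiffOn ℝ (Icc (0:ℝ) 1 ×ˢ I) := (uniqueDiffOn_Icc zero_lt_one).prod hI.uniqueDiffOn
    have hc := hf.continuousOn_fderivWithin hu (by simp)
    have hmap : MapsTo (fun t : ℝ => (t, θ)) (Icc 0 1) (Icc (0:ℝ) 1 ×ˢ I) := fun t ht => ⟨ht, hθ⟩
    have hcf : ContinuousOn (fun t : ℝ => f (t, θ)) (Icc 0 1) := hf.continuousOn.comp (by fun_prop) hmap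
    have hcd : ContinuousOn (fun t : ℝ => fderivWithin ℝ f (Icc (0:ℝ) 1 ×ˢ I) (t, θ) (0, 1)) (Icc 0 1) :=
      (hc.comp (f := fun t : ℝ => (t, θ)) (by fun_prop) hmap).clm_apply continuousOn_const
    have e : ∀ t ∈ Icc (0:ℝ) 1, deriv (fun r => f (t, r)) θ = fderivWithin ℝ f (Icc (0:ℝ) 1 ×ˢ I) (t, θ) (0, 1) := by
      intro t ht
      have h1 := ((hf.differentiableOn (by simp)) (t, θ) ⟨ht, hθ⟩).hasFDerivWithinAt
      have h2 := h1.comp_hasDerivWithinAt (f := fun r : ℝ => (t, r)) (s := I) θ (((hasDerivAt_const θ t).prodMk (hasDerivAt_id θ)).hasDerivWithinAt) (fun r hr => ⟨ht, hr⟩)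
      exact (h2.hasDerivAt (hI.mem_nhds hθ)).deriv
    refine ContinuousOn.sub ?_ (by fun_prop)
    have hmc : ContinuousOn (fun t => mc p q (f (t, θ)) (fderivWithin ℝ f (Icc (0:ℝ) 1 ×ˢ I) (t, θ) (0, 1))) (Icc 0 1) :=
      ((contDiff_spdInv hp q).continuous.comp_continuousOn hcf).mul (continuousOn_mc_curve hp q hcf hcd)
    refine ((continuous_matrix_trace.comp_continuousOn (hmc.mul hmc)).const_mul (1 / 4)).congr fun t ht => ?_
    simp only [metric_eq_mc hp, e t ht]
    rfl
  · rw [interior_Icc]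
    intro t ht
    refine (HasDerivAt.congr_of_eventuallyEq ((hd2 t ht).sub (((hasDerivAt_id t).fun_pow 2).const_mul (d ^ 2))) ?_).hasDerivWithinAt.congr_deriv ?_
    · filter_upwards [Ioo_mem_nhds ht.1 ht.2] with r hr
      rw [hmetric r hr]; simp
    · simp
  · rw [interior_Icc]
    intro t ht
    refine ((hd3 t ht).fun_sub (((hasDerivAt_id t).const_mul 2).const_mul (d ^ 2))).hasDerivWithinAt.congr_deriv ?_
    simp
  · rw [interior_Icc]
    intro t ht
    have hs := (hasDerivAt_mc_space hp hI hf hgeo ht hθ hW hX rfl).2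
    have hWt : W = mc p q (f (t, θ)) (fderiv ℝ f (t, θ) (1, 0)) := (mc_time_const hp hI hf hgeo ht hθ).symm
    obtain ⟨hj0, hj⟩ : 0 ≤ ((X + K t * W - W * K t) * X).trace ∧
        (W * X).trace ^ 2 ≤ (W * W).trace * ((X + K t * W - W * K t) * X).trace := by
      rw [hWt] at hs ⊢
      exact jacobi_inequality_spd hp hs
    have hℓ : speedSq p q f θ = 1 / 4 * (W * W).trace := by rw [speedSq, metric_eq_mc hp]
    have hdd : d = 1 / 2 * (W * X).trace / (2 * √(speedSq p q f θ)) := by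
      rw [hd, deriv_targetDist_family hp hI hf hgeo hθ, (hasDerivAt_speedSq hp hI hf hθ).deriv]
    -- Where the endpoints coincide, the distance has derivative value d = 0 and plain convexity is
    -- enough.
    rcases (speedSq_nonneg p q f θ).eq_or_lt with h0 | h0
    · rw [← h0, Real.sqrt_zero, mul_zero, div_zero] at hdd
      rw [hdd]
      simpa using hj0
    · have hd2 : d ^ 2 = (W * X).trace ^ 2 / (4 * (W * W).trace) := by
        rw [hdd, div_pow, mul_pow, mul_pow, Real.sq_sqrt h0.le, hℓ]
        ring
      have hpos : 0 < (W * W).trace := by linarith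
      have : (W * X).trace ^ 2 / (4 * (W * W).trace) ≤ 1 / 4 * ((X + K t * W - W * K t) * X).trace := by
        rw [div_le_iff₀ (by positivity)]
        linarith
      rw [hd2]
      linarith
end

end

/-! ### Parametric integrals, convexity, and Hopf coordinates -/

section

variable {p q : ℤ}

/-! ### Differentiation under the integral over a relatively compact set. -/

section ParametricIntegral
variable {E : Type*} [NormedAddCommGroup E] [NormedSpace ℝ E]
  {O K B : Set E} {h : ℝ × E → ℝ}

theorem contDiffOn_timeDeriv (hO : IsOpen O) (hh : ContDiffOn ℝ ∞ h (Icc 0 1 ×ˢ O)) :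
    ContDiffOn ℝ ∞ (fun z => fderivWithin ℝ h (Icc 0 1 ×ˢ O) z (1, 0)) (Icc 0 1 ×ˢ O) :=
  (hh.fderivWithin ((uniqueDiffOn_Icc zero_lt_one).prod hO.uniqueDiffOn) (by simp)).clm_apply contDiffOn_const

theorem hasDerivWithinAt_slice (hh : ContDiffOn ℝ ∞ h (Icc 0 1 ×ˢ O)) {t : ℝ} (ht : t ∈ Icc (0:ℝ) 1) {c : E} (hc : c ∈ O) :
    HasDerivWithinAt (fun r => h (r, c)) (fderivWithin ℝ h (Icc 0 1 ×ˢ O) (t, c) (1, 0)) (Icc 0 1) t := by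
  have h1 := ((hh.differentiableOn (by simp)) (t, c) ⟨ht, hc⟩).hasFDerivWithinAt
  exact h1.comp_hasDerivWithinAt (f := fun r : ℝ => (r, c)) (s := Icc 0 1) t
    (((hasDerivAt_id t).prodMk (hasDerivAt_const t c)).hasDerivWithinAt) (fun r hr => ⟨hr, hc⟩)

variable [MeasurableSpace E] [BorelSpace E] {μ : Measure E} [IsFiniteMeasureOnCompacts μ]

theorem integrableOn_slice (hh : ContDiffOn ℝ ∞ h (Icc 0 1 ×ˢ O)) (hK : IsCompact K) (hKO : K ⊆ O)
    (hBK : B ⊆ K) {t : ℝ} (ht : t ∈ Icc (0:ℝ) 1) : IntegrableOn (fun c => h (t, c)) B μ := by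
  refine IntegrableOn.mono_set ?_ hBK
  refine ContinuousOn.integrableOn_compact hK ?_
  exact hh.continuousOn.comp (by fun_prop) fun c hc => ⟨ht, hKO hc⟩

theorem hasDerivWithinAt_integral_slice (hO : IsOpen O) (hh : ContDiffOn ℝ ∞ h (Icc 0 1 ×ˢ O)) (hK : IsCompact K) (hKO : K ⊆ O)
    (hBK : B ⊆ K) (hB : MeasurableSet B) {t : ℝ} (ht : t ∈ Icc (0:ℝ) 1) :
    HasDerivWithinAt (fun r => ∫ c in B, h (r, c) ∂μ)
      (∫ c in B, fderivWithin ℝ h (Icc 0 1 ×ˢ O) (t, c) (1, 0) ∂μ) (Icc 0 1) t := by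
  -- By the mean value inequality this bound on the time derivative also dominates the difference
  -- quotients.
  obtain ⟨M, hM⟩ := (isCompact_Icc.prod hK).exists_bound_of_continuousOn
    ((contDiffOn_timeDeriv hO hh).continuousOn.mono (prod_mono subset_rfl hKO))
  have hfin : μ B ≠ ⊤ := ((measure_mono hBK).trans_lt hK.measure_lt_top).ne
  rw [hasDerivWithinAt_iff_tendsto_slope]
  have key : Tendsto (fun r => ∫ c in B, slope (fun s => h (s, c)) t r ∂μ) (𝓝[Icc 0 1 \ {t}] t)
      (𝓝 (∫ c in B, fderivWithin ℝ h (Icc 0 1 ×ˢ O) (t, c) (1, 0) ∂μ)) := by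
    refine tendsto_integral_filter_of_dominated_convergence (fun _ => M) ?_ ?_ ?_ ?_
    · filter_upwards [self_mem_nhdsWithin] with r hr
      refine ContinuousOn.aestronglyMeasurable ?_ hB
      simp only [slope_def_field]
      refine ContinuousOn.div_const (ContinuousOn.sub ?_ ?_) _
      · exact hh.continuousOn.comp (by fun_prop) fun c hc => ⟨hr.1, hKO (hBK hc)⟩
      · exact hh.continuousOn.comp (by fun_prop) fun c hc => ⟨ht, hKO (hBK hc)⟩
    · filter_upwards [self_mem_nhdsWithin] with r hr
      refine (ae_restrict_iff' hB).2 (Eventually.of_forall fun c hc => ?_)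
      have := (convex_Icc (0:ℝ) 1).norm_image_sub_le_of_norm_hasDerivWithin_le
        (fun s hs => hasDerivWithinAt_slice hh hs (hKO (hBK hc))) (fun s hs => hM (s, c) ⟨hs, hBK hc⟩) ht hr.1
      have hne : 0 < ‖r - t‖ := norm_pos_iff.2 (sub_ne_zero.2 hr.2)
      rw [slope_def_field, norm_div, div_le_iff₀ hne]
      exact this
    · exact integrableOn_const (by exact hfin)
    · refine (ae_restrict_iff' hB).2 (Eventually.of_forall fun c hc => ?_)
      exact hasDerivWithinAt_iff_tendsto_slope.1 (hasDerivWithinAt_slice hh ht (hKO (hBK hc)))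
  refine key.congr' ?_
  filter_upwards [self_mem_nhdsWithin] with r hr
  simp only [slope_def_field]
  rw [integral_div, integral_sub (integrableOn_slice hh hK hKO hBK hr.1) (integrableOn_slice hh hK hKO hBK ht)]

theorem contDiffOn_integral_slice (hO : IsOpen O) (hK : IsCompact K) (hKO : K ⊆ O)
    (hBK : B ⊆ K) (hB : MeasurableSet B) (n : ℕ) : ∀ {h : ℝ × E → ℝ}, ContDiffOn ℝ ∞ h (Icc 0 1 ×ˢ O) →
    ContDiffOn ℝ n (fun r => ∫ c in B, h (r, c) ∂μ) (Icc 0 1) := by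
  induction n with
  | zero =>
    intro h hh
    exact contDiffOn_zero.2 fun t ht => (hasDerivWithinAt_integral_slice hO hh hK hKO hBK hB ht).continuousWithinAt
  | succ n ih =>
    intro h hh
    have hu := uniqueDiffOn_Icc (zero_lt_one (α := ℝ))
    push_cast
    rw [contDiffOn_succ_iff_derivWithin hu]
    refine ⟨fun t ht => (hasDerivWithinAt_integral_slice hO hh hK hKO hBK hB ht).differentiableWithinAt, by simp, ?_⟩
    exact (ih (contDiffOn_timeDeriv hO hh)).congr fun t ht =>
      (hasDerivWithinAt_integral_slice hO hh hK hKO hBK hB ht).derivWithin (hu t ht)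

end ParametricIntegral

/-- A chord slope of a convex function lies between the derivatives at its ends. Hence difference
quotients of G' are nonnegative, one-sided ones at the endpoints included. -/
theorem second_deriv_nonneg_of_convexOn {G G' : ℝ → ℝ} {G'' t : ℝ} (hG : ConvexOn ℝ (Icc 0 1) G) (ht : t ∈ Icc (0:ℝ) 1)
    (h1 : ∀ᶠ s in 𝓝[Icc 0 1] t, HasDerivWithinAt G (G' s) (Icc 0 1) s) (h2 : HasDerivWithinAt G' G'' (Icc 0 1) t) :
    0 ≤ G'' := by
  have hu : UniqueDiffWithinAt ℝ (Icc (0:ℝ) 1) t := uniqueDiffOn_Icc zero_lt_one t ht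
  have hne : (𝓝[Icc (0:ℝ) 1 \ {t}] t).NeBot := accPt_principal_iff_nhdsWithin.1 hu.accPt
  have h0 := h1.self_of_nhdsWithin ht
  refine ge_of_tendsto (hasDerivWithinAt_iff_tendsto_slope.1 h2) ?_
  filter_upwards [nhdsWithin_mono t sdiff_subset h1, self_mem_nhdsWithin] with s hs hs'
  rw [slope_def_field]
  rcases lt_or_gt_of_ne hs'.2 with hlt | hlt
  · have a1 := hG.le_slope_of_hasDerivWithinAt hs'.1 ht hlt hs
    have a2 := hG.slope_le_of_hasDerivWithinAt hs'.1 ht hlt h0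
    exact div_nonneg_of_nonpos (by linarith) (by linarith)
  · have a1 := hG.le_slope_of_hasDerivWithinAt ht hs'.1 hlt h0
    have a2 := hG.slope_le_of_hasDerivWithinAt ht hs'.1 hlt hs
    exact div_nonneg (by linarith) (by linarith)

/-! ### Integrals of integrands that are uniformly convex in time. -/

section Convex
variable {X : Type*} [MeasurableSpace X] {μ : Measure X} {B : Set X} {e : ℝ → X → ℝ} {m : X → ℝ}

theorem integrableOn_of_convexOn_sub (hB : MeasurableSet B) (hm : AEStronglyMeasurable m (μ.restrict B)) (hm0 : ∀ c ∈ B, 0 ≤ m c)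
    (he : ∀ t ∈ Icc (0:ℝ) 1, IntegrableOn (e t) B μ)
    (hc : ∀ c ∈ B, ConvexOn ℝ (Icc 0 1) (fun t => e t c - m c * t ^ 2)) : IntegrableOn m B μ := by
  -- Midpoint convexity between 0 and 1 reads m ≤ 2e(0) + 2e(1) − 4e(½), an integrable bound.
  have hi : IntegrableOn (fun c => 2 * e 0 c + 2 * e 1 c - 4 * e (1 / 2) c) B μ :=
    (((he 0 (by simp)).const_mul 2).add ((he 1 (by simp)).const_mul 2)).sub ((he (1 / 2) (by constructor <;> norm_num)).const_mul 4)
  refine Integrable.mono' hi hm ((ae_restrict_iff' hB).2 (Eventually.of_forall fun c hcB => ?_))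
  have := (hc c hcB).2 (left_mem_Icc.2 zero_le_one) (right_mem_Icc.2 zero_le_one)
    (show (0:ℝ) ≤ 1 / 2 by norm_num) (show (0:ℝ) ≤ 1 / 2 by norm_num) (by norm_num)
  simp only [smul_eq_mul] at this
  norm_num at this
  rw [Real.norm_of_nonneg (hm0 c hcB)]
  norm_num
  linarith

theorem convexOn_integral_sub (hB : MeasurableSet B) (hmi : IntegrableOn m B μ)
    (he : ∀ t ∈ Icc (0:ℝ) 1, IntegrableOn (e t) B μ)
    (hc : ∀ c ∈ B, ConvexOn ℝ (Icc 0 1) (fun t => e t c - m c * t ^ 2)) :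
    ConvexOn ℝ (Icc 0 1) (fun t => (∫ c in B, e t c ∂μ) - (∫ c in B, m c ∂μ) * t ^ 2) := by
  have hi : ∀ t ∈ Icc (0:ℝ) 1, IntegrableOn (fun c => e t c - m c * t ^ 2) B μ := fun t ht => (he t ht).sub (hmi.mul_const _)
  have heq : ∀ t ∈ Icc (0:ℝ) 1, (∫ c in B, e t c ∂μ) - (∫ c in B, m c ∂μ) * t ^ 2 = ∫ c in B, (e t c - m c * t ^ 2) ∂μ := by
    intro t ht
    rw [integral_sub (he t ht) (hmi.mul_const _), integral_mul_const]
  refine ⟨convex_Icc 0 1, fun x hx y hy a b ha hb hab => ?_⟩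
  have hz := convex_Icc (0:ℝ) 1 hx hy ha hb hab
  simp only [heq _ hx, heq _ hy, heq _ hz]
  simp only [smul_eq_mul]
  rw [← integral_const_mul, ← integral_const_mul, ← integral_add ((hi x hx).const_mul a) ((hi y hy).const_mul b)]
  refine setIntegral_mono_on (hi _ hz) (((hi x hx).const_mul a).add ((hi y hy).const_mul b)) hB fun c hcB => ?_
  exact (hc c hcB).2 hx hy ha hb hab
end Convex

/-! ### Hopf coordinates and compactness away from the poles. -/

section Sphere

theorem continuous_hopf : Continuous hopf := by
  refine Continuous.subtype_mk ?_ _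
  refine (PiLp.continuous_toLp 2 _).comp (continuous_pi fun i => ?_)
  fin_cases i <;> simp <;> fun_prop

theorem isOpen_coordSet {Ω : Set S3} (hΩ : IsOpen Ω) : IsOpen (coordSet Ω) :=
  (isOpen_Ioo.preimage continuous_fst).inter (hΩ.preimage continuous_hopf)

theorem measurableSet_coordBox {Ω : Set S3} (hΩ : IsOpen Ω) : MeasurableSet (coordBox Ω) := by
  refine (isOpen_coordSet hΩ).measurableSet.inter (MeasurableSet.inter ?_ ?_)
  · exact measurableSet_Ico.preimage (measurable_fst.comp measurable_snd)
  · exact measurableSet_Ico.preimage (measurable_snd.comp measurable_snd)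

theorem norm_hopf_zero (c : ℝ × ℝ × ℝ) : ‖(hopf c).1 0‖ = |Real.sin (c.1 / 2)| := by
  simp [hopf, hopfVec, Complex.norm_exp_ofReal_mul_I, -Complex.ofReal_sin, Complex.norm_real]

theorem hopf_zero_mem_poles (φ : ℝ × ℝ) : hopf (0, φ) ∈ poles := by
  left; simp [hopf, hopfVec]

theorem hopf_pi_mem_poles (φ : ℝ × ℝ) : hopf (Real.pi, φ) ∈ poles := by
  right; simp [hopf, hopfVec]

/-- The compact set of Hopf coordinates in one period of the points of the closure of `Ω`. -/
def closedBox (Ω : Set S3) : Set (ℝ × ℝ × ℝ) :=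
  (Icc 0 Real.pi ×ˢ Icc 0 (2 * Real.pi) ×ˢ Icc 0 (2 * Real.pi)) ∩ hopf ⁻¹' closure Ω

theorem isCompact_closedBox (Ω : Set S3) : IsCompact (closedBox Ω) :=
  (isCompact_Icc.prod (isCompact_Icc.prod isCompact_Icc)).inter_right (isClosed_closure.preimage continuous_hopf)

theorem coordBox_subset_closedBox (Ω : Set S3) : coordBox Ω ⊆ closedBox Ω := fun _ hc =>
  ⟨⟨Ioo_subset_Icc_self hc.1.1, Ico_subset_Icc_self hc.2.1, Ico_subset_Icc_self hc.2.2⟩, subset_closure hc.1.2⟩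

theorem closedBox_subset_coordSet {Ω U : Set S3} (h : closure Ω ⊆ U) (hU : Disjoint U poles) : closedBox Ω ⊆ coordSet U := by
  rintro ⟨θ, φ⟩ hc
  have hcU : hopf (θ, φ) ∈ U := h hc.2
  have hnp := fun hp => Set.disjoint_left.1 hU hcU hp
  refine ⟨⟨lt_of_le_of_ne hc.1.1.1 ?_, lt_of_le_of_ne hc.1.1.2 ?_⟩, hcU⟩
  · rintro h0
    have h0' : 0 = θ := h0
    subst h0'
    exact hnp (hopf_zero_mem_poles φ)
  · rintro h0
    have h0' : θ = Real.pi := h0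
    subst h0'
    exact hnp (hopf_pi_mem_poles φ)
end Sphere

end

/-! ### The quasi-harmonic energy -/

section

variable {p q : ℤ}

theorem contDiff_metric_self (hp : p ≠ 0) (q : ℤ) : ContDiff ℝ ∞ (fun z : Target × Target => metric p q z.1 z.2 z.2) := by
  have h1 : ContDiff ℝ ∞ (fun z : Target × Target => mc p q z.1 z.2) :=
    ((contDiff_spdInv hp q).comp contDiff_fst).mul
      ((((contDiff_spd hp q).fderiv_right (m := ∞) (by simp)).comp contDiff_fst).clm_apply contDiff_snd)
  simp only [metric_eq_mc hp]
  exact contDiff_const.mul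
    ((Matrix.traceLinearMap (Fin 7) ℝ ℝ).toContinuousLinearMap.contDiff.comp (h1.mul h1))

section Family
variable {Ψ : ℝ → S3 → Target} {Ω : Set S3} {c : ℝ × ℝ × ℝ}

/-- The family restricted to the meridian with Hopf angles `φ`. -/
def meridian (Ψ : ℝ → S3 → Target) (φ : ℝ × ℝ) (y : ℝ × ℝ) : Target := Ψ y.1 (hopf (y.2, φ))

/-- The values of `θ` on the meridian with Hopf angles `φ` that stay in `Ω`. -/
def meridianDomain (Ω : Set S3) (φ : ℝ × ℝ) : Set ℝ := {θ | (θ, φ) ∈ coordSet Ω}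

theorem isOpen_meridianDomain (hΩ : IsOpen Ω) (φ : ℝ × ℝ) : IsOpen (meridianDomain Ω φ) :=
  (isOpen_coordSet hΩ).preimage (by fun_prop)

theorem contDiffOn_meridian (hΨ : SmoothFamilyOn Ψ Ω) (φ : ℝ × ℝ) :
    ContDiffOn ℝ ∞ (meridian Ψ φ) (Icc 0 1 ×ˢ meridianDomain Ω φ) :=
  ContDiffOn.comp (g := fun z : ℝ × ℝ × ℝ × ℝ => Ψ z.1 (hopf z.2)) (f := fun y : ℝ × ℝ => (y.1, y.2, φ)) hΨ
    (by fun_prop) fun _ hy => ⟨hy.1, hy.2⟩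

theorem deriv_eq_zero_of_eventually_const {g : ℝ → ℝ} {x : ℝ} (h : ∀ᶠ y in 𝓝 x, g y = g x) : deriv g x = 0 := by
  exact (EventuallyEq.deriv_eq (f := fun _ => g x) h).trans (deriv_const _ _)

/-- By bi-axisymmetry the distance is locally constant in both angles; the factor 4 is the inverse
of dθ²/4. -/
theorem gradDistSq_eq (hΩ : IsOpen Ω) (hsymm : ∀ t ∈ Icc (0 : ℝ) 1, BiaxisymmetricOn (Ψ t) Ω) (hc : c ∈ coordSet Ω) :
    gradDistSq p q (Ψ 1) (Ψ 0) c =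
      4 * deriv (fun r => targetDist p q (meridian Ψ c.2 (1, r)) (meridian Ψ c.2 (0, r))) c.1 ^ 2 := by
  obtain ⟨θ, φ₁, φ₂⟩ := c
  have key : ∀ d ∈ coordSet Ω, d.1 = θ →
      targetDist p q (Ψ 1 (hopf d)) (Ψ 0 (hopf d)) =
        targetDist p q (Ψ 1 (hopf (θ, φ₁, φ₂))) (Ψ 0 (hopf (θ, φ₁, φ₂))) := by
    intro d hd hdθ
    have hn : ‖(hopf d).1 0‖ = ‖(hopf (θ, φ₁, φ₂)).1 0‖ := by rw [norm_hopf_zero, norm_hopf_zero, hdθ]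
    rw [hsymm 1 (by simp) _ hd.2 _ hc.2 hn, hsymm 0 (by simp) _ hd.2 _ hc.2 hn]
  have hO := isOpen_coordSet hΩ
  have h1 : deriv (fun φ => targetDist p q (Ψ 1 (hopf (θ, φ, φ₂))) (Ψ 0 (hopf (θ, φ, φ₂)))) φ₁ = 0 := by
    refine deriv_eq_zero_of_eventually_const ?_
    filter_upwards [(hO.preimage (show Continuous fun φ : ℝ => (θ, φ, φ₂) by fun_prop)).mem_nhds hc] with φ hφ
    exact key _ hφ rfl
  have h2 : deriv (fun φ => targetDist p q (Ψ 1 (hopf (θ, φ₁, φ))) (Ψ 0 (hopf (θ, φ₁, φ)))) φ₂ = 0 := by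
    refine deriv_eq_zero_of_eventually_const ?_
    filter_upwards [(hO.preimage (show Continuous fun φ : ℝ => (θ, φ₁, φ) by fun_prop)).mem_nhds hc] with φ hφ
    exact key _ hφ rfl
  simp only [gradDistSq, gradSq, h1, h2, meridian]
  ring

theorem sin_nonneg_of_mem_coordSet (hc : c ∈ coordSet Ω) : 0 ≤ Real.sin c.1 / 4 :=
  div_nonneg (Real.sin_nonneg_of_nonneg_of_le_pi hc.1.1.le hc.1.2.le) (by norm_num)

theorem convexOn_energyDensity_sub (hp : p ≠ 0) {Λ : ℝ} (A : ℝ) (hΛ : 0 ≤ Λ) {ξ : ℝ → ℝ}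
    (hξ1 : ∀ x ∈ Icc (-1 : ℝ) 1, 1 ≤ ξ x) (hΩ : IsOpen Ω) (hΨ : SmoothFamilyOn Ψ Ω)
    (hsymm : ∀ t ∈ Icc (0 : ℝ) 1, BiaxisymmetricOn (Ψ t) Ω)
    (hgeo : ∀ x ∈ Ω, IsGeodesic p q (fun t => Ψ t x)) (hc : c ∈ coordSet Ω) :
    ConvexOn ℝ (Icc 0 1) (fun t => energyDensity p q Λ A ξ (Ψ t) c * (Real.sin c.1 / 4)
      - 1 / 4 * (gradDistSq p q (Ψ 1) (Ψ 0) c * (Real.sin c.1 / 4)) * t ^ 2) := by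
  have h1 := convexOn_density hp (isOpen_meridianDomain hΩ c.2) (contDiffOn_meridian hΨ c.2)
    (fun θ hθ => hgeo _ hθ.2) (θ := c.1) hc
  have h2 := (hgeo _ hc.2).convexOn_exp hp
  have hx : 1 ≤ ξ (Real.cos c.1) := hξ1 _ ⟨Real.neg_one_le_cos _, Real.cos_le_one _⟩
  have hs := sin_nonneg_of_mem_coordSet hc
  rw [gradDistSq_eq hΩ hsymm hc]
  set d := deriv (fun r => targetDist p q (meridian Ψ c.2 (1, r)) (meridian Ψ c.2 (0, r))) c.1
  have h3 : ConvexOn ℝ (Icc (0:ℝ) 1) (fun t : ℝ => t ^ 2) :=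
    (even_two.convexOn_pow).subset (subset_univ _) (convex_Icc 0 1)
  have hk : 0 ≤ 3 * (p : ℝ) ^ 2 * Λ * (A / (2 * √2 * Real.pi ^ 2)) ^ 2 * Real.sin c.1 ^ 2 := by positivity
  -- With e the Dirichlet density, ξe − d²t² = ξ(e − d²t²) + (ξ − 1)d²t². Both terms are convex as ξ
  -- ≥ 1, and the potential is a nonnegative multiple of e^{-4u}.
  have := ((((h1.smul (zero_le_one.trans hx)).add (h3.smul (mul_nonneg (sub_nonneg.2 hx) (sq_nonneg d)))).add
    (h2.smul (mul_nonneg (zero_le_one.trans hx) hk))).smul hs)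
  refine this.congr fun t _ => ?_
  simp only [energyDensity, smul_eq_mul, Pi.add_apply, meridian, dTheta]
  ring

theorem contDiffOn_metric_self (hp : p ≠ 0) {E : Type*} [NormedAddCommGroup E] [NormedSpace ℝ E] {s : Set E}
    {g v : E → Target} (hg : ContDiffOn ℝ ∞ g s) (hv : ContDiffOn ℝ ∞ v s) :
    ContDiffOn ℝ ∞ (fun z => metric p q (g z) (v z) (v z)) s :=
  (contDiff_metric_self hp q).comp_contDiffOn (hg.prodMk hv)

/-- Joint smoothness in all Hopf coordinates, needed for the measurability of |∇dist|². -/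
theorem contDiffOn_speedSq_meridian (hp : p ≠ 0) (hΩ : IsOpen Ω) (hΨ : SmoothFamilyOn Ψ Ω) :
    ContDiffOn ℝ ∞ (fun c : ℝ × ℝ × ℝ => speedSq p q (meridian Ψ c.2) c.1) (coordSet Ω) := by
  have hO : IsOpen (Ioo (0:ℝ) 1 ×ˢ coordSet Ω) := isOpen_Ioo.prod (isOpen_coordSet hΩ)
  have hΨ' := hΨ.mono (prod_mono Ioo_subset_Icc_self subset_rfl : Ioo (0:ℝ) 1 ×ˢ coordSet Ω ⊆ _)
  have hmap : MapsTo (fun c : ℝ × ℝ × ℝ => ((1 / 2 : ℝ), c)) (coordSet Ω) (Ioo (0:ℝ) 1 ×ˢ coordSet Ω) :=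
    fun c hc => ⟨half_mem, hc⟩
  have hv : ContDiffOn ℝ ∞ (fun c : ℝ × ℝ × ℝ =>
      fderiv ℝ (fun z : ℝ × ℝ × ℝ × ℝ => Ψ z.1 (hopf z.2)) (1 / 2, c) (1, 0)) (coordSet Ω) :=
    ((hΨ'.fderiv_of_isOpen hO (m := ∞) (by simp)).comp (f := fun c : ℝ × ℝ × ℝ => ((1 / 2 : ℝ), c))
      (by fun_prop) hmap).clm_apply contDiffOn_const
  refine (contDiffOn_metric_self (q := q) hp (hΨ'.comp (f := fun c : ℝ × ℝ × ℝ => ((1 / 2 : ℝ), c)) (by fun_prop) hmap) hv).congr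
    fun c hc => ?_
  have hd : HasFDerivAt (fun z : ℝ × ℝ × ℝ × ℝ => Ψ z.1 (hopf z.2)) _ (1 / 2, c) :=
    ((hΨ'.contDiffAt (hO.mem_nhds (hmap hc))).differentiableAt (by simp)).hasFDerivAt
  have hi : HasFDerivAt (fun y : ℝ × ℝ => (y.1, y.2, c.2))
      ((ContinuousLinearMap.fst ℝ ℝ ℝ).prod ((ContinuousLinearMap.snd ℝ ℝ ℝ).prod 0)) (1 / 2, c.1) :=
    hasFDerivAt_fst.prodMk (hasFDerivAt_snd.prodMk (hasFDerivAt_const _ _))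
  have hm : fderiv ℝ (meridian Ψ c.2) (1 / 2, c.1) (1, 0) =
      fderiv ℝ (fun z : ℝ × ℝ × ℝ × ℝ => Ψ z.1 (hopf z.2)) (1 / 2, c) (1, 0) := by
    have := HasFDerivAt.comp (f := fun y : ℝ × ℝ => (y.1, y.2, c.2)) (1 / 2, c.1) hd hi
    rw [show meridian Ψ c.2 = (fun z : ℝ × ℝ × ℝ × ℝ => Ψ z.1 (hopf z.2)) ∘ fun y : ℝ × ℝ => (y.1, y.2, c.2) from rfl,
      this.fderiv]
    simp
    rfl
  rw [speedSq, hm]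
  rfl

theorem aestronglyMeasurable_gradDistSq (hp : p ≠ 0) (hΩ : IsOpen Ω) (hΨ : SmoothFamilyOn Ψ Ω)
    (hsymm : ∀ t ∈ Icc (0 : ℝ) 1, BiaxisymmetricOn (Ψ t) Ω)
    (hgeo : ∀ x ∈ Ω, IsGeodesic p q (fun t => Ψ t x)) :
    AEStronglyMeasurable (fun c => gradDistSq p q (Ψ 1) (Ψ 0) c * (Real.sin c.1 / 4))
      (volume.restrict (coordBox Ω)) := by
  set ℓ : ℝ × ℝ × ℝ → ℝ := fun c => speedSq p q (meridian Ψ c.2) c.1 with hℓ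
  have hO := isOpen_coordSet hΩ
  have hc : ContDiffOn ℝ ∞ ℓ (coordSet Ω) := contDiffOn_speedSq_meridian hp hΩ hΨ
  have h1 : AEMeasurable ℓ (volume.restrict (coordSet Ω)) := hc.continuousOn.aemeasurable hO.measurableSet
  have h2 : AEMeasurable (fun c => fderiv ℝ ℓ c (1, 0)) (volume.restrict (coordSet Ω)) :=
    ((hc.continuousOn_fderiv_of_isOpen hO (by simp)).clm_apply continuousOn_const).aemeasurable hO.measurableSet
  have h3 : AEMeasurable (fun c : ℝ × ℝ × ℝ => 4 * (fderiv ℝ ℓ c (1, 0) / (2 * √(ℓ c))) ^ 2 * (Real.sin c.1 / 4))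
      (volume.restrict (coordSet Ω)) :=
    (((h2.div (h1.sqrt.const_mul 2)).pow_const 2).const_mul 4).mul (by fun_prop)
  refine AEStronglyMeasurable.mono_set (t := coordSet Ω) inter_subset_left ?_
  refine h3.aestronglyMeasurable.congr ((ae_restrict_iff' hO.measurableSet).2 (Eventually.of_forall fun c hcC => ?_))
  beta_reduce
  rw [gradDistSq_eq hΩ hsymm hcC, deriv_targetDist_family hp (isOpen_meridianDomain hΩ c.2) (contDiffOn_meridian hΨ c.2)
    (fun θ hθ => hgeo _ hθ.2) (θ := c.1) hcC]
  have hd : HasFDerivAt ℓ _ (c.1, c.2) := ((hc.contDiffAt (hO.mem_nhds hcC)).differentiableAt (by simp)).hasFDerivAt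
  have := hd.comp_hasDerivAt (f := fun θ : ℝ => (θ, c.2)) c.1 ((hasDerivAt_id c.1).prodMk (hasDerivAt_const c.1 c.2))
  have h4 : deriv (speedSq p q (meridian Ψ c.2)) c.1 = fderiv ℝ ℓ c (1, 0) := this.deriv
  rw [h4]

theorem gradDistSq_mul_sin_nonneg (hc : c ∈ coordSet Ω) :
    0 ≤ gradDistSq p q (Ψ 1) (Ψ 0) c * (Real.sin c.1 / 4) :=
  mul_nonneg (by unfold gradDistSq gradSq; positivity) (sin_nonneg_of_mem_coordSet hc)

theorem sphereIntegrable_gradDistSq (hp : p ≠ 0) {Λ A : ℝ} (hΛ : 0 ≤ Λ) {ξ : ℝ → ℝ}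
    (hξ1 : ∀ x ∈ Icc (-1 : ℝ) 1, 1 ≤ ξ x) (hΩ : IsOpen Ω) (hΨ : SmoothFamilyOn Ψ Ω)
    (hsymm : ∀ t ∈ Icc (0 : ℝ) 1, BiaxisymmetricOn (Ψ t) Ω)
    (hgeo : ∀ x ∈ Ω, IsGeodesic p q (fun t => Ψ t x))
    (hfin : ∀ t ∈ Icc (0 : ℝ) 1, FiniteEnergy p q Λ A ξ Ω (Ψ t)) :
    SphereIntegrable Ω (gradDistSq p q (Ψ 1) (Ψ 0)) := by
  have h := integrableOn_of_convexOn_sub (e := fun t c => energyDensity p q Λ A ξ (Ψ t) c * (Real.sin c.1 / 4))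
    (m := fun c => 1 / 4 * (gradDistSq p q (Ψ 1) (Ψ 0) c * (Real.sin c.1 / 4))) (measurableSet_coordBox hΩ)
    ((aestronglyMeasurable_gradDistSq hp hΩ hΨ hsymm hgeo).const_mul _)
    (fun c hc => mul_nonneg (by norm_num) (gradDistSq_mul_sin_nonneg hc.1)) hfin
    (fun c hc => convexOn_energyDensity_sub hp A hΛ hξ1 hΩ hΨ hsymm hgeo hc.1)
  refine (h.const_mul 4).congr (Eventually.of_forall fun c => ?_)
  ring

theorem energy_second_deriv_ge (hp : p ≠ 0) {Λ A : ℝ} (hΛ : 0 ≤ Λ) {ξ : ℝ → ℝ}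
    (hξ1 : ∀ x ∈ Icc (-1 : ℝ) 1, 1 ≤ ξ x) (hΩ : IsOpen Ω) (hΨ : SmoothFamilyOn Ψ Ω)
    (hsymm : ∀ t ∈ Icc (0 : ℝ) 1, BiaxisymmetricOn (Ψ t) Ω)
    (hgeo : ∀ x ∈ Ω, IsGeodesic p q (fun t => Ψ t x))
    (hfin : ∀ t ∈ Icc (0 : ℝ) 1, FiniteEnergy p q Λ A ξ Ω (Ψ t)) {t : ℝ} (ht : t ∈ Icc (0 : ℝ) 1) {E' : ℝ → ℝ} {E'' : ℝ}
    (h1 : ∀ᶠ s in 𝓝[Icc 0 1] t, HasDerivWithinAt (fun t => energy p q Λ A ξ Ω (Ψ t)) (E' s) (Icc 0 1) s)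
    (h2 : HasDerivWithinAt E' E'' (Icc 0 1) t) :
    1 / (2 * Real.pi ^ 2) * sphereIntegral Ω (gradDistSq p q (Ψ 1) (Ψ 0)) ≤ E'' := by
  have hint := sphereIntegrable_gradDistSq hp hΛ hξ1 hΩ hΨ hsymm hgeo hfin
  have hconv := convexOn_integral_sub (e := fun t c => energyDensity p q Λ A ξ (Ψ t) c * (Real.sin c.1 / 4))
    (m := fun c => 1 / 4 * (gradDistSq p q (Ψ 1) (Ψ 0) c * (Real.sin c.1 / 4))) (measurableSet_coordBox hΩ)
    (hint.const_mul _) hfin (fun c hc => convexOn_energyDensity_sub hp A hΛ hξ1 hΩ hΨ hsymm hgeo hc.1)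
  rw [integral_const_mul] at hconv
  set S := sphereIntegral Ω (gradDistSq p q (Ψ 1) (Ψ 0)) with hS
  -- The ¼ is from the pointwise bound, 1/π² from the energy; the second derivative of t² then
  -- doubles 1/(4π²).
  have hG : ConvexOn ℝ (Icc 0 1) (fun t => energy p q Λ A ξ Ω (Ψ t) - 1 / (4 * Real.pi ^ 2) * S * t ^ 2) := by
    refine (hconv.smul (show (0:ℝ) ≤ 1 / Real.pi ^ 2 by positivity)).congr fun t _ => ?_
    simp only [energy, hS, sphereIntegral, smul_eq_mul]
    ring
  have := second_deriv_nonneg_of_convexOn (G' := fun s => E' s - 1 / (4 * Real.pi ^ 2) * S * (2 * s))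
    (G'' := E'' - 1 / (4 * Real.pi ^ 2) * S * 2) hG ht ?_ ?_
  · have e : 1 / (4 * Real.pi ^ 2) * S * 2 = 1 / (2 * Real.pi ^ 2) * S := by ring
    linarith
  · filter_upwards [h1] with s hs
    exact hs.sub ((((hasDerivAt_id s).fun_pow 2).const_mul (1 / (4 * Real.pi ^ 2) * S)).congr_deriv (by simp)).hasDerivWithinAt
  · exact h2.sub ((((hasDerivAt_id t).const_mul 2).const_mul (1 / (4 * Real.pi ^ 2) * S)).congr_deriv (by simp)).hasDerivWithinAt

theorem contDiffOn_energyDensity (hp : p ≠ 0) (Λ A : ℝ) {ξ : ℝ → ℝ} (hξ : ContDiffOn ℝ ∞ ξ (Icc (-1) 1)) (hΩ : IsOpen Ω)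
    (hΨ : SmoothFamilyOn Ψ Ω) :
    ContDiffOn ℝ ∞ (fun z : ℝ × ℝ × ℝ × ℝ => energyDensity p q Λ A ξ (Ψ z.1) z.2 * (Real.sin z.2.1 / 4))
      (Icc 0 1 ×ˢ coordSet Ω) := by
  have hO := isOpen_coordSet hΩ
  have hu : UniqueDiffOn ℝ (Icc (0:ℝ) 1 ×ˢ coordSet Ω) := (uniqueDiffOn_Icc zero_lt_one).prod hO.uniqueDiffOn
  -- At t = 0, 1 only a derivative within the strip is available. It still gives ∂_θ in the
  -- direction (0, 1, 0, 0), because the slice in θ is open.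
  have hv : ContDiffOn ℝ ∞ (fun z : ℝ × ℝ × ℝ × ℝ => dTheta (Ψ z.1) z.2) (Icc 0 1 ×ˢ coordSet Ω) := by
    refine ((ContDiffOn.fderivWithin hΨ hu (m := ∞) (by simp)).clm_apply
      (contDiffOn_const (c := ((0, 1, 0, 0) : ℝ × ℝ × ℝ × ℝ)))).congr fun z hz => ?_
    have h1 := ((ContDiffOn.differentiableOn hΨ (by simp)) (z.1, z.2.1, z.2.2) hz).hasFDerivWithinAt
    have h2 := h1.comp_hasDerivWithinAt (f := fun θ : ℝ => (z.1, θ, z.2.2)) (s := meridianDomain Ω z.2.2) z.2.1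
      (((hasDerivAt_const z.2.1 z.1).prodMk ((hasDerivAt_id z.2.1).prodMk (hasDerivAt_const z.2.1 z.2.2))).hasDerivWithinAt)
      (fun θ hθ => ⟨hz.1, hθ⟩)
    exact (h2.hasDerivAt ((isOpen_meridianDomain hΩ z.2.2).mem_nhds hz.2)).deriv
  have hξc : ContDiffOn ℝ ∞ (fun z : ℝ × ℝ × ℝ × ℝ => ξ (Real.cos z.2.1)) (Icc 0 1 ×ˢ coordSet Ω) :=
    hξ.comp (f := fun z : ℝ × ℝ × ℝ × ℝ => Real.cos z.2.1)
      (Real.contDiff_cos.comp (by fun_prop)).contDiffOn fun z _ => ⟨Real.neg_one_le_cos _, Real.cos_le_one _⟩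
  have hsin : ContDiff ℝ ∞ (fun z : ℝ × ℝ × ℝ × ℝ => Real.sin z.2.1) := Real.contDiff_sin.comp (by fun_prop)
  have hu0 : ContDiffOn ℝ ∞ (fun z : ℝ × ℝ × ℝ × ℝ => Real.exp (-4 * Ψ z.1 (hopf z.2) 0)) (Icc 0 1 ×ˢ coordSet Ω) :=
    (contDiffOn_const.mul ((contDiff_coord 0).comp_contDiffOn hΨ)).exp
  exact (hξc.mul ((contDiffOn_metric_self hp hΨ hv).add
    ((contDiffOn_const.mul hu0).mul (hsin.pow 2).contDiffOn))).mul (hsin.div_const 4).contDiffOn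

theorem contDiffOn_energy (hp : p ≠ 0) (Λ A : ℝ) {ξ : ℝ → ℝ} (hξ : ContDiffOn ℝ ∞ ξ (Icc (-1) 1)) (hΩ : IsOpen Ω)
    {U : Set S3} (hU : IsOpen U) (hΩU : closure Ω ⊆ U) (hUΓ : Disjoint U poles) (hΨ : SmoothFamilyOn Ψ U) (n : ℕ) :
    ContDiffOn ℝ n (fun t => energy p q Λ A ξ Ω (Ψ t)) (Icc 0 1) :=
  contDiffOn_const.mul (contDiffOn_integral_slice (isOpen_coordSet hU) (isCompact_closedBox Ω)
    (closedBox_subset_coordSet hΩU hUΓ) (coordBox_subset_closedBox Ω) (measurableSet_coordBox hΩ) n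
    (contDiffOn_energyDensity hp Λ A hξ hU hΨ))

theorem finiteEnergy_of_smooth_closure (hp : p ≠ 0) (Λ A : ℝ) {ξ : ℝ → ℝ} (hξ : ContDiffOn ℝ ∞ ξ (Icc (-1) 1))
    {U : Set S3} (hU : IsOpen U) (hΩU : closure Ω ⊆ U) (hUΓ : Disjoint U poles) (hΨ : SmoothFamilyOn Ψ U) {t : ℝ}
    (ht : t ∈ Icc (0 : ℝ) 1) : FiniteEnergy p q Λ A ξ Ω (Ψ t) :=
  integrableOn_slice (contDiffOn_energyDensity hp Λ A hξ hU hΨ) (isCompact_closedBox Ω)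
    (closedBox_subset_coordSet hΩU hUΓ) (coordBox_subset_closedBox Ω) ht
end Family

end

end QuasiHarmonic

end

theorem proposition6p3
    (p q : ℤ) (hp : p ≠ 0) (Λ A : ℝ) (hΛ : 0 ≤ Λ)
    (ξ : ℝ → ℝ) (hξ : ContDiffOn ℝ ∞ ξ (Icc (-1) 1)) (hξ1 : ∀ x ∈ Icc (-1 : ℝ) 1, 1 ≤ ξ x)
    (Ω : Set S3) (hΩ : IsOpen Ω) (hΩΓ : Disjoint Ω poles)
    (Ψ : ℝ → S3 → Target) (hΨ : SmoothFamilyOn Ψ Ω)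
    (hsymm : ∀ t ∈ Icc (0 : ℝ) 1, BiaxisymmetricOn (Ψ t) Ω)
    (hgeo : ∀ x ∈ Ω, IsGeodesic p q (fun t => Ψ t x)) :
    -- family smooth up to the boundary of `Ω`, `closure Ω` free of poles:
    -- the energy is twice continuously differentiable and the inequality holds
    ((∃ U : Set S3, IsOpen U ∧ closure Ω ⊆ U ∧ Disjoint U poles ∧ SmoothFamilyOn Ψ U) →
      (∀ t ∈ Icc (0 : ℝ) 1, FiniteEnergy p q Λ A ξ Ω (Ψ t)) ∧
      SphereIntegrable Ω (gradDistSq p q (Ψ 1) (Ψ 0)) ∧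
      ContDiffOn ℝ 2 (fun t => energy p q Λ A ξ Ω (Ψ t)) (Icc 0 1) ∧
      ∀ t ∈ Icc (0 : ℝ) 1,
        iteratedDerivWithin 2 (fun t => energy p q Λ A ξ Ω (Ψ t)) (Icc 0 1) t
          ≥ 1 / (2 * Real.pi ^ 2) * sphereIntegral Ω (gradDistSq p q (Ψ 1) (Ψ 0))) ∧
    -- arbitrary `Ω` in the complement of the poles, finite energy:
    -- the inequality holds wherever the second derivative exists
    ((∀ t ∈ Icc (0 : ℝ) 1, FiniteEnergy p q Λ A ξ Ω (Ψ t)) →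
      SphereIntegrable Ω (gradDistSq p q (Ψ 1) (Ψ 0)) ∧
      ∀ t ∈ Icc (0 : ℝ) 1, ∀ (E' : ℝ → ℝ) (E'' : ℝ),
        (∀ᶠ s in 𝓝[Icc 0 1] t,
          HasDerivWithinAt (fun t => energy p q Λ A ξ Ω (Ψ t)) (E' s) (Icc 0 1) s) →
        HasDerivWithinAt E' E'' (Icc 0 1) t →
        E'' ≥ 1 / (2 * Real.pi ^ 2) * sphereIntegral Ω (gradDistSq p q (Ψ 1) (Ψ 0))) ∧
    -- `e^{-4u}` is convex along geodesics of the target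
    (∀ γ : ℝ → Target, IsGeodesic p q γ →
      ConvexOn ℝ (Icc 0 1) (fun t => Real.exp (-4 * γ t 0))) := by
  refine ⟨?_, fun hfin => ⟨sphereIntegrable_gradDistSq hp hΛ hξ1 hΩ hΨ hsymm hgeo hfin,
    fun t ht E' E'' h1 h2 => energy_second_deriv_ge hp hΛ hξ1 hΩ hΨ hsymm hgeo hfin ht h1 h2⟩,
    fun γ hγ => hγ.convexOn_exp hp⟩
  rintro ⟨U, hU, hΩU, hUΓ, hΨU⟩
  have hfin : ∀ t ∈ Icc (0 : ℝ) 1, FiniteEnergy p q Λ A ξ Ω (Ψ t) :=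
    fun t ht => finiteEnergy_of_smooth_closure hp Λ A hξ hU hΩU hUΓ hΨU ht
  have hC : ContDiffOn ℝ 2 (fun t => energy p q Λ A ξ Ω (Ψ t)) (Icc 0 1) :=
    contDiffOn_energy hp Λ A hξ hΩ hU hΩU hUΓ hΨU 2
  refine ⟨hfin, sphereIntegrable_gradDistSq hp hΛ hξ1 hΩ hΨ hsymm hgeo hfin, hC, fun t ht => ?_⟩
  have hu := uniqueDiffOn_Icc (zero_lt_one (α := ℝ))
  refine energy_second_deriv_ge hp hΛ hξ1 hΩ hΨ hsymm hgeo hfin ht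
    (E' := derivWithin (fun t => energy p q Λ A ξ Ω (Ψ t)) (Icc 0 1)) ?_ ?_
  · filter_upwards [self_mem_nhdsWithin] with s hs
    exact ((hC.differentiableOn (by simp)) s hs).hasDerivWithinAt
  · have hC1 : ContDiffOn ℝ 1 (derivWithin (fun t => energy p q Λ A ξ Ω (Ψ t)) (Icc 0 1)) (Icc 0 1) :=
      hC.derivWithin hu (by norm_num)
    have e : iteratedDerivWithin 2 (fun t => energy p q Λ A ξ Ω (Ψ t)) (Icc 0 1) t =
        derivWithin (derivWithin (fun t => energy p q Λ A ξ Ω (Ψ t)) (Icc 0 1)) (Icc 0 1) t := by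
      rw [iteratedDerivWithin_succ, iteratedDerivWithin_one]
    rw [e]
    exact ((hC1.differentiableOn (by simp)) t ht).hasDerivWithinAt
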